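/- Let $\mathfrak g$ be a finite-dimensional real Lie algebra, $\mathfrak a,\mathfrak b\subset\mathfrak g$ linear subspaces with $\mathfrak a\cap\mathfrak b=0$, $k=\dim\mathfrak a$, and let $\mathcal A\subset\mathrm{Hom}(\mathfrak a,\mathfrak b)$ be a linear subspace. Put $\rho(F)(A_1,A_2)=\frac12\big(F(A_1)(A_2)-F(A_2)(A_1)\big)$ for $F\in\mathrm{Hom}(\mathfrak a,\mathcal A)$ and $\mathcal A^{(1)}=\ker\rho$. For a complete flag $\ell:0=\mathfrak a_0\subset\mathfrak a_1\subset\dots\subset\mathfrak a_k=\mathfrak a$ put $\mathcal A_j(\ell)=\{Q\in\mathcal A: Q|_{\mathfrak a_j}=0\}$; $\ell$ is generic if every $\dim\mathcal A_j(\ell)$ is minimal among all flags, and the characters $s'_1,\dots,s'_k$ of $\mathcal A$ are defined by $s'_1+\dots+s'_j=\dim\mathcal A-\dim\mathcal A_j(\ell)$ for $\ell$ generic. Assume that $\mathcal A$ is a tableau over $\mathfrak g$, that is: 1. $[A_1+Q(A_1),A_2+Q(A_2)]\in\mathfrak a\oplus\mathfrak b$ for all $Q\in\mathcal A$, $A_1,A_2\in\mathfrak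 a$; 2. for every $Q\in\mathcal A$ the form $\tau_Q(A_1,A_2)=[A_1+Q(A_1),A_2+Q(A_2)]_{\mathfrak b}-Q\big([A_1+Q(A_1),A_2+Q(A_2)]_{\mathfrak a}\big)$ lies in the image of $\rho$; 3. $\mathcal A$ is involutive: $\dim\mathcal A^{(1)}=s'_1+2s'_2+\dots+ks'_k$. Let $G$ be a connected Lie group with Lie algebra $\mathfrak g$. Let $(A_1,\dots,A_k,B_1,\dots,B_h,C_1,\dots,C_s)$ be a basis of $\mathfrak g$ such that the $A_i$ span $\mathfrak a$, the $B_j$ span $\mathfrak b$ and the flag of the $\mathrm{span}\{A_1,\dots,A_j\}$ is generic, and let $(\alpha^i,\beta^j,\gamma^a)$ be the dual coframe of left-invariant $1$-forms on $G$. Let $Q_\epsilon=Q^j_{\epsilon i}B_j\otimes\alpha^i$ ($\epsilon=1,\dots,m$) be a basis of $\mathcal A$, and identify $Y=G\times\mathcal A$ with $G\times\mathbb R^m$ by $(g,p^\epsilon Q_\epsilon)\leftrightarrow(g,p^1,\dots,p^m)$. Let $\mathcal I$ be the differential ideal on $Y$ generated by the $1$-forms $$\eta^j=\beta^j-p^\epsilon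 Q^j_{\epsilon i}\alpha^i\quad(1\le j\le h),\qquad \gamma^a\quad(1\le a\le s),$$ with independence condition $\omega=\alpha^1\wedge\dots\wedge\alpha^k\ne0$. Then: * $(\mathcal I,\omega)$ is a linear Pfaffian system: the forms $\eta^j,\gamma^a,\alpha^i$ are smooth and pointwise linearly independent, and $d\eta^j$, $d\gamma^a$ lie in the algebraic ideal generated by the $\eta^j,\gamma^a,\alpha^i$; * $(\mathcal I,\omega)$ is in involution: at every $y\in Y$ there is a $k$-dimensional integral element $E\subset T_yY$ of $\mathcal I$ with $\omega|_E\neq0$ that is ordinary, i.e. the end of an integral flag $0=E_0\subset E_1\subset\dots\subset E_k=E$ with $y$ an ordinary zero of the functions in $\mathcal I$ and $E_0,\dots,E_{k-1}$ Kähler-regular; * the Cartan characters of $(\mathcal I,\omega)$ are those of $\mathcal A$: for every such flag, at every $y\in Y$, one has $c_j-c_{j-1}=s'_j$ for $1\le j\le k$, where $c_p$ is the codimension in $T_yY$ of the polar space of $E_p$ for $p<k$, and $c_k$ is the codimension of $E_k$. -/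

import Mathlib

open scoped Manifold ContDiff Topology

/-! ## Tableaux over a Lie algebra -/

namespace LieTableau

section Algebra

variable {K : Type*} [Field K] {V W : Type*} [AddCommGroup V] [Module K V]
  [AddCommGroup W] [Module K W]

/-- A complete flag `0 = V_0 ⊂ V_1 ⊂ ⋯ ⊂ V_k = V` of a `k`-dimensional space `V`, with
`dim V_j = j`.  (Past `k` the sequence is forced to be constantly `V`.) -/
structure CompleteFlag (K V : Type*) [Field K] [AddCommGroup V] [Module K V] where
  space : ℕ → Submodule K V
  mono : Monotone space
  finrank_eq : ∀ j ≤ Module.finrank K V, Module.finrank K (space j) = j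

/-- `A_j(ℓ) = {Q ∈ A : Q vanishes on ℓ_j}`. -/
def restrictedKer (A : Submodule K (V →ₗ[K] W)) (ℓ : CompleteFlag K V) (j : ℕ) :
    Submodule K (V →ₗ[K] W) where
  carrier := {Q | Q ∈ A ∧ ∀ v ∈ ℓ.space j, Q v = 0}
  add_mem' := fun {P Q} hP hQ =>
    ⟨A.add_mem hP.1 hQ.1, fun v hv => by simp [hP.2 v hv, hQ.2 v hv]⟩
  zero_mem' := ⟨A.zero_mem, fun _ _ => rfl⟩
  smul_mem' := fun c Q hQ => ⟨A.smul_mem c hQ.1, fun v hv => by simp [hQ.2 v hv]⟩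

/-- The minimum of `dim A_j(ℓ)` over all complete flags `ℓ`. -/
noncomputable def minDim (A : Submodule K (V →ₗ[K] W)) (j : ℕ) : ℕ :=
  sInf (Set.range fun ℓ : CompleteFlag K V => Module.finrank K (restrictedKer A ℓ j))

/-- A flag is generic with respect to `A` if every `dim A_j(ℓ)` is a minimum. -/
def IsGeneric (A : Submodule K (V →ₗ[K] W)) (ℓ : CompleteFlag K V) : Prop :=
  ∀ j ≤ Module.finrank K V, Module.finrank K (restrictedKer A ℓ j) = minDim A j

/-- The characters `s'_j` (`1 ≤ j ≤ dim V`) of `A`, determined by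
`s'_1 + ⋯ + s'_j = dim A - dim A_j(ℓ)` for a generic flag `ℓ`; see `sum_character`. -/
noncomputable def character (A : Submodule K (V →ₗ[K] W)) (j : ℕ) : ℕ :=
  minDim A (j - 1) - minDim A j

/-- The linear map `ρ(F)(v₁, v₂) = (F(v₁)(v₂) - F(v₂)(v₁)) / 2`, with values in the bilinear maps
(it takes its values in the alternating ones). -/
noncomputable def rho (A : Submodule K (V →ₗ[K] W)) :
    (V →ₗ[K] A) →ₗ[K] (V →ₗ[K] V →ₗ[K] W) where
  toFun F := (2 : K)⁻¹ • (A.subtype ∘ₗ F - (A.subtype ∘ₗ F).flip)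
  map_add' F F' := by ext; simp; module
  map_smul' c F := by ext; simp; module

/-- The first prolongation `A^(1)` of `A`. -/
noncomputable def prolongation (A : Submodule K (V →ₗ[K] W)) : Submodule K (V →ₗ[K] A) :=
  LinearMap.ker (rho A)

/-- `A` is involutive: `dim A^(1) = s'_1 + 2 s'_2 + ⋯ + k s'_k`. -/
def IsInvolutive (A : Submodule K (V →ₗ[K] W)) : Prop :=
  Module.finrank K (prolongation A) =
    ∑ j ∈ Finset.Icc 1 (Module.finrank K V), j * character A j

theorem restrictedKer_antitone (A : Submodule K (V →ₗ[K] W)) (ℓ : CompleteFlag K V) :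
    Antitone (restrictedKer A ℓ) :=
  fun _ _ hij _ hQ => ⟨hQ.1, fun v hv => hQ.2 v (ℓ.mono hij hv)⟩

/-- The defining property of the characters. -/
theorem sum_character [FiniteDimensional K V] [FiniteDimensional K W]
    (A : Submodule K (V →ₗ[K] W)) (ℓ : CompleteFlag K V) (hℓ : IsGeneric A ℓ) (j : ℕ)
    (hj : j ≤ Module.finrank K V) :
    ∑ i ∈ Finset.Icc 1 j, character A i + Module.finrank K (restrictedKer A ℓ j) =
      Module.finrank K A := by
  induction j with
  | zero =>
    have h0 : ℓ.space 0 = ⊥ := Submodule.finrank_eq_zero.mp (ℓ.finrank_eq 0 (Nat.zero_le _))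
    have : restrictedKer A ℓ 0 = A := by
      ext Q
      simp [restrictedKer, h0]
    rw [this]
    simp
  | succ j ih =>
    have ih' := ih (by omega)
    rw [Finset.sum_Icc_succ_top (by omega)]
    have hle : Module.finrank K (restrictedKer A ℓ (j + 1)) ≤
        Module.finrank K (restrictedKer A ℓ j) :=
      Submodule.finrank_mono (restrictedKer_antitone A ℓ (Nat.le_succ j))
    have hc : character A (j + 1) = Module.finrank K (restrictedKer A ℓ j) -
        Module.finrank K (restrictedKer A ℓ (j + 1)) := by
      rw [hℓ j (by omega), hℓ (j + 1) hj]
      rfl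
    omega

end Algebra

section LieAlgebra

variable {K : Type*} [Field K] {𝔤 : Type*} [LieRing 𝔤] [LieAlgebra K 𝔤]

/-- The components `(X_𝔞, X_𝔟)` of an element `X` of `𝔞 ⊕ 𝔟` (when `𝔞 ∩ 𝔟 = 0`; the value is
irrelevant for `X ∉ 𝔞 + 𝔟`). -/
noncomputable def components (𝔞 𝔟 : Submodule K 𝔤) (X : 𝔤) : 𝔞 × 𝔟 :=
  Function.invFun (fun p : 𝔞 × 𝔟 => (p.1 : 𝔤) + (p.2 : 𝔤)) X

variable {𝔞 𝔟 : Submodule K 𝔤}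

/-- `[A₁ + Q(A₁), A₂ + Q(A₂)]`. -/
def graphBracket (Q : 𝔞 →ₗ[K] 𝔟) (A₁ A₂ : 𝔞) : 𝔤 :=
  ⁅(A₁ : 𝔤) + (Q A₁ : 𝔤), (A₂ : 𝔤) + (Q A₂ : 𝔤)⁆

/-- `τ_Q(A₁, A₂) = [A₁ + Q(A₁), A₂ + Q(A₂)]_𝔟 - Q([A₁ + Q(A₁), A₂ + Q(A₂)]_𝔞)`. -/
noncomputable def tau (Q : 𝔞 →ₗ[K] 𝔟) (A₁ A₂ : 𝔞) : 𝔟 :=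
  (components 𝔞 𝔟 (graphBracket Q A₁ A₂)).2 - Q (components 𝔞 𝔟 (graphBracket Q A₁ A₂)).1

/-- A tableau over the Lie algebra `𝔤`: a linear subspace `A` of `Hom(𝔞, 𝔟)`, with
`𝔞 ∩ 𝔟 = 0`, such that for each `Q ∈ A` the form `R_Q`, i.e. the class of
`[A₁ + Q(A₁), A₂ + Q(A₂)]` in `𝔤 / (𝔞 ⊕ 𝔟)`, vanishes and `τ_Q` is in the image of `ρ`, and such
that `A` is involutive. -/
structure IsTableauOver (A : Submodule K (𝔞 →ₗ[K] 𝔟)) : Prop where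
  disjoint : Disjoint 𝔞 𝔟
  R_eq_zero : ∀ Q ∈ A, ∀ A₁ A₂ : 𝔞, (𝔞 ⊔ 𝔟).mkQ (graphBracket Q A₁ A₂) = 0
  tau_mem : ∀ Q ∈ A, ∃ F : 𝔞 →ₗ[K] A, ∀ A₁ A₂ : 𝔞, rho A F A₁ A₂ = tau Q A₁ A₂
  involutive : IsInvolutive A

/-- A basis `(A_1, …, A_k, B_1, …, B_h, C_1, …, C_s)` of `𝔤` such that the `A_i` span `𝔞` and the
`B_j` span `𝔟`. -/
structure AdaptedBasis (𝔞 𝔟 : Submodule K 𝔤) (k h s : ℕ) where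
  basis : Module.Basis (Fin k ⊕ Fin h ⊕ Fin s) K 𝔤
  span_A : Submodule.span K (Set.range fun i => basis (Sum.inl i)) = 𝔞
  span_B : Submodule.span K (Set.range fun j => basis (Sum.inr (Sum.inl j))) = 𝔟

namespace AdaptedBasis

variable {k h s : ℕ}

/-- The vector `A_i`, as an element of `𝔞`. -/
noncomputable def vecA (𝓑 : AdaptedBasis 𝔞 𝔟 k h s) (i : Fin k) : 𝔞 :=
  ⟨𝓑.basis (Sum.inl i), by
    have := Submodule.subset_span (R := K) (Set.mem_range_self (f := fun i =>
      𝓑.basis (Sum.inl i)) i)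
    rwa [𝓑.span_A] at this⟩

/-- The adapted basis is generic: the flag of the `span {A_1, …, A_j}` is generic with respect
to `A`. -/
def IsGeneric (𝓑 : AdaptedBasis 𝔞 𝔟 k h s) (A : Submodule K (𝔞 →ₗ[K] 𝔟)) : Prop :=
  ∃ ℓ : CompleteFlag K 𝔞, LieTableau.IsGeneric A ℓ ∧
    ∀ j ≤ k, ℓ.space j = Submodule.span K (𝓑.vecA '' {i | (i : ℕ) < j})

/-- The coefficients `Q^j_{εi}` in `Q_ε = Q^j_{εi} B_j ⊗ α^i`. -/
noncomputable def coeff (𝓑 : AdaptedBasis 𝔞 𝔟 k h s) {A : Submodule K (𝔞 →ₗ[K] 𝔟)} {m : ℕ}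
    (Q : Module.Basis (Fin m) K A) (j : Fin h) (ε : Fin m) (i : Fin k) : K :=
  𝓑.basis.coord (Sum.inr (Sum.inl j)) ((Q ε : 𝔞 →ₗ[K] 𝔟) (𝓑.vecA i) : 𝔤)

end AdaptedBasis

end LieAlgebra

end LieTableau

/-! ## Exterior differential systems

Throughout, `M` is a smooth manifold without boundary, modelled on a finite-dimensional real
space `E`. -/

namespace EDS

section Pointwise

variable {V : Type*} [AddCommGroup V] [Module ℝ V] [TopologicalSpace V]

/-- The multilinear map `(v_1, …, v_n) ↦ φ(v_1, …, v_p) ψ(v_{p+1}, …, v_n)`, `n = p + q`. -/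
noncomputable def tensorMul {p q n : ℕ} (h : p + q = n) (φ : V [⋀^Fin p]→L[ℝ] ℝ)
    (ψ : V [⋀^Fin q]→L[ℝ] ℝ) : ContinuousMultilinearMap ℝ (fun _ : Fin n => V) ℝ where
  toMultilinearMap := (LinearMap.mul' ℝ ℝ).compMultilinearMap
    (MultilinearMap.domDomCongr (finSumFinEquiv.trans (finCongr h))
      (MultilinearMap.domCoprod φ.toMultilinearMap ψ.toMultilinearMap))
  cont := by
    have : Continuous fun v : Fin n → V =>
        φ (fun i => v (Fin.cast h (Fin.castAdd q i))) *
          ψ (fun j => v (Fin.cast h (Fin.natAdd p j))) := by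
      refine Continuous.mul (φ.cont.comp ?_) (ψ.cont.comp ?_) <;> fun_prop
    exact this

theorem tensorMul_apply {p q n : ℕ} (h : p + q = n) (φ : V [⋀^Fin p]→L[ℝ] ℝ)
    (ψ : V [⋀^Fin q]→L[ℝ] ℝ) (v : Fin n → V) :
    tensorMul h φ ψ v = φ (fun i => v (Fin.cast h (Fin.castAdd q i))) *
      ψ (fun j => v (Fin.cast h (Fin.natAdd p j))) := rfl

/-- The wedge product
`(φ ∧ ψ)(v_1, …, v_n) = 1/(p! q!) ∑_σ sgn(σ) φ(v_σ(1), …, v_σ(p)) ψ(v_σ(p+1), …, v_σ(n))`. -/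
noncomputable def wedge {p q n : ℕ} (h : p + q = n) (φ : V [⋀^Fin p]→L[ℝ] ℝ)
    (ψ : V [⋀^Fin q]→L[ℝ] ℝ) : V [⋀^Fin n]→L[ℝ] ℝ :=
  ((p.factorial * q.factorial : ℕ) : ℝ)⁻¹ • (tensorMul h φ ψ).alternatization

/-- The wedge product `α_1 ∧ ⋯ ∧ α_k` of linear forms,
`(v_1, …, v_k) ↦ det (α_i(v_j))`; see `wedgeOneForms_apply`. -/
noncomputable def wedgeOneForms {k : ℕ} (α : Fin k → V [⋀^Fin 1]→L[ℝ] ℝ) : V [⋀^Fin k]→L[ℝ] ℝ :=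
  ((ContinuousMultilinearMap.mkPiAlgebra ℝ (Fin k) ℝ).compContinuousLinearMap fun i =>
    (ContinuousAlternatingMap.ofSubsingleton ℝ V ℝ (0 : Fin 1)).symm (α i)).alternatization

theorem wedgeOneForms_apply {k : ℕ} (α : Fin k → V [⋀^Fin 1]→L[ℝ] ℝ) (v : Fin k → V) :
    wedgeOneForms α v = (Matrix.of fun i j => α i (fun _ => v j)).det := by
  rw [wedgeOneForms, ContinuousMultilinearMap.alternatization_apply_apply,
    ← Matrix.det_transpose, Matrix.det_apply]
  rfl

end Pointwise

variable {E : Type*} [NormedAddCommGroup E] [NormedSpace ℝ E]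
  {H : Type*} [TopologicalSpace H] (I : ModelWithCorners ℝ E H)
  (M : Type*) [TopologicalSpace M] [ChartedSpace H M]

/-- (Not necessarily smooth) differential forms of degree `n` on `M`. -/
abbrev DForm (n : ℕ) : Type _ := ∀ x : M, TangentSpace I x [⋀^Fin n]→L[ℝ] ℝ

/-- Families of differential forms, of all degrees. -/
abbrev Family : Type _ := ∀ n : ℕ, DForm I M n → Prop

variable {I M}

namespace DForm

variable {n : ℕ}

/-- The expression of `φ` in the preferred chart at `x₀`: its pullback by the inverse chart. -/
noncomputable def inChart (φ : DForm I M n) (x₀ : M) : E → E [⋀^Fin n]→L[ℝ] ℝ := fun u =>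
  (φ ((extChartAt I x₀).symm u)).compContinuousLinearMap
    (mfderiv 𝓘(ℝ, E) I (extChartAt I x₀).symm u : E →L[ℝ] TangentSpace I _)

/-- `φ` is smooth. -/
def IsSmooth (φ : DForm I M n) : Prop :=
  ∀ x₀ : M, ContDiffOn ℝ ∞ (φ.inChart x₀) (extChartAt I x₀).target

/-- The exterior derivative, computed at `x` in the preferred chart at `x`. -/
noncomputable def d (φ : DForm I M n) : DForm I M (n + 1) := fun x =>
  (extDeriv (φ.inChart x) (extChartAt I x x)).compContinuousLinearMap
    (mfderiv I 𝓘(ℝ, E) (extChartAt I x) x : TangentSpace I x →L[ℝ] E)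

end DForm

/-- The algebraic ideal, in the ring of smooth differential forms, generated by a family of smooth
forms. -/
inductive AlgIdeal (S : Family I M) : Family I M
  | of {n : ℕ} {φ : DForm I M n} : S n φ → AlgIdeal S n φ
  | zero (n : ℕ) : AlgIdeal S n (0 : DForm I M n)
  | add {n : ℕ} {φ ψ : DForm I M n} :
      AlgIdeal S n φ → AlgIdeal S n ψ → AlgIdeal S n (φ + ψ)
  | wedge_right {p q n : ℕ} (h : p + q = n) {φ : DForm I M p} {ψ : DForm I M q} :
      AlgIdeal S p φ → ψ.IsSmooth → AlgIdeal S n (fun x => wedge h (φ x) (ψ x))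
  | wedge_left {p q n : ℕ} (h : p + q = n) {φ : DForm I M p} {ψ : DForm I M q} :
      φ.IsSmooth → AlgIdeal S q ψ → AlgIdeal S n (fun x => wedge h (φ x) (ψ x))

/-- The forms of `S` together with their exterior derivatives. -/
inductive WithDerivatives (S : Family I M) : Family I M
  | of {n : ℕ} {φ : DForm I M n} : S n φ → WithDerivatives S n φ
  | d {n : ℕ} {φ : DForm I M n} : S n φ → WithDerivatives S (n + 1) φ.d

/-- The differential ideal generated by a family `S` of smooth forms: it is generated
algebraically by the forms of `S` and their exterior derivatives (because `d ∘ d = 0`). -/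
def DiffIdeal (S : Family I M) : Family I M := AlgIdeal (WithDerivatives S)

/-- A collection of 1-forms, as a family of forms. -/
inductive OneForms {ι : Type*} (θ : ι → DForm I M 1) : Family I M
  | of (i : ι) : OneForms θ 1 (θ i)

/-- The 1-forms `θ_i` and `α_j` define a linear Pfaffian system: they are smooth and pointwise
linearly independent (so that `I = span {θ_i}` and `J = span {θ_i, α_j}` are subbundles of `T*M`
and the `α_j` project to a coframe of `J/I`), and `dI ≡ 0` modulo the algebraic ideal `{J}`
generated by the sections of `J`. -/
structure IsLinearPfaffian {ι : Type*} {k : ℕ} (θ : ι → DForm I M 1) (α : Fin k → DForm I M 1) :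
    Prop where
  smooth_θ : ∀ i, (θ i).IsSmooth
  smooth_α : ∀ i, (α i).IsSmooth
  linearIndependent : ∀ x : M, LinearIndependent ℝ
    (Sum.elim (fun i => θ i x) (fun i => α i x) : ι ⊕ Fin k → TangentSpace I x [⋀^Fin 1]→L[ℝ] ℝ)
  linear : ∀ i, AlgIdeal (OneForms (Sum.elim θ α)) 2 (θ i).d

/-- `S ⊆ T_x M` is an `n`-dimensional integral element of `𝓘`: `dim S = n` and all forms of `𝓘`
vanish on `S`. -/
def IsIntegralElement (𝓘 : Family I M) (n : ℕ) (x : M) (S : Submodule ℝ (TangentSpace I x)) :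
    Prop :=
  Module.finrank ℝ S = n ∧
    ∀ (p : ℕ) (φ : DForm I M p), 𝓘 p φ → ∀ v : Fin p → TangentSpace I x, (∀ i, v i ∈ S) → φ x v = 0

/-- The polar space `H(S) = {v : φ(v, e_1, …, e_p) = 0 for all φ ∈ 𝓘^{p+1} and e_1, …, e_p ∈ S}`
of a `p`-dimensional integral element `S`. -/
def polarSpace (𝓘 : Family I M) (p : ℕ) (x : M) (S : Submodule ℝ (TangentSpace I x)) :
    Submodule ℝ (TangentSpace I x) where
  carrier := {v | ∀ φ : DForm I M (p + 1), 𝓘 (p + 1) φ →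
    ∀ e : Fin p → TangentSpace I x, (∀ i, e i ∈ S) → φ x (Matrix.vecCons v e) = 0}
  add_mem' := fun {v w} hv hw φ hφ e he => by
    rw [ContinuousAlternatingMap.vecCons_add, hv φ hφ e he, hw φ hφ e he, add_zero]
  zero_mem' := fun φ _ e _ => (φ x).map_coord_zero (m := Matrix.vecCons 0 e) 0 rfl
  smul_mem' := fun c v hv φ hφ e he => by
    rw [ContinuousAlternatingMap.vecCons_smul, hv φ hφ e he, smul_zero]

/-! The Grassmann bundle `G_n(TM)` is the quotient of the bundle of `n`-frames of `M` by `GL_n`.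
Functions on, and neighbourhoods in, `G_n(TM)` are described by lifting them to `n`-frames along
this submersion.  The frames based in the domain of the preferred chart at `x₀` are parametrized by
the pairs `(u, w) ∈ E × Eⁿ`: `u` is the coordinate of the base point and `w` consists of the
coordinates of the vectors. -/

section Frames

variable {n : ℕ}

/-- The coordinates, in the preferred chart at `x`, of an `n`-frame at `x`. -/
noncomputable def frameCoord (x : M) (v : Fin n → TangentSpace I x) : E × (Fin n → E) :=
  (extChartAt I x x, fun i => mfderiv I 𝓘(ℝ, E) (extChartAt I x) x (v i))

variable (I) in
/-- The base point of the frame with coordinates `z` in the preferred chart at `x₀`. -/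
noncomputable def basePoint (x₀ : M) (z : E × (Fin n → E)) : M := (extChartAt I x₀).symm z.1

variable (I) in
/-- The frame with coordinates `z` in the preferred chart at `x₀`. -/
noncomputable def frameAt (x₀ : M) (z : E × (Fin n → E)) (i : Fin n) :
    TangentSpace I (basePoint I x₀ z) :=
  (mfderiv 𝓘(ℝ, E) I (extChartAt I x₀).symm z.1 : E →L[ℝ] TangentSpace I _) (z.2 i)

variable (I) in
/-- The plane spanned by the frame with coordinates `z`. -/
noncomputable def planeAt (x₀ : M) (z : E × (Fin n → E)) :
    Submodule ℝ (TangentSpace I (basePoint I x₀ z)) :=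
  Submodule.span ℝ (Set.range (frameAt I x₀ z))

/-- The function `φ_Ω` on `{S ∈ G_n(TM) : Ω_S ≠ 0}`, defined by `φ_S = φ_Ω(S) Ω_S`, in the
coordinates of frames. -/
noncomputable def formQuotient (φ Ω : DForm I M n) (x₀ : M) (z : E × (Fin n → E)) : ℝ :=
  φ (basePoint I x₀ z) (frameAt I x₀ z) / Ω (basePoint I x₀ z) (frameAt I x₀ z)

end Frames

/-- `z` is an ordinary zero of a set `F` of functions on a manifold (here, on a coordinate space):
all functions in `F` vanish at `z` and, near `z`, the common zeros of `F` are those of finitely many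
functions in `F` with linearly independent differentials. -/
def IsOrdinaryZero {V : Type*} [NormedAddCommGroup V] [NormedSpace ℝ V] (F : Set (V → ℝ)) (z : V) :
    Prop :=
  (∀ f ∈ F, f z = 0) ∧ ∃ (q : ℕ) (f : Fin q → V → ℝ), (∀ i, f i ∈ F) ∧
    ∀ᶠ w in 𝓝 z, LinearIndependent ℝ (fun i => fderiv ℝ (f i) w) ∧
      ((∀ g ∈ F, g w = 0) ↔ ∀ i, f i w = 0)

/-- The vectors `v_1, …, v_n` form a basis of `S`. -/
def IsFrameOf {n : ℕ} {x : M} (v : Fin n → TangentSpace I x) (S : Submodule ℝ (TangentSpace I x)) :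
    Prop :=
  LinearIndependent ℝ v ∧ Submodule.span ℝ (Set.range v) = S

/-- `S` is a Kähler-ordinary integral element: there is an `n`-form `Ω` with `Ω_S ≠ 0` such that
`S` is an ordinary zero of the set of functions `φ_Ω`, `φ ∈ 𝓘^n`. -/
def IsKahlerOrdinary (𝓘 : Family I M) (n : ℕ) (x : M) (S : Submodule ℝ (TangentSpace I x)) :
    Prop :=
  IsIntegralElement 𝓘 n x S ∧ ∃ Ω : DForm I M n, Ω.IsSmooth ∧ ∃ v : Fin n → TangentSpace I x,
    IsFrameOf v S ∧ Ω x v ≠ 0 ∧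
      IsOrdinaryZero {f | ∃ φ : DForm I M n, 𝓘 n φ ∧ f = formQuotient φ Ω x} (frameCoord x v)

/-- `S` is a Kähler-regular integral element: it is Kähler-ordinary and the dimension of the polar
space is constant on a neighbourhood of `S` in the space of Kähler-ordinary integral elements. -/
def IsKahlerRegular (𝓘 : Family I M) (n : ℕ) (x : M) (S : Submodule ℝ (TangentSpace I x)) : Prop :=
  IsKahlerOrdinary 𝓘 n x S ∧ ∃ v : Fin n → TangentSpace I x, IsFrameOf v S ∧
    ∀ᶠ z in 𝓝 (frameCoord x v), IsKahlerOrdinary 𝓘 n (basePoint I x z) (planeAt I x z) →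
      Module.finrank ℝ (polarSpace 𝓘 n (basePoint I x z) (planeAt I x z)) =
        Module.finrank ℝ (polarSpace 𝓘 n x S)

/-- An ordinary integral flag `0 = S_0 ⊂ S_1 ⊂ ⋯ ⊂ S_n ⊆ T_x M`: the base point is an ordinary zero
of the functions in `𝓘` (that is, `S_0` is Kähler-ordinary), and `S_p` is Kähler-regular
for `p < n`. -/
structure IsOrdinaryFlag (𝓘 : Family I M) (n : ℕ) (x : M)
    (S : ℕ → Submodule ℝ (TangentSpace I x)) : Prop where
  le_succ : ∀ p < n, S p ≤ S (p + 1)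
  integral : ∀ p ≤ n, IsIntegralElement 𝓘 p x (S p)
  base : IsKahlerOrdinary 𝓘 0 x (S 0)
  regular : ∀ p < n, IsKahlerRegular 𝓘 p x (S p)

/-- An ordinary integral element of dimension `n`: the end of an ordinary integral flag. -/
def IsOrdinaryElement (𝓘 : Family I M) (n : ℕ) (x : M) (S : Submodule ℝ (TangentSpace I x)) :
    Prop :=
  ∃ F : ℕ → Submodule ℝ (TangentSpace I x), IsOrdinaryFlag 𝓘 n x F ∧ F n = S

/-- `S` belongs to `V_n(𝓘, Ω)`: it is an `n`-dimensional integral element with `Ω_S ≠ 0`. -/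
def IsIntegralElementOf (𝓘 : Family I M) {n : ℕ} (Ω : DForm I M n) (x : M)
    (S : Submodule ℝ (TangentSpace I x)) : Prop :=
  IsIntegralElement 𝓘 n x S ∧ ∃ v : Fin n → TangentSpace I x, (∀ i, v i ∈ S) ∧ Ω x v ≠ 0

/-- `(𝓘, Ω)` is in involution: at every point there is an ordinary integral element in
`V_n(𝓘, Ω)`. -/
def IsInInvolution (𝓘 : Family I M) {n : ℕ} (Ω : DForm I M n) : Prop :=
  ∀ x : M, ∃ S : Submodule ℝ (TangentSpace I x),
    IsIntegralElementOf 𝓘 Ω x S ∧ IsOrdinaryElement 𝓘 n x S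

/-- For an integral flag `S_0 ⊂ ⋯ ⊂ S_n` at `x`: `c_p` is the codimension of the polar space
`H(S_p)` for `p < n`, and `c_n` is the codimension of `S_n`. -/
noncomputable def polarCodim (𝓘 : Family I M) (n : ℕ) (x : M)
    (S : ℕ → Submodule ℝ (TangentSpace I x)) (p : ℕ) : ℤ :=
  Module.finrank ℝ (TangentSpace I x) -
    if p < n then (Module.finrank ℝ (polarSpace 𝓘 p x (S p)) : ℤ) else Module.finrank ℝ (S n)

/-- The Cartan characters `s_0 = c_0`, `s_p = c_p - c_{p-1}` (`1 ≤ p ≤ n`) of an ordinary integral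
flag. -/
noncomputable def cartanCharacter (𝓘 : Family I M) (n : ℕ) (x : M)
    (S : ℕ → Submodule ℝ (TangentSpace I x)) : ℕ → ℤ
  | 0 => polarCodim 𝓘 n x S 0
  | p + 1 => polarCodim 𝓘 n x S (p + 1) - polarCodim 𝓘 n x S p

/-- The Cartan characters of the system `(𝓘, Ω)` are `s_1, …, s_n`: the system has an ordinary
integral element in `V_n(𝓘, Ω)` at every point, and every ordinary integral flag ending in
`V_n(𝓘, Ω)` has these characters. -/
def HasCartanCharacters (𝓘 : Family I M) {n : ℕ} (Ω : DForm I M n) (s : ℕ → ℕ) : Prop :=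
  IsInInvolution 𝓘 Ω ∧
    ∀ (x : M) (F : ℕ → Submodule ℝ (TangentSpace I x)), IsOrdinaryFlag 𝓘 n x F →
      IsIntegralElementOf 𝓘 Ω x (F n) →
        ∀ j ∈ Finset.Icc 1 n, cartanCharacter 𝓘 n x F j = (s j : ℤ)

end EDS

/-! ## The Pfaffian system associated with a tableau -/

namespace LieTableau

open EDS

variable {E : Type*} [NormedAddCommGroup E] [NormedSpace ℝ E] [FiniteDimensional ℝ E]
  [CompleteSpace E]
  {G : Type*} [TopologicalSpace G] [ChartedSpace E G] [Group G] [LieGroup 𝓘(ℝ, E) ∞ G]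
  {𝔤 : Type*} [LieRing 𝔤] [LieAlgebra ℝ 𝔤]

/-- A smooth Lie group is regular enough for the Lie bracket on its tangent space at `1`. -/
instance instLieGroupMinSmoothness {E : Type*} [NormedAddCommGroup E] [NormedSpace ℝ E]
    {G : Type*} [TopologicalSpace G] [ChartedSpace E G] [Group G] [LieGroup 𝓘(ℝ, E) ∞ G] :
    LieGroup 𝓘(ℝ, E) (minSmoothness ℝ 3) G := by
  rw [minSmoothness_of_isRCLikeNormedField]
  infer_instance

/-- The model of the configuration space `Y = G × A ≅ G × ℝ^m`, where a basis `Q_1, …, Q_m` of the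
tableau `A` identifies `(g, p^1, …, p^m)` with `(g, p^ε Q_ε)`. -/
noncomputable abbrev modelY (E : Type*) [NormedAddCommGroup E] [NormedSpace ℝ E] (m : ℕ) :
    ModelWithCorners ℝ (E × (Fin m → ℝ)) (ModelProd E (Fin m → ℝ)) :=
  𝓘(ℝ, E).prod 𝓘(ℝ, Fin m → ℝ)

/-- The left-invariant 1-form on `G`, pulled back to `G × ℝ^m`, defined by a linear form `ξ` on the
Lie algebra `𝔤` of `G`: `X ↦ ξ(dL_{g⁻¹} X)`. -/
noncomputable def leftInvariantForm (e : GroupLieAlgebra 𝓘(ℝ, E) G ≃ₗ⁅ℝ⁆ 𝔤) (m : ℕ)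
    (ξ : 𝔤 →ₗ[ℝ] ℝ) : DForm (modelY E m) (G × (Fin m → ℝ)) 1 := fun y =>
  let ξ' : E →L[ℝ] ℝ := LinearMap.toContinuousLinearMap
    (ξ ∘ₗ (e : GroupLieAlgebra 𝓘(ℝ, E) G →ₗ[ℝ] 𝔤) : E →ₗ[ℝ] ℝ)
  let L : TangentSpace 𝓘(ℝ, E) y.1 →L[ℝ] E :=
    mfderiv 𝓘(ℝ, E) 𝓘(ℝ, E) (fun x : G => y.1⁻¹ * x) y.1
  let pr : TangentSpace (modelY E m) y →L[ℝ] TangentSpace 𝓘(ℝ, E) y.1 :=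
    mfderiv (modelY E m) 𝓘(ℝ, E) (Prod.fst : G × (Fin m → ℝ) → G) y
  ContinuousAlternatingMap.ofSubsingleton ℝ _ ℝ 0 (ξ'.comp (L.comp pr))

variable {𝔞 𝔟 : Submodule ℝ 𝔤} {k h s m : ℕ}

/-- The form `α^i`. -/
noncomputable def alphaForm (e : GroupLieAlgebra 𝓘(ℝ, E) G ≃ₗ⁅ℝ⁆ 𝔤)
    (𝓑 : AdaptedBasis 𝔞 𝔟 k h s) (m : ℕ) (i : Fin k) :
    DForm (modelY E m) (G × (Fin m → ℝ)) 1 :=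
  leftInvariantForm e m (𝓑.basis.coord (Sum.inl i))

/-- The form `β^j`. -/
noncomputable def betaForm (e : GroupLieAlgebra 𝓘(ℝ, E) G ≃ₗ⁅ℝ⁆ 𝔤)
    (𝓑 : AdaptedBasis 𝔞 𝔟 k h s) (m : ℕ) (j : Fin h) :
    DForm (modelY E m) (G × (Fin m → ℝ)) 1 :=
  leftInvariantForm e m (𝓑.basis.coord (Sum.inr (Sum.inl j)))

/-- The form `γ^a`. -/
noncomputable def gammaForm (e : GroupLieAlgebra 𝓘(ℝ, E) G ≃ₗ⁅ℝ⁆ 𝔤)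
    (𝓑 : AdaptedBasis 𝔞 𝔟 k h s) (m : ℕ) (a : Fin s) :
    DForm (modelY E m) (G × (Fin m → ℝ)) 1 :=
  leftInvariantForm e m (𝓑.basis.coord (Sum.inr (Sum.inr a)))

/-- The form `η^j = β^j - p^ε Q^j_{εi} α^i`. -/
noncomputable def etaForm (e : GroupLieAlgebra 𝓘(ℝ, E) G ≃ₗ⁅ℝ⁆ 𝔤)
    (𝓑 : AdaptedBasis 𝔞 𝔟 k h s) {A : Submodule ℝ (𝔞 →ₗ[ℝ] 𝔟)}
    (Q : Module.Basis (Fin m) ℝ A) (j : Fin h) : DForm (modelY E m) (G × (Fin m → ℝ)) 1 := fun y =>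
  betaForm e 𝓑 m j y - ∑ ε : Fin m, ∑ i : Fin k, (y.2 ε * 𝓑.coeff Q j ε i) • alphaForm e 𝓑 m i y

/-- The generators `η^1, …, η^h, γ^1, …, γ^s` of the system associated with `A`. -/
noncomputable def generators (e : GroupLieAlgebra 𝓘(ℝ, E) G ≃ₗ⁅ℝ⁆ 𝔤)
    (𝓑 : AdaptedBasis 𝔞 𝔟 k h s) {A : Submodule ℝ (𝔞 →ₗ[ℝ] 𝔟)} (Q : Module.Basis (Fin m) ℝ A) :
    Fin h ⊕ Fin s → DForm (modelY E m) (G × (Fin m → ℝ)) 1 :=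
  Sum.elim (etaForm e 𝓑 Q) (gammaForm e 𝓑 m)

/-- The exterior differential ideal of the system associated with `A`. -/
noncomputable def systemIdeal (e : GroupLieAlgebra 𝓘(ℝ, E) G ≃ₗ⁅ℝ⁆ 𝔤)
    (𝓑 : AdaptedBasis 𝔞 𝔟 k h s) {A : Submodule ℝ (𝔞 →ₗ[ℝ] 𝔟)} (Q : Module.Basis (Fin m) ℝ A) :
    Family (modelY E m) (G × (Fin m → ℝ)) :=
  DiffIdeal (OneForms (generators e 𝓑 Q))

/-- The independence form `ω = α^1 ∧ ⋯ ∧ α^k`. -/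
noncomputable def independenceForm (e : GroupLieAlgebra 𝓘(ℝ, E) G ≃ₗ⁅ℝ⁆ 𝔤)
    (𝓑 : AdaptedBasis 𝔞 𝔟 k h s) (m : ℕ) : DForm (modelY E m) (G × (Fin m → ℝ)) k := fun y =>
  wedgeOneForms fun i => alphaForm e 𝓑 m i y

end LieTableau

/-! Left translation trivializes `T_yY` as `𝔤 × ℝ^m`. At `y = (g, Q)` the vectors killed by all
`η^j`, `γ^a` are those whose `𝔤`-part is `x + Q(x)` with `x ∈ 𝔞`, the fibre part being free. The
forms `η`, `γ`, `α` span all left-invariant forms, so by the structure equations the system is a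
linear Pfaffian system. On two zeros of the generators the derivatives give the bracket `[x₁ +
Q(x₁), x₂ + Q(x₂)]` modulo the graph of `Q`, plus a skew expression in the fibre parts. The first
condition reduces the bracket term to `τ_Q`, and the second allows `τ_Q` to be absorbed into a shift
of the fibre part (`torsionPotential`). The zeros of the generators at `y` are thus parametrized by
pairs `(x, P) ∈ 𝔞 × A` (`zeroVector`), and the derivatives kill two of them exactly when `P₁(x₂) =
P₂(x₁)` (`d_generators_zeroVector_eq_zero_iff`). Integral elements over a sequence in `𝔞` become
symmetric tuples in `A` (`symTuple`).

The algebraic core is Cartan's test. Over a generic sequence, dropping the last member of a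
symmetric `(p + 1)`-tuple has a kernel of dimension at most `dim A_p`, so `dim A^(1) ≤ ∑ dim A_j`.
Summation by parts shows that involutivity is equality here; every such map is then onto, and every
symmetric tuple extends to a member of the prolongation (`IsGenericTuple.exists_prolongation`). This
yields polar spaces of dimension `k + dim A_p` (`finrank_polarSpace`). The dimension of the space of
symmetric tuples depends on `p` only, so a maximal independent set of symmetry equations remains
sufficient for nearby sequences (`IsGenericTuple.exists_independent_equations`). With
`isKahlerOrdinary_span`, integral elements over generic sequences are therefore Kähler-ordinary, and
Kähler-regular because genericity is open. The zero tuple provides an ordinary flag at every point.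

An arbitrary ordinary flag may lie over a non-generic sequence. Its last member projects onto `𝔞`,
so each smaller member can be moved slightly inside it into generic position, and regularity carries
the polar dimension back (`finrank_polarSpace_of_isOrdinaryFlag`). The characters are the
differences of these dimensions. -/

namespace EDS

/-! ### Wedge products evaluated on frames -/

section Pointwise

variable {V : Type*} [AddCommGroup V] [Module ℝ V] [TopologicalSpace V]

theorem wedge_apply {p q n : ℕ} (h : p + q = n) (φ : V [⋀^Fin p]→L[ℝ] ℝ)
    (ψ : V [⋀^Fin q]→L[ℝ] ℝ) (v : Fin n → V) :
    wedge h φ ψ v = ((p.factorial * q.factorial : ℕ) : ℝ)⁻¹ *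
      ∑ σ : Equiv.Perm (Fin n), ((Equiv.Perm.sign σ : ℤ) : ℝ) *
        (φ (fun i => v (σ (Fin.cast h (Fin.castAdd q i)))) *
          ψ (fun j => v (σ (Fin.cast h (Fin.natAdd p j))))) := by
  rw [wedge, ContinuousAlternatingMap.smul_apply,
    ContinuousMultilinearMap.alternatization_apply_apply, smul_eq_mul]
  congr 1
  refine Finset.sum_congr rfl fun σ _ => ?_
  rw [tensorMul_apply]
  simp [Units.smul_def]

theorem wedge_one_one_apply (φ ψ : V [⋀^Fin 1]→L[ℝ] ℝ) (v : Fin 2 → V) :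
    wedge (n := 2) rfl φ ψ v =
      φ (fun _ => v 0) * ψ (fun _ => v 1) - φ (fun _ => v 1) * ψ (fun _ => v 0) := by
  have hu : (Finset.univ : Finset (Equiv.Perm (Fin 2))) = {1, Equiv.swap 0 1} := by decide
  have e0 : ∀ i : Fin 1, Fin.cast (rfl : 1 + 1 = 2) (Fin.castAdd 1 i) = 0 := by decide
  have e1 : ∀ i : Fin 1, Fin.cast (rfl : 1 + 1 = 2) (Fin.natAdd 1 i) = 1 := by decide
  rw [wedge_apply, hu, Finset.sum_pair (by decide)]
  simp only [e0, e1]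
  simp
  ring

open TensorProduct in
/-- The shuffle formula for the wedge product. -/
theorem wedge_eq_domCoprod {p q n : ℕ} (h : p + q = n) (φ : V [⋀^Fin p]→L[ℝ] ℝ)
    (ψ : V [⋀^Fin q]→L[ℝ] ℝ) (v : Fin n → V) :
    wedge h φ ψ v = LinearMap.mul' ℝ ℝ
      (φ.toAlternatingMap.domCoprod ψ.toAlternatingMap
        (v ∘ finSumFinEquiv.trans (finCongr h))) := by
  subst h
  have key := congrArg (fun F => LinearMap.mul' ℝ ℝ (F (v ∘ finSumFinEquiv)))
    (MultilinearMap.domCoprod_alternization_eq φ.toAlternatingMap ψ.toAlternatingMap)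
  simp only [Fintype.card_fin, AlternatingMap.smul_apply, map_nsmul] at key
  have hne : ((p.factorial * q.factorial : ℕ) : ℝ) ≠ 0 := by positivity
  rw [wedge_apply, inv_mul_eq_iff_eq_mul₀ hne]
  have e2 : finSumFinEquiv.trans (finCongr (rfl : p + q = p + q)) = finSumFinEquiv := by
    ext; simp
  rw [e2]
  rw [nsmul_eq_mul] at key
  rw [← key, MultilinearMap.alternatization_apply, map_sum]
  -- Permutations of `Fin (p + q)` are conjugated to permutations of `Fin p ⊕ Fin q`, which
  -- preserves signs.
  refine Fintype.sum_equiv (finSumFinEquiv.symm.permCongr) _ _ fun σ => ?_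
  simp only [MultilinearMap.domDomCongr_apply, Units.smul_def,
    MultilinearMap.domCoprod_apply, Equiv.permCongr_apply, Equiv.Perm.sign_permCongr, map_zsmul]
  simp

/-- The wedge product with a product of covectors dual to the last vectors of a frame is a
contraction. -/
theorem wedge_wedgeOneForms_of_dual {q r n : ℕ} (h : q + r = n) (φ : V [⋀^Fin q]→L[ℝ] ℝ)
    (β : Fin r → V [⋀^Fin 1]→L[ℝ] ℝ) (w : Fin n → V)
    (h₁ : ∀ i j, β j (fun _ => w (Fin.cast h (Fin.natAdd q i))) = if i = j then 1 else 0)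
    (h₀ : ∀ i j, β j (fun _ => w (Fin.cast h (Fin.castAdd r i))) = 0) :
    wedge h φ (wedgeOneForms β) w = φ (fun i => w (Fin.cast h (Fin.castAdd r i))) := by
  subst h
  rw [wedge_eq_domCoprod, AlternatingMap.domCoprod_apply]
  have e2 : finSumFinEquiv.trans (finCongr (rfl : q + r = q + r)) = finSumFinEquiv := by
    ext; simp
  rw [e2]
  rw [sum_apply, map_sum]
  -- The sum runs over shuffles, i.e. cosets of the block-preserving permutations. A non-trivial one
  -- feeds a vector of the first block to the `β j`, whose determinant then has a zero column.
  refine (Finset.sum_eq_single (Quotient.mk'' 1) ?_ (by simp)).trans ?_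
  rotate_left
  · rw [AlternatingMap.domCoprod.summand_mk'']
    have hone : wedgeOneForms β (fun i => w (Fin.natAdd q i)) = 1 := by
      rw [wedgeOneForms_apply]
      convert Matrix.det_one (n := Fin r) (R := ℝ) using 2
      ext i j
      simpa [Matrix.one_apply, eq_comm] using h₁ j i
    simp [MultilinearMap.domCoprod_apply, hone]
  · intro σ _ hσ
    induction σ using Quotient.inductionOn' with | _ σ
    rw [AlternatingMap.domCoprod.summand_mk'']
    suffices wedgeOneForms β (fun j => w (finSumFinEquiv (σ (Sum.inr j)))) = 0 by
      have h2 := this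
      simp [MultilinearMap.domCoprod_apply, this]
    -- Otherwise `σ` preserves the second block, hence by finiteness both blocks, and its coset is
    -- trivial.
    have : ∃ j, ∃ i, σ (Sum.inr j) = Sum.inl i := by
      by_contra! hcon
      apply hσ
      refine Quotient.sound' ?_
      rw [QuotientGroup.leftRel_apply, mul_one, inv_mem_iff]
      refine Equiv.Perm.mem_sumCongrHom_range_of_perm_mapsTo_inl ?_
      rintro _ ⟨i, rfl⟩
      rcases hi : σ (Sum.inl i) with i' | j'
      · exact ⟨i', rfl⟩
      · have hex : ∀ j, ∃ j', σ (Sum.inr j) = Sum.inr j' := fun j => by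
          rcases h : σ (Sum.inr j) with i | j'
          · exact absurd h (hcon j i)
          · exact ⟨j', rfl⟩
        choose τ hτ using hex
        have hinj : Function.Injective τ := fun a b hab => by
          have : σ (Sum.inr a) = σ (Sum.inr b) := by rw [hτ, hτ, hab]
          exact Sum.inr_injective (σ.injective this)
        obtain ⟨j, rfl⟩ := Finite.surjective_of_injective hinj j'
        exact absurd (σ.injective (hi.trans (hτ j).symm)) (by simp)
    obtain ⟨j, i, hij⟩ := this
    rw [wedgeOneForms_apply]
    refine Matrix.det_eq_zero_of_column_eq_zero j fun a => ?_
    simpa [hij] using h₀ i a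

theorem wedgeOneForms_of_dual {r : ℕ} (β : Fin r → V [⋀^Fin 1]→L[ℝ] ℝ) (w : Fin r → V)
    (h : ∀ i j, β j (fun _ => w i) = if i = j then 1 else 0) : wedgeOneForms β w = 1 := by
  rw [wedgeOneForms_apply]
  convert Matrix.det_one (n := Fin r) (R := ℝ) using 2
  ext i j
  simpa [Matrix.one_apply, eq_comm] using h j i

/-- An alternating form of top degree on a frame, in terms of another frame of the same plane. -/
theorem map_linearCombination_eq_det_mul {n : ℕ} (φ : V [⋀^Fin n]→L[ℝ] ℝ) (w : Fin n → V)
    (M : Matrix (Fin n) (Fin n) ℝ) :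
    φ (fun l => ∑ i, M l i • w i) = M.det * φ w := by
  -- Pulled back to `ℝ^n`, the form is a multiple of the determinant; `w` may be dependent.
  let L : (Fin n → ℝ) →ₗ[ℝ] V := Fintype.linearCombination ℝ w
  have key := (φ.toAlternatingMap.compLinearMap L).eq_smul_basis_det (Pi.basisFun ℝ (Fin n))
  have := congrArg (fun F => F fun l => M l) key
  simp only [AlternatingMap.compLinearMap_apply, AlternatingMap.smul_apply, Pi.basisFun_det] at this
  have e1 : (fun l => L (M l)) = fun l => ∑ i, M l i • w i := by
    ext l; simp [L, Fintype.linearCombination_apply]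
  have e2 : (fun i => L (Pi.basisFun ℝ (Fin n) i)) = w := by
    ext i; simp [L, Fintype.linearCombination_apply, Pi.single_apply]
  simp only [e1, e2] at this
  exact this.trans (mul_comm _ _)

end Pointwise

/-! ### Smooth forms, ideals and centred charts -/

section Smooth

variable {V : Type*} [NormedAddCommGroup V] [NormedSpace ℝ V] [FiniteDimensional ℝ V]

/-- A map to a space of alternating forms is smooth as soon as its evaluations are. -/
theorem contDiffOn_of_forall_apply {U : Type*} [NormedAddCommGroup U] [NormedSpace ℝ U] {n : ℕ}
    {f : U → V [⋀^Fin n]→L[ℝ] ℝ} {s : Set U} {m : WithTop ℕ∞}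
    (h : ∀ v : Fin n → V, ContDiffOn ℝ m (fun u => f u v) s) : ContDiffOn ℝ m f s := by
  let b := Module.finBasis ℝ V
  let T : (V [⋀^Fin n]→L[ℝ] ℝ) →ₗ[ℝ] ((Fin n → Fin (Module.finrank ℝ V)) → ℝ) :=
    { toFun := fun φ c => φ fun i => b (c i)
      map_add' := fun _ _ => rfl
      map_smul' := fun _ _ => rfl }
  have hT : LinearMap.ker T = ⊥ := by
    rw [LinearMap.ker_eq_bot']
    intro φ hφ
    apply ContinuousAlternatingMap.toAlternatingMap_injective
    refine b.ext_alternating fun c _ => ?_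
    exact congrFun hφ c
  -- `T` records the values on tuples of basis vectors, which determine a form. Its left inverse is
  -- linear on a finite-dimensional space, hence continuous, and recovers `f` from scalar functions.
  obtain ⟨S, hS⟩ := T.exists_leftInverse_of_injective hT
  have : f = fun u => (LinearMap.toContinuousLinearMap S) (T (f u)) := by
    ext1 u
    exact (LinearMap.congr_fun hS (f u)).symm
  rw [this]
  refine (LinearMap.toContinuousLinearMap S).contDiff.comp_contDiffOn ?_
  exact contDiffOn_pi.2 fun c => h _

end Smooth

section Manifold

variable {E : Type*} [NormedAddCommGroup E] [NormedSpace ℝ E]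
  {H : Type*} [TopologicalSpace H] {I : ModelWithCorners ℝ E H}
  {M : Type*} [TopologicalSpace M] [ChartedSpace H M]

theorem DForm.inChart_apply {n : ℕ} (φ : DForm I M n) (x₀ : M) (u : E) (v : Fin n → E) :
    φ.inChart x₀ u v = φ ((extChartAt I x₀).symm u) (fun i =>
      (mfderiv 𝓘(ℝ, E) I (extChartAt I x₀).symm u : E →L[ℝ] TangentSpace I _) (v i)) := rfl

theorem DForm.isSmooth_of_forall_apply [FiniteDimensional ℝ E] {n : ℕ} {φ : DForm I M n}
    (h : ∀ (x₀ : M) (v : Fin n → E),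
      ContDiffOn ℝ ∞ (fun u => φ.inChart x₀ u v) (extChartAt I x₀).target) : φ.IsSmooth :=
  fun x₀ => contDiffOn_of_forall_apply (h x₀)

theorem DForm.IsSmooth.contDiffOn_apply {n : ℕ} {φ : DForm I M n} (hφ : φ.IsSmooth) (x₀ : M)
    (v : Fin n → E) :
    ContDiffOn ℝ ∞ (fun u => φ.inChart x₀ u v) (extChartAt I x₀).target := by
  let ev : (E [⋀^Fin n]→L[ℝ] ℝ) →L[ℝ] ℝ := ContinuousAlternatingMap.apply ℝ E ℝ v
  exact ev.contDiff.comp_contDiffOn (hφ x₀)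

theorem DForm.IsSmooth.wedge [FiniteDimensional ℝ E] {p q n : ℕ} (h : p + q = n)
    {φ : DForm I M p} {ψ : DForm I M q} (hφ : φ.IsSmooth) (hψ : ψ.IsSmooth) :
    DForm.IsSmooth (fun x => EDS.wedge h (φ x) (ψ x) : DForm I M n) := by
  refine DForm.isSmooth_of_forall_apply fun x₀ v => ?_
  simp only [DForm.inChart_apply, wedge_apply]
  refine contDiffOn_const.mul (ContDiffOn.sum fun σ _ => contDiffOn_const.mul (ContDiffOn.mul ?_ ?_))
  · exact hφ.contDiffOn_apply x₀ _
  · exact hψ.contDiffOn_apply x₀ _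

theorem DForm.IsSmooth.wedgeOneForms [FiniteDimensional ℝ E] {k : ℕ}
    {α : Fin k → DForm I M 1} (hα : ∀ i, (α i).IsSmooth) :
    DForm.IsSmooth (fun x => EDS.wedgeOneForms fun i => α i x : DForm I M k) := by
  refine DForm.isSmooth_of_forall_apply fun x₀ v => ?_
  simp only [DForm.inChart_apply, wedgeOneForms_apply, Matrix.det_apply]
  refine ContDiffOn.sum fun σ _ => ContDiffOn.const_smul _ (contDiffOn_prod fun i _ => ?_)
  exact (hα _).contDiffOn_apply x₀ _

/-- A subspace on which the generators of an algebraic ideal vanish is an integral element. -/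
theorem AlgIdeal.vanish {S : Family I M} {x : M} {W : Submodule ℝ (TangentSpace I x)}
    (hS : ∀ (n : ℕ) (φ : DForm I M n), S n φ → ∀ v : Fin n → TangentSpace I x, (∀ i, v i ∈ W) →
      φ x v = 0) {n : ℕ} {φ : DForm I M n} (hφ : AlgIdeal S n φ) :
    ∀ v : Fin n → TangentSpace I x, (∀ i, v i ∈ W) → φ x v = 0 := by
  induction hφ with
  | of h => exact hS _ _ h
  | zero n => intro v _; rfl
  | add _ _ h₁ h₂ =>
    intro v hv
    rw [Pi.add_apply, ContinuousAlternatingMap.add_apply, h₁ v hv, h₂ v hv, add_zero]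
  | wedge_right h _ _ ih =>
    intro v hv
    rw [wedge_apply]
    simp [ih _ fun i => hv _]
  | wedge_left h _ _ ih =>
    intro v hv
    rw [wedge_apply]
    simp [ih _ fun i => hv _]

/-- Only degrees one and two matter, since the algebraic generators are the `θ i` and `(θ i).d`. -/
theorem DiffIdeal.vanish {ι : Type*} {θ : ι → DForm I M 1} {x : M}
    {W : Submodule ℝ (TangentSpace I x)}
    (h₁ : ∀ i, ∀ v ∈ W, θ i x (fun _ => v) = 0)
    (h₂ : ∀ i, ∀ v : Fin 2 → TangentSpace I x, (∀ a, v a ∈ W) → (θ i).d x v = 0)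
    {n : ℕ} {φ : DForm I M n} (hφ : DiffIdeal (OneForms θ) n φ) (v : Fin n → TangentSpace I x)
    (hv : ∀ i, v i ∈ W) : φ x v = 0 := by
  refine AlgIdeal.vanish ?_ hφ v hv
  rintro n φ (⟨⟨i⟩⟩ | ⟨⟨i⟩⟩) v hv
  · have : v = fun _ => v 0 := by ext a; rw [Subsingleton.elim a 0]
    rw [this]
    exact h₁ i _ (hv 0)
  · exact h₂ i v hv

theorem DiffIdeal.of_mem {ι : Type*} {θ : ι → DForm I M 1} (i : ι) :
    DiffIdeal (OneForms θ) 1 (θ i) := .of (.of (.of i))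

theorem DiffIdeal.d_mem {ι : Type*} {θ : ι → DForm I M 1} (i : ι) :
    DiffIdeal (OneForms θ) 2 (θ i).d := .of (.d (.of i))

/-- The preferred chart at `x` has the identity as derivative at `x`, so vectors are their own
coordinates. -/
theorem frameCoord_eq [IsManifold I 1 M] {n : ℕ} (x : M) (v : Fin n → TangentSpace I x) :
    frameCoord x v = (extChartAt I x x, (v : Fin n → E)) := by
  have h : (mfderiv I 𝓘(ℝ, E) (extChartAt I x) x : E →L[ℝ] E) = ContinuousLinearMap.id ℝ E :=
    mfderiv_extChartAt_self
  refine Prod.ext rfl (funext fun i => ?_)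
  change (mfderiv I 𝓘(ℝ, E) (extChartAt I x) x : E →L[ℝ] E) (v i) = v i
  rw [h]
  rfl

/-- A property of frames at `x` passes to the frames at `x` described by their coordinates. -/
theorem of_frame_at_center [IsManifold I 1 M] [I.Boundaryless] {n : ℕ}
    (x : M) (v : Fin n → TangentSpace I x) (C : ∀ y : M, (Fin n → TangentSpace I y) → Prop)
    (h : C x v) :
    C (basePoint I x (extChartAt I x x, (v : Fin n → E)))
      (frameAt I x (extChartAt I x x, (v : Fin n → E))) := by
  -- The base point recovered from the coordinates equals `x` only propositionally, so the transport
  -- is done over a variable base point.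
  have key : ∀ (y : M) (w : Fin n → TangentSpace I y), y = x → (∀ i, (w i : E) = (v i : E)) →
      C y w := by
    intro y w hy hw
    subst hy
    have : w = v := funext hw
    rwa [this]
  refine key _ _ (extChartAt_to_inv x) fun i => ?_
  have h1 := mfderivWithin_range_extChartAt_symm (I := I) (x := x)
  rw [I.range_eq_univ, mfderivWithin_univ] at h1
  have h1' : (mfderiv 𝓘(ℝ, E) I (extChartAt I x).symm (extChartAt I x x) : E →L[ℝ] E) =
    ContinuousLinearMap.id ℝ E := h1
  change (mfderiv 𝓘(ℝ, E) I (extChartAt I x).symm (extChartAt I x x) : E →L[ℝ] E) (v i) = v i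
  rw [h1']
  rfl

end Manifold

end EDS

namespace EDS

/-! ### Integral elements and polar spaces of ideals generated by 1-forms -/

section Forms

variable {E : Type*} [NormedAddCommGroup E] [NormedSpace ℝ E]
  {H : Type*} [TopologicalSpace H] {I : ModelWithCorners ℝ E H}
  {M : Type*} [TopologicalSpace M] [ChartedSpace H M]

/-- Lets a coframe be reordered so that the members indexed by `c` come first. -/
theorem exists_perm_extending {q r p : ℕ} (h : q + r = p) (c : Fin q → Fin p)
    (hc : Function.Injective c) :
    ∃ σ : Equiv.Perm (Fin p), ∀ i, σ (Fin.cast h (Fin.castAdd r i)) = c i := by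
  have hι : Function.Injective fun i : Fin q => Fin.cast h (Fin.castAdd r i) := by
    intro a b hab
    simpa [Fin.ext_iff] using hab
  let e := (Equiv.ofInjective _ hι).symm.trans (Equiv.ofInjective c hc)
  refine ⟨Equiv.extendSubtype e, fun i => ?_⟩
  rw [Equiv.extendSubtype_apply_of_mem e _ ⟨i, rfl⟩]
  have : (⟨Fin.cast h (Fin.castAdd r i), i, rfl⟩ :
      Set.range fun i : Fin q => Fin.cast h (Fin.castAdd r i)) = Equiv.ofInjective _ hι i := rfl
  simp only [e, Equiv.trans_apply]
  rw [this, Equiv.symm_apply_apply]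
  rfl

section Linear

variable {V : Type*} [AddCommGroup V] [Module ℝ V] [TopologicalSpace V]

/-- A form of degree one as a linear form. -/
def oneFormLinear (Φ : V [⋀^Fin 1]→L[ℝ] ℝ) : V →ₗ[ℝ] ℝ :=
  ((ContinuousAlternatingMap.ofSubsingleton ℝ V ℝ (0 : Fin 1)).symm Φ : V →L[ℝ] ℝ)

@[simp]
theorem oneFormLinear_apply (Φ : V [⋀^Fin 1]→L[ℝ] ℝ) (v : V) :
    oneFormLinear Φ v = Φ (fun _ => v) := rfl

/-- A form of degree two as a bilinear form, with its second argument fixed. -/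
def twoFormLinear (Φ : V [⋀^Fin 2]→L[ℝ] ℝ) (b : V) : V →ₗ[ℝ] ℝ where
  toFun a := Φ ![a, b]
  map_add' a a' := ContinuousAlternatingMap.vecCons_add Φ ![b] a a'
  map_smul' c a := ContinuousAlternatingMap.vecCons_smul Φ ![b] c a

@[simp]
theorem twoFormLinear_apply (Φ : V [⋀^Fin 2]→L[ℝ] ℝ) (a b : V) :
    twoFormLinear Φ b a = Φ ![a, b] := rfl

theorem two_form_self (Φ : V [⋀^Fin 2]→L[ℝ] ℝ) (a : V) : Φ ![a, a] = 0 :=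
  Φ.map_eq_zero_of_eq _ (i := 0) (j := 1) rfl (by decide)

theorem two_form_swap (Φ : V [⋀^Fin 2]→L[ℝ] ℝ) (a b : V) : Φ ![a, b] = -Φ ![b, a] := by
  have := Φ.toAlternatingMap.map_swap ![b, a] (i := 0) (j := 1) (by decide)
  have e2 : ![b, a] ∘ ⇑(Equiv.swap (0 : Fin 2) 1) = ![a, b] := by ext i; fin_cases i <;> rfl
  rw [e2] at this
  exact this

theorem two_form_vanish_on_span (Φ : V [⋀^Fin 2]→L[ℝ] ℝ) (s : Set V)
    (h : ∀ a ∈ s, ∀ b ∈ s, Φ ![a, b] = 0)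
    (v : Fin 2 → V) (hv : ∀ i, v i ∈ Submodule.span ℝ s) : Φ v = 0 := by
  have e : v = ![v 0, v 1] := by ext i; fin_cases i <;> rfl
  have step : ∀ b ∈ s, Submodule.span ℝ s ≤ LinearMap.ker (twoFormLinear Φ b) := fun b hb =>
    Submodule.span_le.2 fun a ha => h a ha b hb
  have step' : ∀ a ∈ Submodule.span ℝ s, Submodule.span ℝ s ≤ LinearMap.ker (twoFormLinear Φ a) :=
    fun a ha => Submodule.span_le.2 fun b hb => by
      have := step b hb ha
      simp only [LinearMap.mem_ker, twoFormLinear_apply] at this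
      simp [two_form_swap Φ b a, this]
  rw [e]
  exact step' _ (hv 1) (hv 0)

theorem one_form_vanish_on_span (Φ : V [⋀^Fin 1]→L[ℝ] ℝ) (s : Set V)
    (h : ∀ a ∈ s, Φ (fun _ => a) = 0) (v : V) (hv : v ∈ Submodule.span ℝ s) :
    Φ (fun _ => v) = 0 := by
  have : Submodule.span ℝ s ≤ LinearMap.ker (oneFormLinear Φ) :=
    Submodule.span_le.2 fun a ha => h a ha
  exact this hv

end Linear

theorem DiffIdeal.vanish_of_frame {ι : Type*} {θ : ι → DForm I M 1} {p : ℕ} {x : M}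
    (w : Fin p → TangentSpace I x) (h₁ : ∀ i a, θ i x (fun _ => w a) = 0)
    (h₂ : ∀ i a b, (θ i).d x ![w a, w b] = 0) {n : ℕ} {φ : DForm I M n}
    (hφ : DiffIdeal (OneForms θ) n φ) (v : Fin n → TangentSpace I x)
    (hv : ∀ i, v i ∈ Submodule.span ℝ (Set.range w)) : φ x v = 0 := by
  refine DiffIdeal.vanish (fun i => ?_) (fun i => ?_) hφ v hv
  · refine one_form_vanish_on_span _ _ ?_
    rintro _ ⟨a, rfl⟩
    exact h₁ i a
  · refine two_form_vanish_on_span _ _ ?_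
    rintro _ ⟨a, rfl⟩ _ ⟨b, rfl⟩
    exact h₂ i a b

theorem isIntegralElement_span_iff {ι : Type*} {θ : ι → DForm I M 1} {p : ℕ} {x : M}
    (w : Fin p → TangentSpace I x) (hli : LinearIndependent ℝ w) :
    IsIntegralElement (DiffIdeal (OneForms θ)) p x (Submodule.span ℝ (Set.range w)) ↔
      (∀ i a, θ i x (fun _ => w a) = 0) ∧ ∀ i a b, (θ i).d x ![w a, w b] = 0 := by
  constructor
  · rintro ⟨-, h⟩
    refine ⟨fun i a => h 1 _ (DiffIdeal.of_mem i) _ fun _ => Submodule.subset_span ⟨a, rfl⟩,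
      fun i a b => h 2 _ (DiffIdeal.d_mem i) _ fun c => ?_⟩
    fin_cases c <;> exact Submodule.subset_span ⟨_, rfl⟩
  · rintro ⟨h₁, h₂⟩
    exact ⟨by simpa using finrank_span_eq_card hli,
      fun n φ hφ v hv => DiffIdeal.vanish_of_frame w h₁ h₂ hφ v hv⟩

variable [FiniteDimensional ℝ E]

/-- A form `φ` of an algebraic ideal can be multiplied by the members of a coframe so that the
result has the same value on a dual frame as `φ` on the remaining vectors of that frame, up to a
sign. -/
theorem AlgIdeal.exists_wedge_coframe {S : Family I M} {q p : ℕ} {φ : DForm I M q}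
    (hφ : AlgIdeal S q φ) (hs : φ.IsSmooth) (α : Fin p → DForm I M 1) (hα : ∀ i, (α i).IsSmooth)
    (c : Fin q → Fin p) (hc : Function.Injective c) :
    ∃ Φ : DForm I M p, AlgIdeal S p Φ ∧ Φ.IsSmooth ∧ ∃ ε : ℝ, ε ≠ 0 ∧
      ∀ (y : M) (w : Fin p → TangentSpace I y),
        (∀ a ∉ Set.range c, ∀ b, α a y (fun _ => w b) = if b = a then 1 else 0) →
          Φ y w = ε * φ y (fun i => w (c i)) := by
  have hle : q ≤ p := by simpa using Fintype.card_le_of_injective c hc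
  obtain ⟨r, rfl⟩ := Nat.exists_eq_add_of_le hle
  obtain ⟨σ, hσ⟩ := exists_perm_extending rfl c hc
  -- The covectors not selected by `c`. Wedging with them contracts away the vectors dual to them;
  -- the sign of `σ` accounts for the reordering.
  let β : Fin r → DForm I M 1 := fun j => α (σ (Fin.natAdd q j))
  have hψ : DForm.IsSmooth (fun x => wedgeOneForms fun j => β j x : DForm I M r) :=
    DForm.IsSmooth.wedgeOneForms fun j => hα _
  refine ⟨_, AlgIdeal.wedge_right rfl hφ hψ, hs.wedge rfl hψ,
    ((Equiv.Perm.sign σ : ℤ) : ℝ), by simp, fun y w hw => ?_⟩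
  have hnot : ∀ j : Fin r, σ (Fin.natAdd q j) ∉ Set.range c := by
    rintro j ⟨i, hi⟩
    rw [← hσ i] at hi
    have := σ.injective hi
    simp [Fin.ext_iff] at this
    omega
  have key := wedge_wedgeOneForms_of_dual (n := q + r) rfl (φ y) (fun j => β j y)
    (fun a => w (σ a)) ?_ ?_
  · have h2 := (wedge (n := q + r) rfl (φ y) (wedgeOneForms fun j => β j y)).toAlternatingMap.map_perm
      (fun a => w (σ a)) σ⁻¹
    have e3 : (fun a => w (σ a)) ∘ ⇑σ⁻¹ = w := by ext a; simp
    rw [e3] at h2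
    have h3 : (wedge (n := q + r) rfl (φ y) (wedgeOneForms fun j => β j y)) w =
      Equiv.Perm.sign σ⁻¹ • (wedge (n := q + r) rfl (φ y) (wedgeOneForms fun j => β j y))
        (fun a => w (σ a)) := h2
    rw [h3, key, Equiv.Perm.sign_inv, Units.smul_def, zsmul_eq_mul]
    simp only [hσ]
  · intro i j
    simp only [β]
    rw [hw _ (hnot j)]
    simp
  · intro i j
    simp only [β]
    rw [hw _ (hnot j), if_neg]
    intro h
    have := σ.injective h
    simp [Fin.ext_iff] at this
    omega

/-- The polar space of an integral element, for the ideal generated by 1-forms. -/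
theorem mem_polarSpace_iff {ι : Type*} {θ : ι → DForm I M 1} (hθ : ∀ i, (θ i).IsSmooth)
    (hdθ : ∀ i, (θ i).d.IsSmooth) {p : ℕ} {x : M} (w : Fin p → TangentSpace I x)
    (h₁ : ∀ i a, θ i x (fun _ => w a) = 0) (h₂ : ∀ i a b, (θ i).d x ![w a, w b] = 0)
    (α : Fin p → DForm I M 1) (hα : ∀ a, (α a).IsSmooth)
    (hw : ∀ a b, α a x (fun _ => w b) = if b = a then 1 else 0) (v : TangentSpace I x) :
    v ∈ polarSpace (DiffIdeal (OneForms θ)) p x (Submodule.span ℝ (Set.range w)) ↔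
      (∀ i, θ i x (fun _ => v) = 0) ∧ ∀ i a, (θ i).d x ![v, w a] = 0 := by
  have mpr : ∀ v : TangentSpace I x, (∀ i, θ i x (fun _ => v) = 0) →
      (∀ i a, (θ i).d x ![v, w a] = 0) →
      v ∈ polarSpace (DiffIdeal (OneForms θ)) p x (Submodule.span ℝ (Set.range w)) := by
    intro v hv₁ hv₂ φ hφ e he
    refine DiffIdeal.vanish (W := Submodule.span ℝ (insert v (Set.range w))) ?_ ?_ hφ _ ?_
    · intro i
      refine one_form_vanish_on_span (θ i x) _ ?_
      rintro _ (rfl | ⟨a, rfl⟩)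
      · exact hv₁ i
      · exact h₁ i a
    · intro i
      refine two_form_vanish_on_span ((θ i).d x) _ ?_
      rintro _ (rfl | ⟨a, rfl⟩) _ (rfl | ⟨b, rfl⟩)
      · exact two_form_self _ _
      · exact hv₂ i b
      · rw [two_form_swap, hv₂ i a, neg_zero]
      · exact h₂ i a b
    · intro i
      refine Fin.cases ?_ (fun j => ?_) i
      · exact Submodule.subset_span (Set.mem_insert _ _)
      · exact Submodule.span_mono (Set.subset_insert _ _) (he j)
  refine ⟨fun hv => ?_, fun h => mpr v h.1 h.2⟩
  -- Removing the component of `v` along the plane stays inside the polar space and makes `v'`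
  -- invisible to the coframe.
  set v' : TangentSpace I x := v - ∑ a, α a x (fun _ => v) • w a with hv'
  have hv'H : v' ∈ polarSpace (DiffIdeal (OneForms θ)) p x (Submodule.span ℝ (Set.range w)) :=
    Submodule.sub_mem _ hv (Submodule.sum_mem _ fun a _ => Submodule.smul_mem _ _
      (mpr _ (fun i => h₁ i a) fun i b => h₂ i a b))
  have hαv' : ∀ a, α a x (fun _ => v') = 0 := fun a => by
    rw [← oneFormLinear_apply, hv', map_sub, map_sum]
    simp [hw]
  -- The zero form only fills slot `0`. That slot is among the selected ones in both uses below, so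
  -- it is never wedged.
  let α' : Fin (p + 1) → DForm I M 1 := Fin.cons 0 α
  have hα' : ∀ a, (α' a).IsSmooth := by
    refine Fin.cases ?_ hα
    refine DForm.isSmooth_of_forall_apply fun x₀ v => ?_
    have : (fun u => DForm.inChart (α' 0) x₀ u v) = fun _ => (0 : ℝ) := rfl
    rw [this]
    exact contDiffOn_const
  have hdual : ∀ a ≠ 0, ∀ b, α' a x (fun _ => (Matrix.vecCons v' w : Fin (p + 1) → _) b) =
      if b = a then 1 else 0 := by
    intro a ha b
    obtain ⟨a, rfl⟩ := Fin.exists_succ_eq.2 ha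
    refine Fin.cases ?_ (fun b => ?_) b
    · simp only [α', Fin.cons_succ, Matrix.cons_val_zero]
      rw [hαv' a, if_neg (Fin.succ_ne_zero a).symm]
    · simp only [α', Fin.cons_succ, Matrix.cons_val_succ]
      rw [hw a b]
      simp
  -- The polar space tests forms of degree `p + 1` only. Multiplying `θ i` by all the `α a` reaches
  -- that degree, and on `(v', w)` the product is a non-zero multiple of `θ i` at `v'`.
  have hv₁ : ∀ i, θ i x (fun _ => v') = 0 := by
    intro i
    obtain ⟨Φ, hΦ, -, ε, hε, h⟩ := AlgIdeal.exists_wedge_coframe (DiffIdeal.of_mem i)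
      (hθ i) α' hα' ![0] (fun a b _ => Subsingleton.elim a b)
    have := h x (Matrix.vecCons v' w) fun a ha => hdual a (by rintro rfl; exact ha ⟨0, rfl⟩)
    rw [hv'H Φ hΦ w fun a => Submodule.subset_span ⟨a, rfl⟩] at this
    have h0 : (fun i : Fin 1 => (Matrix.vecCons v' w : Fin (p + 1) → _) ((![0] : Fin 1 → _) i)) =
        fun _ => v' := by
      ext i; fin_cases i; rfl
    rw [h0] at this
    exact (mul_eq_zero.1 this.symm).resolve_left hε
  -- Here `α a` is left out of the product, so that the contraction leaves `v'` and `w a`.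
  have hv₂ : ∀ i a, (θ i).d x ![v', w a] = 0 := by
    intro i a
    obtain ⟨Φ, hΦ, -, ε, hε, h⟩ := AlgIdeal.exists_wedge_coframe (DiffIdeal.d_mem i)
      (hdθ i) α' hα' ![0, a.succ] (by
        intro b c hbc
        fin_cases b <;> fin_cases c <;> first
          | rfl
          | exact absurd hbc (Fin.succ_ne_zero a).symm
          | exact absurd hbc (Fin.succ_ne_zero a))
    have := h x (Matrix.vecCons v' w) fun a ha => hdual a (by rintro rfl; exact ha ⟨0, rfl⟩)
    rw [hv'H Φ hΦ w fun a => Submodule.subset_span ⟨a, rfl⟩] at this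
    have h0 : (fun i : Fin 2 => (Matrix.vecCons v' w : Fin (p + 1) → _)
        ((![0, a.succ] : Fin 2 → _) i)) = ![v', w a] := by
      ext i; fin_cases i <;> rfl
    rw [h0] at this
    exact (mul_eq_zero.1 this.symm).resolve_left hε
  have hvv : v = v' + ∑ a, α a x (fun _ => v) • w a := by rw [hv', sub_add_cancel]
  constructor
  · intro i
    rw [← oneFormLinear_apply, hvv, map_add, map_sum]
    simp [hv₁, h₁]
  · intro i a
    rw [← twoFormLinear_apply, hvv, map_add, map_sum]
    simp [hv₂, h₂]

end Forms

end EDS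

namespace EDS

/-! ### A criterion for Kähler-ordinary elements -/

section OrdinaryZero

/-- The differentials are continuous at `z` and independence is open, so it need only be checked at
`z`; that zeros of `F` are zeros of the `f i` is clear from `hf`. -/
theorem isOrdinaryZero_of_contDiffAt {V : Type*} [NormedAddCommGroup V] [NormedSpace ℝ V]
    {F : Set (V → ℝ)} {z : V} (h₀ : ∀ f ∈ F, f z = 0) {κ : Type*} [Finite κ] (f : κ → V → ℝ)
    (hf : ∀ i, f i ∈ F) (hs : ∀ i, ContDiffAt ℝ 1 (f i) z)
    (hli : LinearIndependent ℝ fun i => fderiv ℝ (f i) z)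
    (hz : ∀ᶠ w in 𝓝 z, (∀ i, f i w = 0) → ∀ g ∈ F, g w = 0) : IsOrdinaryZero F z := by
  have := Fintype.ofFinite κ
  let e := Fintype.equivFin κ
  refine ⟨h₀, Fintype.card κ, fun i => f (e.symm i), fun i => hf _, ?_⟩
  have hcont : ContinuousAt (fun w => fun i => fderiv ℝ (f (e.symm i)) w) z :=
    continuousAt_pi.2 fun i => (hs (e.symm i)).continuousAt_fderiv (by simp)
  have hli' : LinearIndependent ℝ (fun i => fderiv ℝ (f (e.symm i)) z) :=
    hli.comp e.symm e.symm.injective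
  filter_upwards [hcont.eventually hli'.eventually, hz] with w hw hzw
  refine ⟨hw, fun h i => h _ (hf _), fun h => hzw fun i => ?_⟩
  simpa using h (e i)

variable {E : Type*} [NormedAddCommGroup E] [NormedSpace ℝ E]
  {H : Type*} [TopologicalSpace H] {I : ModelWithCorners ℝ E H}
  {M : Type*} [TopologicalSpace M] [ChartedSpace H M]

/-- The frame of the plane spanned by `w` which is dual to the coframe `α`. -/
noncomputable def dualFrame {p : ℕ} (α : Fin p → DForm I M 1) (y : M)
    (w : Fin p → TangentSpace I y) : Fin p → TangentSpace I y := fun l =>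
  ∑ i, (Matrix.of fun l i => α i y (fun _ => w l))⁻¹ l i • w i

section dualFrame

variable {p : ℕ} {α : Fin p → DForm I M 1} {y : M} {w : Fin p → TangentSpace I y}

theorem apply_dualFrame (β : DForm I M 1) (l : Fin p) : β y (fun _ => dualFrame α y w l) =
    ∑ i, (Matrix.of fun l i => α i y (fun _ => w l))⁻¹ l i * β y (fun _ => w i) := by
  rw [← oneFormLinear_apply, dualFrame, map_sum]
  simp

theorem dualFrame_dual (h : (Matrix.of fun l i => α i y (fun _ => w l)).det ≠ 0) (a b : Fin p) :
    α a y (fun _ => dualFrame α y w b) = if b = a then 1 else 0 := by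
  have h1 := congrFun (congrFun (Matrix.nonsing_inv_mul _ (isUnit_iff_ne_zero.2 h)) b) a
  rw [Matrix.mul_apply, Matrix.one_apply] at h1
  rw [apply_dualFrame, ← h1]
  simp

theorem eq_sum_dualFrame (h : (Matrix.of fun l i => α i y (fun _ => w l)).det ≠ 0) (l : Fin p) :
    w l = ∑ i, α i y (fun _ => w l) • dualFrame α y w i := by
  set N : Matrix (Fin p) (Fin p) ℝ := Matrix.of fun l i => α i y (fun _ => w l) with hN
  have h1 := Matrix.mul_nonsing_inv N (isUnit_iff_ne_zero.2 h)
  have h2 : ∀ i, ∑ j, α j y (fun _ => w l) • N⁻¹ j i • w i = (if l = i then (1 : ℝ) else 0) • w i := by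
    intro i
    have := congrFun (congrFun h1 l) i
    rw [Matrix.mul_apply, Matrix.one_apply] at this
    rw [← this, Finset.sum_smul]
    simp [hN, mul_smul]
  simp only [dualFrame, Finset.smul_sum]
  rw [Finset.sum_comm]
  simp only [← hN, h2]
  simp

theorem dualFrame_of_dual (h : ∀ a b, α a y (fun _ => w b) = if b = a then 1 else 0) :
    dualFrame α y w = w := by
  have : (Matrix.of fun l i => α i y (fun _ => w l)) = 1 := by
    ext i j; simp [h, Matrix.one_apply]
  ext l
  rw [dualFrame, this]
  simp [Matrix.one_apply]

/-- A change of frame multiplies all forms of degree `p` by the same determinant, so their quotients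
can be computed on the dual frame. -/
theorem apply_eq_det_mul_dualFrame (h : (Matrix.of fun l i => α i y (fun _ => w l)).det ≠ 0)
    (φ : DForm I M p) :
    φ y w = (Matrix.of fun l i => α i y (fun _ => w l)).det * φ y (dualFrame α y w) := by
  rw [← map_linearCombination_eq_det_mul]
  congr 1
  ext1 l
  exact eq_sum_dualFrame h l

theorem linearIndependent_of_dual (h : ∀ a b, α a y (fun _ => w b) = if b = a then 1 else 0) :
    LinearIndependent ℝ w := by
  rw [Fintype.linearIndependent_iff]
  intro g hg a
  have := congrArg (oneFormLinear (α a y)) hg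
  rw [map_sum, map_zero] at this
  simpa [h] using this

end dualFrame

variable [FiniteDimensional ℝ E]

/-- In a basis of `E` the value is polynomial in the coordinates of the frame, with coefficients
smooth in the base point. -/
theorem contDiffAt_inChart_apply [I.Boundaryless] {n : ℕ} {φ : DForm I M n} (hφ : φ.IsSmooth)
    (x₀ : M)
    {z : E × (Fin n → E)} (hz : z.1 ∈ (extChartAt I x₀).target) :
    ContDiffAt ℝ ∞ (fun z : E × (Fin n → E) => φ (basePoint I x₀ z) (frameAt I x₀ z)) z := by
  let b := Module.finBasis ℝ E
  have : (fun z : E × (Fin n → E) => φ (basePoint I x₀ z) (frameAt I x₀ z)) = fun z =>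
      ∑ c : Fin n → Fin (Module.finrank ℝ E), (∏ i, b.repr (z.2 i) (c i)) *
        φ.inChart x₀ z.1 (fun i => b (c i)) := by
    ext1 z
    change φ.inChart x₀ z.1 z.2 = _
    conv_lhs => rw [show z.2 = fun i => ∑ j, b.repr (z.2 i) j • b j from
      funext fun i => (b.sum_repr _).symm]
    have := (φ.inChart x₀ z.1).toAlternatingMap.toMultilinearMap.map_sum
      (fun i j => b.repr (z.2 i) j • b j)
    refine this.trans (Finset.sum_congr rfl fun c _ => ?_)
    exact (φ.inChart x₀ z.1).toAlternatingMap.toMultilinearMap.map_smul_univ _ _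
  rw [this]
  refine ContDiffAt.sum fun c _ => ContDiffAt.mul (contDiffAt_prod fun i _ => ?_) ?_
  · have : (fun z : E × (Fin n → E) => b.repr (z.2 i) (c i)) = fun z =>
        (LinearMap.toContinuousLinearMap (b.coord (c i))) (z.2 i) := rfl
    rw [this]
    fun_prop
  · have h1 := (hφ.contDiffOn_apply x₀ (fun i => b (c i))).contDiffAt
      ((isOpen_extChartAt_target x₀).mem_nhds hz)
    exact ContDiffAt.comp z h1 contDiffAt_fst

theorem continuousAt_apply_frameAt [I.Boundaryless] {p : ℕ} {γ : DForm I M 1} (hγ : γ.IsSmooth)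
    (x₀ : M) {z : E × (Fin p → E)} (hz : z.1 ∈ (extChartAt I x₀).target) (i : Fin p) :
    ContinuousAt (fun z : E × (Fin p → E) =>
      γ (basePoint I x₀ z) (fun _ => frameAt I x₀ z i)) z := by
  have h1 := (contDiffAt_inChart_apply (n := 1) hγ x₀ (z := (z.1, fun _ => z.2 i)) hz).continuousAt
  have h2 : ContinuousAt (fun z : E × (Fin p → E) => ((z.1, fun _ => z.2 i) : E × (Fin 1 → E))) z := by
    fun_prop
  exact ContinuousAt.comp (f := fun z : E × (Fin p → E) => ((z.1, fun _ => z.2 i) : E × (Fin 1 → E)))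
    h1 h2

theorem continuousAt_apply_dualFrame [I.Boundaryless] {p : ℕ} {α : Fin p → DForm I M 1}
    (hα : ∀ a, (α a).IsSmooth) {β : DForm I M 1} (hβ : β.IsSmooth) (x₀ : M)
    {z : E × (Fin p → E)} (hz : z.1 ∈ (extChartAt I x₀).target)
    (h : (Matrix.of fun l i => α i (basePoint I x₀ z) (fun _ => frameAt I x₀ z l)).det ≠ 0)
    (l : Fin p) :
    ContinuousAt (fun z : E × (Fin p → E) =>
      β (basePoint I x₀ z) (fun _ => dualFrame α (basePoint I x₀ z) (frameAt I x₀ z) l)) z := by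
  have one : ∀ {γ : DForm I M 1}, γ.IsSmooth → ∀ i, ContinuousAt (fun z : E × (Fin p → E) =>
      γ (basePoint I x₀ z) (fun _ => frameAt I x₀ z i)) z := fun hγ i =>
    continuousAt_apply_frameAt hγ x₀ hz i
  simp only [apply_dualFrame]
  have hN : ContinuousAt (fun z : E × (Fin p → E) =>
      (Matrix.of fun l i => α i (basePoint I x₀ z) (fun _ => frameAt I x₀ z l) :
        Matrix (Fin p) (Fin p) ℝ)) z :=
    continuousAt_pi.2 fun l => continuousAt_pi.2 fun i => one (hα i) l
  have hinv : ContinuousAt (fun z : E × (Fin p → E) =>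
      (Matrix.of fun l i => α i (basePoint I x₀ z) (fun _ => frameAt I x₀ z l) :
        Matrix (Fin p) (Fin p) ℝ)⁻¹) z := by
    -- The inverse is the adjugate over the determinant, which is non-zero at the point considered.
    simp only [Matrix.inv_def]
    have hd : ContinuousAt (fun z : E × (Fin p → E) =>
        (Matrix.of fun l i => α i (basePoint I x₀ z) (fun _ => frameAt I x₀ z l) :
        Matrix (Fin p) (Fin p) ℝ).det) z :=
      ContinuousAt.comp (Continuous.matrix_det continuous_id).continuousAt hN
    have ha : ContinuousAt (fun z : E × (Fin p → E) =>
        (Matrix.of fun l i => α i (basePoint I x₀ z) (fun _ => frameAt I x₀ z l) :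
        Matrix (Fin p) (Fin p) ℝ).adjugate) z :=
      ContinuousAt.comp (g := fun N : Matrix (Fin p) (Fin p) ℝ => N.adjugate)
        (Continuous.matrix_adjugate continuous_id).continuousAt hN
    simp only [Ring.inverse_eq_inv']
    exact (hd.inv₀ h).smul ha
  refine tendsto_finsetSum _ fun i _ => ContinuousAt.mul ?_ (one hβ i)
  exact continuousAt_pi.1 (continuousAt_pi.1 hinv l) i

theorem eventually_det_ne_zero [I.Boundaryless] {p : ℕ} {α : Fin p → DForm I M 1}
    (hα : ∀ a, (α a).IsSmooth) (x₀ : M)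
    {z : E × (Fin p → E)} (hz : z.1 ∈ (extChartAt I x₀).target)
    (h : (Matrix.of fun l i => α i (basePoint I x₀ z) (fun _ => frameAt I x₀ z l)).det ≠ 0) :
    ∀ᶠ z in 𝓝 z,
      (Matrix.of fun l i => α i (basePoint I x₀ z) (fun _ => frameAt I x₀ z l)).det ≠ 0 := by
  have h1 := (contDiffAt_inChart_apply (n := p) (DForm.IsSmooth.wedgeOneForms hα) x₀ hz).continuousAt
  simp only [wedgeOneForms_apply] at h1
  rw [← Matrix.det_transpose] at h
  filter_upwards [h1.eventually_ne h] with z hz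
  rw [← Matrix.det_transpose]
  exact hz

/-- A criterion for the span of a frame to be a Kähler-ordinary integral element of an ideal
generated by 1-forms. -/
theorem isKahlerOrdinary_span [IsManifold I 1 M] [I.Boundaryless] {ι : Type*} [Finite ι]
    {θ : ι → DForm I M 1}
    (hθ : ∀ i, (θ i).IsSmooth) (hdθ : ∀ i, (θ i).d.IsSmooth) {p : ℕ} {x : M}
    (w : Fin p → TangentSpace I x) (h₁ : ∀ i a, θ i x (fun _ => w a) = 0)
    (h₂ : ∀ i a b, (θ i).d x ![w a, w b] = 0)
    (α : Fin p → DForm I M 1) (hα : ∀ a, (α a).IsSmooth)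
    (hw : ∀ a b, α a x (fun _ => w b) = if b = a then 1 else 0)
    {κ : Type*} [Finite κ] (c : κ → ι × Fin p × Fin p) (hc : ∀ k, (c k).2.1 ≠ (c k).2.2)
    (hind : ∀ (g₁ : ι × Fin p → ℝ) (g₂ : κ → ℝ), (∀ δ : Fin p → TangentSpace I x,
      (∀ a b, α a x (fun _ => δ b) = 0) →
      ∑ᶠ i, g₁ i * θ i.1 x (fun _ => δ i.2) + ∑ᶠ k, g₂ k *
        ((θ (c k).1).d x ![δ (c k).2.1, w (c k).2.2] +
          (θ (c k).1).d x ![w (c k).2.1, δ (c k).2.2]) = 0) → g₁ = 0 ∧ g₂ = 0)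
    (hzero : ∀ᶠ z in 𝓝 (frameCoord x w), ∀ w' : Fin p → TangentSpace I (basePoint I x z),
      w' = dualFrame α (basePoint I x z) (frameAt I x z) →
      (∀ a b, α a (basePoint I x z) (fun _ => w' b) = if b = a then 1 else 0) →
      (∀ i a, θ i (basePoint I x z) (fun _ => w' a) = 0) →
      (∀ k, (θ (c k).1).d (basePoint I x z) ![w' (c k).2.1, w' (c k).2.2] = 0) →
      ∀ i a b, (θ i).d (basePoint I x z) ![w' a, w' b] = 0) :
    IsKahlerOrdinary (DiffIdeal (OneForms θ)) p x (Submodule.span ℝ (Set.range w)) := by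
  have hli := linearIndependent_of_dual hw
  refine ⟨(isIntegralElement_span_iff w hli).2 ⟨h₁, h₂⟩, fun y => wedgeOneForms fun a => α a y,
    DForm.IsSmooth.wedgeOneForms hα, w, ⟨hli, rfl⟩, ?_, ?_⟩
  · simp only
    rw [wedgeOneForms_of_dual _ _ fun a b => hw b a]
    exact one_ne_zero
  set Ω : DForm I M p := fun y => wedgeOneForms fun a => α a y with hΩ
  have hΩs : Ω.IsSmooth := DForm.IsSmooth.wedgeOneForms hα
  have hz₀ : frameCoord x w = (extChartAt I x x, (w : Fin p → E)) := frameCoord_eq x w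
  have htarget : (frameCoord x w).1 ∈ (extChartAt I x).target := mem_extChartAt_target x
  have hΩdual : ∀ (y : M) (w' : Fin p → TangentSpace I y),
      (∀ a b, α a y (fun _ => w' b) = if b = a then 1 else 0) → Ω y w' = 1 := fun y w' h =>
    wedgeOneForms_of_dual _ _ fun a b => h b a
  have hdet₀ : (Matrix.of fun l i => α i (basePoint I x (frameCoord x w))
      (fun _ => frameAt I x (frameCoord x w) l)).det ≠ 0 := by
    rw [hz₀]
    refine of_frame_at_center x w (fun y w => (Matrix.of fun l i => α i y (fun _ => w l)).det ≠ 0) ?_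
    have : (Matrix.of fun l i => α i x (fun _ => w l)) = 1 := by
      ext i j; simp [hw, Matrix.one_apply]
    rw [this, Matrix.det_one]
    exact one_ne_zero
  have hsmooth : ∀ φ : DForm I M p, φ.IsSmooth →
      ContDiffAt ℝ 1 (formQuotient φ Ω x) (frameCoord x w) := by
    intro φ hφ
    refine ((contDiffAt_inChart_apply hφ x htarget).div
      (contDiffAt_inChart_apply hΩs x htarget) ?_).of_le (by simp)
    rw [hz₀]
    refine of_frame_at_center x w (fun y w => Ω y w ≠ 0) ?_
    rw [hΩdual x w hw]
    exact one_ne_zero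
  -- Forms of degree `p` in the ideal that realize the equations: on frames dual to `α` they are
  -- non-zero multiples of the values of the `θ i` on single vectors, and of the derivatives
  -- selected by `c`.
  choose Φ hΦ hΦs ε hε hΦε using fun i : ι × Fin p => AlgIdeal.exists_wedge_coframe
    (DiffIdeal.of_mem (θ := θ) i.1) (hθ i.1) α hα ![i.2] (fun a b _ => Subsingleton.elim a b)
  choose Ψ hΨ hΨs ε' hε' hΨε using fun k : κ => AlgIdeal.exists_wedge_coframe
    (DiffIdeal.d_mem (θ := θ) (c k).1) (hdθ _) α hα ![(c k).2.1, (c k).2.2] (by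
      intro a b hab
      fin_cases a <;> fin_cases b <;> first
        | rfl
        | exact absurd hab (hc k)
        | exact absurd hab.symm (hc k))
  have hΦ1 : ∀ (i : ι × Fin p) (y : M) (w' : Fin p → TangentSpace I y),
      (∀ a b, α a y (fun _ => w' b) = if b = a then 1 else 0) →
      Φ i y w' = ε i * θ i.1 y (fun _ => w' i.2) := by
    intro i y w' h
    rw [hΦε i y w' fun a _ b => h a b]
    congr 2
    ext j; fin_cases j; rfl
  have hΨ1 : ∀ (k : κ) (y : M) (w' : Fin p → TangentSpace I y),
      (∀ a b, α a y (fun _ => w' b) = if b = a then 1 else 0) →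
      Ψ k y w' = ε' k * (θ (c k).1).d y ![w' (c k).2.1, w' (c k).2.2] := by
    intro k y w' h
    rw [hΨε k y w' fun a _ b => h a b]
    congr 2
    ext j; fin_cases j <;> rfl
  refine isOrdinaryZero_of_contDiffAt (κ := (ι × Fin p) ⊕ κ) ?_
    (Sum.elim (fun i => formQuotient (Φ i) Ω x) fun k => formQuotient (Ψ k) Ω x) ?_ ?_ ?_ ?_
  · rintro _ ⟨φ, hφ, rfl⟩
    rw [hz₀]
    refine of_frame_at_center x w (fun y w => φ y w / Ω y w = 0) ?_
    rw [DiffIdeal.vanish_of_frame w h₁ h₂ hφ w fun i => Submodule.subset_span ⟨i, rfl⟩, zero_div]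
  · rintro (i | k)
    · exact ⟨_, hΦ i, rfl⟩
    · exact ⟨_, hΨ k, rfl⟩
  · rintro (i | k)
    · exact hsmooth _ (hΦs i)
    · exact hsmooth _ (hΨs k)
  · have := Fintype.ofFinite ι
    have := Fintype.ofFinite κ
    -- A variation `δ` killed by `α` keeps `w + t δ` dual to `α`. Thus `Ω` remains `1`, and the
    -- quotient is `φ` itself along this line.
    have hderiv : ∀ (φ : DForm I M p), φ.IsSmooth → ∀ δ : Fin p → TangentSpace I x,
        (∀ a b, α a x (fun _ => δ b) = 0) → ∀ (P : ℝ → ℝ) (d : ℝ),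
        (∀ t : ℝ, φ x (fun a => w a + t • δ a) = P t) → HasDerivAt P d 0 →
        fderiv ℝ (formQuotient φ Ω x) (frameCoord x w) ((0, δ) : E × (Fin p → E)) = d := by
      intro φ hφ δ hδ P d hP hd
      have hline : HasDerivAt (fun t : ℝ => frameCoord x w + t • ((0, δ) : E × (Fin p → E)))
          ((0, δ) : E × (Fin p → E)) 0 := by
        simpa using ((hasDerivAt_id (0 : ℝ)).smul_const ((0, δ) : E × (Fin p → E))).const_add
          (frameCoord x w)
      have h1 : HasFDerivAt (formQuotient φ Ω x)
          (fderiv ℝ (formQuotient φ Ω x) (frameCoord x w))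
          (frameCoord x w + (0 : ℝ) • ((0, δ) : E × (Fin p → E))) := by
        rw [zero_smul, add_zero]
        exact ((hsmooth φ hφ).differentiableAt (by simp)).hasFDerivAt
      have h2 := h1.comp_hasDerivAt (0 : ℝ) hline
      refine h2.unique (hd.congr_of_eventuallyEq (Filter.Eventually.of_forall fun t => ?_))
      have e1 : frameCoord x w + t • ((0, δ) : E × (Fin p → E)) =
          (extChartAt I x x, ((fun a => w a + t • δ a : Fin p → TangentSpace I x) : Fin p → E)) := by
        rw [hz₀]
        refine Prod.ext ?_ rfl
        change extChartAt I x x + t • (0 : E) = _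
        rw [smul_zero, add_zero]
      simp only [Function.comp_apply]
      rw [e1]
      refine of_frame_at_center x (fun a => w a + t • δ a)
        (fun y w => φ y w / Ω y w = P t) ?_
      rw [hP, hΩdual _ _ fun a b => ?_, div_one]
      rw [← oneFormLinear_apply, map_add, map_smul]
      simp [hw, hδ]
    have hdual : ∀ δ : Fin p → TangentSpace I x, (∀ a b, α a x (fun _ => δ b) = 0) → ∀ t : ℝ,
        ∀ a b, α a x (fun _ => w b + t • δ b) = if b = a then 1 else 0 := by
      intro δ hδ t a b
      rw [← oneFormLinear_apply, map_add, map_smul]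
      simp [hw, hδ]
    rw [Fintype.linearIndependent_iff]
    intro g hg
    -- A linear relation between the differentials, evaluated in the directions `(0, δ)`, is the
    -- relation that `hind` excludes.
    have key := hind (fun i => g (Sum.inl i) * ε i) (fun k => g (Sum.inr k) * ε' k) fun δ hδ => by
      have h := congrArg (fun L => L ((0, δ) : E × (Fin p → E))) hg
      simp only [Fintype.sum_sum_type, Sum.elim_inl, Sum.elim_inr] at h
      rw [finsum_eq_sum_of_fintype, finsum_eq_sum_of_fintype]
      rw [add_apply, sum_apply, sum_apply] at h
      simp only [smul_apply, zero_apply, smul_eq_mul] at h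
      rw [← h]
      congr 1
      · refine Finset.sum_congr rfl fun i _ => ?_
        rw [mul_assoc, hderiv (Φ i) (hΦs i) δ hδ (fun t => ε i *
          (θ i.1 x (fun _ => w i.2) + t * θ i.1 x (fun _ => δ i.2))) (ε i * θ i.1 x fun _ => δ i.2)]
        · intro t
          rw [hΦ1 i x _ (hdual δ hδ t)]
          congr 1
          rw [← oneFormLinear_apply, map_add, map_smul]
          rfl
        · simpa using (((hasDerivAt_id (0 : ℝ)).mul_const (θ i.1 x fun _ => δ i.2)).const_add
            (θ i.1 x fun _ => w i.2)).const_mul (ε i)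
      · refine Finset.sum_congr rfl fun k _ => ?_
        set Θ := (θ (c k).1).d x
        rw [mul_assoc, hderiv (Ψ k) (hΨs k) δ hδ (fun t => ε' k *
          (Θ ![w (c k).2.1, w (c k).2.2] + t * (Θ ![δ (c k).2.1, w (c k).2.2] +
            Θ ![w (c k).2.1, δ (c k).2.2]) + t ^ 2 * Θ ![δ (c k).2.1, δ (c k).2.2])) (ε' k *
              (Θ ![δ (c k).2.1, w (c k).2.2] + Θ ![w (c k).2.1, δ (c k).2.2]))]
        · intro t
          rw [hΨ1 k x _ (hdual δ hδ t)]
          congr 1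
          have right : ∀ a b b' : TangentSpace I x, ∀ t : ℝ,
              Θ ![a, b + t • b'] = Θ ![a, b] + t * Θ ![a, b'] := by
            intro a b b' t
            rw [two_form_swap, ← twoFormLinear_apply, map_add, map_smul, two_form_swap Θ a b,
              two_form_swap Θ a b']
            simp only [twoFormLinear_apply, smul_eq_mul]
            ring
          change Θ ![_, _] = _
          rw [right, ← twoFormLinear_apply, ← twoFormLinear_apply, map_add, map_smul, map_add,
            map_smul]
          simp only [twoFormLinear_apply, smul_eq_mul]
          ring
        · have h1 := (hasDerivAt_id (0 : ℝ)).mul_const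
            (Θ ![δ (c k).2.1, w (c k).2.2] + Θ ![w (c k).2.1, δ (c k).2.2])
          have h2 := ((hasDerivAt_id (0 : ℝ)).pow 2).mul_const (Θ ![δ (c k).2.1, δ (c k).2.2])
          simpa using ((h1.const_add (Θ ![w (c k).2.1, w (c k).2.2])).add h2).const_mul (ε' k)
    rintro (i | k)
    · exact (mul_eq_zero.1 (congrFun key.1 i)).resolve_right (hε i)
    · exact (mul_eq_zero.1 (congrFun key.2 k)).resolve_right (hε' k)
  -- Nearby planes still have a dual frame, on which the quotients are the values of the forms;
  -- `hzero` then supplies the equations that were not selected.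
  · filter_upwards [eventually_det_ne_zero hα x htarget hdet₀, hzero] with z hdet hz hf g hg
    obtain ⟨φ, hφ, rfl⟩ := hg
    have hdual := dualFrame_dual hdet
    have hq : ∀ φ : DForm I M p, formQuotient φ Ω x z =
        φ (basePoint I x z) (dualFrame α (basePoint I x z) (frameAt I x z)) := by
      intro φ
      rw [formQuotient, apply_eq_det_mul_dualFrame hdet φ, apply_eq_det_mul_dualFrame hdet Ω,
        hΩdual _ _ hdual, mul_one, mul_div_cancel_left₀ _ hdet]
    have hθ0 : ∀ i a, θ i (basePoint I x z)
        (fun _ => dualFrame α (basePoint I x z) (frameAt I x z) a) = 0 := by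
      intro i a
      have := hf (Sum.inl (i, a))
      simp only [Sum.elim_inl] at this
      rw [hq, hΦ1 _ _ _ hdual] at this
      exact (mul_eq_zero.1 this).resolve_left (hε _)
    have hdθ0 := hz _ rfl hdual hθ0 fun k => by
      have := hf (Sum.inr k)
      simp only [Sum.elim_inr] at this
      rw [hq, hΨ1 _ _ _ hdual] at this
      exact (mul_eq_zero.1 this).resolve_left (hε' _)
    rw [hq]
    exact DiffIdeal.vanish_of_frame _ hθ0 hdθ0 hφ _ fun i => Submodule.subset_span ⟨i, rfl⟩

end OrdinaryZero

end EDS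

namespace LieTableau

/-! ### Linear independence under perturbation -/

section Independence

variable {U : Type*} [AddCommGroup U] [Module ℝ U] {κ : Type*}

theorem exists_dual_of_linearIndependent [Fintype κ] [DecidableEq κ] {x : κ → U}
    (hx : LinearIndependent ℝ x) :
    ∃ f : U →ₗ[ℝ] (κ → ℝ), ∀ q, f (x q) = Pi.single q 1 := by
  have hinj := linearIndependent_iff_injective_fintypeLinearCombination.1 hx
  obtain ⟨f, hf⟩ := LinearMap.exists_leftInverse_of_injective _ (LinearMap.ker_eq_bot.2 hinj)
  refine ⟨f, fun q => ?_⟩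
  have := LinearMap.congr_fun hf (Pi.single q 1)
  simpa using this

theorem linearIndependent_of_det_ne_zero [Fintype κ] [DecidableEq κ] {x : κ → U}
    (f : U →ₗ[ℝ] (κ → ℝ)) (h : (Matrix.of fun q => f (x q)).det ≠ 0) : LinearIndependent ℝ x := by
  have : LinearIndependent ℝ (f ∘ x) := Matrix.linearIndependent_rows_of_det_ne_zero h
  exact this.of_comp

variable [Finite κ]

/-- Linear independence is an open condition, for the weak topology. -/
theorem eventually_linearIndependent {Z : Type*} [TopologicalSpace Z] {z₀ : Z} {x : Z → κ → U}
    (hx : ∀ q (ξ : U →ₗ[ℝ] ℝ), ContinuousAt (fun z => ξ (x z q)) z₀)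
    (h : LinearIndependent ℝ (x z₀)) : ∀ᶠ z in 𝓝 z₀, LinearIndependent ℝ (x z) := by
  classical
  have := Fintype.ofFinite κ
  -- In dual coordinates the family at `z₀` is the identity matrix, and a non-zero determinant still
  -- certifies independence nearby.
  obtain ⟨f, hf⟩ := exists_dual_of_linearIndependent h
  have hN : ContinuousAt (fun z => (Matrix.of fun q => f (x z q) : Matrix κ κ ℝ)) z₀ :=
    continuousAt_pi.2 fun q => continuousAt_pi.2 fun j => hx q (LinearMap.proj j ∘ₗ f)
  have hdet : ContinuousAt (fun z => (Matrix.of fun q => f (x z q) : Matrix κ κ ℝ).det) z₀ :=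
    ContinuousAt.comp (Continuous.matrix_det continuous_id).continuousAt hN
  have h1 : (Matrix.of fun q => f (x z₀ q) : Matrix κ κ ℝ) = 1 := by
    ext i j; simp [hf, Matrix.one_apply, Pi.single_apply, eq_comm]
  filter_upwards [hdet.eventually_ne (y := 0) (by rw [h1, Matrix.det_one]; exact one_ne_zero)] with z hz
  exact linearIndependent_of_det_ne_zero f hz

/-- On a line through a linearly independent family, almost all families are linearly
independent. -/
theorem eventually_linearIndependent_line {x y : κ → U} (h : LinearIndependent ℝ y) :
    ∀ᶠ t : ℝ in 𝓝[≠] 0, LinearIndependent ℝ (fun q => x q + t • (y q - x q)) := by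
  classical
  have := Fintype.ofFinite κ
  obtain ⟨f, hf⟩ := exists_dual_of_linearIndependent h
  let C : Matrix κ κ ℝ := Matrix.of fun q => f (x q)
  -- In coordinates dual to `y` the line runs from `C` at `t = 0` to the identity at `t = 1`. The
  -- determinant is a polynomial in `t` with value `1` at `1`, so only finitely many `t` are bad.
  let P : Polynomial ℝ := (C.map Polynomial.C +
    (Polynomial.X : Polynomial ℝ) • (1 - C).map Polynomial.C).det
  have hP : ∀ t, P.eval t = (Matrix.of fun q => f (x q + t • (y q - x q)) : Matrix κ κ ℝ).det := by
    intro t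
    rw [← Polynomial.coe_evalRingHom, RingHom.map_det]
    congr 1
    ext i j
    by_cases hij : i = j
    · subst hij
      simp [C, hf]
    · have hji : j ≠ i := fun h => hij h.symm
      simp [C, hf, hij, hji]
      ring
  have hne : P ≠ 0 := by
    intro h0
    have h1 := hP 1
    have h2 : (Matrix.of fun q => f (x q + (1 : ℝ) • (y q - x q)) : Matrix κ κ ℝ) = 1 := by
      ext i j; simp [hf, Matrix.one_apply, Pi.single_apply, eq_comm]
    rw [h2, h0] at h1
    simp at h1
  have hfin : {t | P.eval t = 0}.Finite := by
    refine P.roots.toFinset.finite_toSet.subset fun t ht => ?_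
    simpa [hne] using ht
  filter_upwards [nhdsNE_le_cofinite 0 hfin.compl_mem_cofinite] with t ht
  refine linearIndependent_of_det_ne_zero f ?_
  rw [← hP]
  exact ht

end Independence

/-! ### Generic sequences and Cartan's test -/

section Generic

variable {V W : Type*} [AddCommGroup V] [Module ℝ V] [AddCommGroup W] [Module ℝ W]

/-- The members of `A` which vanish on the first `j` vectors of a sequence. -/
def tupleKer (A : Submodule ℝ (V →ₗ[ℝ] W)) (a : ℕ → V) (j : ℕ) : Submodule ℝ A where
  carrier := {P | ∀ i < j, (P : V →ₗ[ℝ] W) (a i) = 0}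
  add_mem' := fun {P Q} hP hQ i hi => by simp [hP i hi, hQ i hi]
  zero_mem' := fun _ _ => rfl
  smul_mem' := fun c P hP i hi => by simp [hP i hi]

/-- A sequence of vectors whose first `dim V` members form a basis with a generic flag. -/
structure IsGenericTuple (A : Submodule ℝ (V →ₗ[ℝ] W)) (a : ℕ → V) : Prop where
  linearIndependent : LinearIndependent ℝ fun i : Fin (Module.finrank ℝ V) => a i
  finrank_eq : ∀ j ≤ Module.finrank ℝ V, Module.finrank ℝ (tupleKer A a j) = minDim A j

/-- Evaluation of the members of `A` on the first `j` vectors of a sequence. -/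
def tupleEval (A : Submodule ℝ (V →ₗ[ℝ] W)) (a : ℕ → V) (j : ℕ) : A →ₗ[ℝ] (Fin j → W) where
  toFun P i := (P : V →ₗ[ℝ] W) (a i)
  map_add' P Q := by ext; simp
  map_smul' c P := by ext; simp

theorem ker_tupleEval (A : Submodule ℝ (V →ₗ[ℝ] W)) (a : ℕ → V) (j : ℕ) :
    LinearMap.ker (tupleEval A a j) = tupleKer A a j := by
  ext P
  rw [LinearMap.mem_ker, funext_iff]
  exact ⟨fun h i hi => h ⟨i, hi⟩, fun h i => h i i.2⟩

theorem exists_flag {a : ℕ → V} (ha : LinearIndependent ℝ fun i : Fin (Module.finrank ℝ V) => a i) :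
    ∃ ℓ : CompleteFlag ℝ V, ∀ j ≤ Module.finrank ℝ V,
      ℓ.space j = Submodule.span ℝ (a '' {i | i < j}) := by
  set k := Module.finrank ℝ V with hk
  refine ⟨⟨fun j => Submodule.span ℝ (a '' {i | i < min j k}), ?_, ?_⟩, ?_⟩
  · intro i j hij
    refine Submodule.span_mono (Set.image_mono fun l hl => ?_)
    simp only [Set.mem_ofPred_eq] at hl ⊢
    omega
  · intro j hj
    have h1 : a '' {i | i < min j k} = Set.range fun i : Fin j => a i := by
      rw [min_eq_left hj]
      ext v
      simp only [Set.mem_image, Set.mem_ofPred_eq, Set.mem_range]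
      exact ⟨fun ⟨i, hi, h⟩ => ⟨⟨i, hi⟩, h⟩, fun ⟨i, h⟩ => ⟨i, i.2, h⟩⟩
    have h2 : LinearIndependent ℝ fun i : Fin j => a i :=
      ha.comp (Fin.castLE hj) (Fin.castLE_injective hj)
    change Module.finrank ℝ (Submodule.span ℝ (a '' {i | i < min j k})) = j
    rw [h1]
    simpa using finrank_span_eq_card h2
  · intro j hj
    simp only [min_eq_left hj]

theorem finrank_restrictedKer_eq (A : Submodule ℝ (V →ₗ[ℝ] W)) {ℓ : CompleteFlag ℝ V} {a : ℕ → V}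
    {j : ℕ} (h : ℓ.space j = Submodule.span ℝ (a '' {i | i < j})) :
    Module.finrank ℝ (restrictedKer A ℓ j) = Module.finrank ℝ (tupleKer A a j) := by
  rw [← Submodule.finrank_map_subtype_eq]
  suffices restrictedKer A ℓ j = Submodule.map A.subtype (tupleKer A a j) by rw [this]
  ext P
  simp only [Submodule.mem_map, Submodule.subtype_apply, Subtype.exists, exists_and_right,
    exists_eq_right]
  constructor
  · rintro ⟨hP, h0⟩
    refine ⟨hP, fun i hi => h0 _ ?_⟩
    rw [h]
    exact Submodule.subset_span ⟨i, hi, rfl⟩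
  · rintro ⟨hP, h0⟩
    refine ⟨hP, fun v hv => ?_⟩
    rw [h] at hv
    have : Submodule.span ℝ (a '' {i | i < j}) ≤ LinearMap.ker P := by
      rw [Submodule.span_le]
      rintro _ ⟨i, hi, rfl⟩
      exact h0 i hi
    exact this hv

theorem minDim_le_finrank_tupleKer (A : Submodule ℝ (V →ₗ[ℝ] W)) {a : ℕ → V}
    (ha : LinearIndependent ℝ fun i : Fin (Module.finrank ℝ V) => a i) {j : ℕ}
    (hj : j ≤ Module.finrank ℝ V) : minDim A j ≤ Module.finrank ℝ (tupleKer A a j) := by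
  obtain ⟨ℓ, hℓ⟩ := exists_flag ha
  rw [← finrank_restrictedKer_eq A (hℓ j hj)]
  exact Nat.sInf_le ⟨ℓ, rfl⟩

theorem mem_prolongation_iff {A : Submodule ℝ (V →ₗ[ℝ] W)} (F : V →ₗ[ℝ] A) :
    F ∈ prolongation A ↔ ∀ v w, (F v : V →ₗ[ℝ] W) w = (F w : V →ₗ[ℝ] W) v := by
  rw [prolongation, LinearMap.mem_ker]
  constructor
  · intro h v w
    have := LinearMap.congr_fun (LinearMap.congr_fun h v) w
    simpa [rho, sub_eq_zero] using this
  · intro h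
    ext v w
    simp [rho, h v w]

/-- The basis formed by the first `dim V` members of a sequence. -/
noncomputable def tupleBasis [FiniteDimensional ℝ V] {a : ℕ → V}
    (ha : LinearIndependent ℝ fun i : Fin (Module.finrank ℝ V) => a i) :
    Module.Basis (Fin (Module.finrank ℝ V)) ℝ V :=
  basisOfLinearIndependentOfCardEqFinrank' (fun i : Fin (Module.finrank ℝ V) => a i) ha (by simp)

theorem tupleBasis_apply [FiniteDimensional ℝ V] {a : ℕ → V}
    (ha : LinearIndependent ℝ fun i : Fin (Module.finrank ℝ V) => a i)
    (i : Fin (Module.finrank ℝ V)) : tupleBasis ha i = a i := by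
  simp [tupleBasis]

theorem IsGenericTuple.tupleKer_eq_bot [FiniteDimensional ℝ V]
    {A : Submodule ℝ (V →ₗ[ℝ] W)} {a : ℕ → V} (h : IsGenericTuple A a) : tupleKer A a (Module.finrank ℝ V) = ⊥ := by
  rw [eq_bot_iff]
  intro P hP
  let b := tupleBasis h.linearIndependent
  have hb : ∀ i, b i = a i := tupleBasis_apply _
  apply Subtype.ext
  refine b.ext fun i => ?_
  rw [hb]
  exact hP i i.2

/-- The components of the equations `P_i(a_l) = P_l(a_i)`. -/
def symFunctional {n : ℕ} (A : Submodule ℝ (V →ₗ[ℝ] W)) (ξ : Fin n → W →ₗ[ℝ] ℝ) (a : ℕ → V) {p : ℕ}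
    (t : Fin n × Fin p × Fin p) : (Fin p → A) →ₗ[ℝ] ℝ where
  toFun P := ξ t.1 ((P t.2.1 : V →ₗ[ℝ] W) (a t.2.2) - (P t.2.2 : V →ₗ[ℝ] W) (a t.2.1))
  map_add' P Q := by simp; ring
  map_smul' c P := by simp [mul_sub]

theorem symFunctional_apply {A : Submodule ℝ (V →ₗ[ℝ] W)} {a : ℕ → V} {n : ℕ} (ξ : Fin n → W →ₗ[ℝ] ℝ) {p : ℕ}
    (t : Fin n × Fin p × Fin p) (P : Fin p → A) :
    symFunctional A ξ a t P =
      ξ t.1 ((P t.2.1 : V →ₗ[ℝ] W) (a t.2.2) - (P t.2.2 : V →ₗ[ℝ] W) (a t.2.1)) := rfl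

variable [FiniteDimensional ℝ V] [FiniteDimensional ℝ W] {A : Submodule ℝ (V →ₗ[ℝ] W)}

/-- A finite subfamily of `A` which detects the rank of the evaluation on a tuple. -/
theorem exists_rank_family (a : ℕ → V) (j : ℕ) :
    ∃ (r : ℕ) (P : Fin r → A), LinearIndependent ℝ (fun q => tupleEval A a j (P q)) ∧
      r + Module.finrank ℝ (tupleKer A a j) = Module.finrank ℝ A := by
  let b := Module.finBasis ℝ (LinearMap.range (tupleEval A a j))
  choose P hP using fun q => (b q).2
  refine ⟨_, P, ?_, ?_⟩
  · have : (fun q => tupleEval A a j (P q)) =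
      fun q => (LinearMap.range (tupleEval A a j)).subtype (b q) := funext hP
    rw [this]
    exact b.linearIndependent.map' _ (Submodule.ker_subtype _)
  · rw [← ker_tupleEval]
    exact LinearMap.finrank_range_add_finrank_ker _

/-- Evaluation has rank at least `r`, which bounds its kernel from above. Since independence
survives perturbation, this is the semicontinuity of `dim A_j`. -/
theorem finrank_tupleKer_add_le {a : ℕ → V} {j r : ℕ} {P : Fin r → A}
    (hP : LinearIndependent ℝ (fun q => tupleEval A a j (P q))) :
    r + Module.finrank ℝ (tupleKer A a j) ≤ Module.finrank ℝ A := by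
  rw [← ker_tupleEval, ← LinearMap.finrank_range_add_finrank_ker (tupleEval A a j)]
  have h1 : LinearIndependent ℝ (fun q => (⟨tupleEval A a j (P q), P q, rfl⟩ :
      LinearMap.range (tupleEval A a j))) := by
    refine LinearIndependent.of_comp (LinearMap.range (tupleEval A a j)).subtype ?_
    exact hP
  have := h1.fintype_card_le_finrank
  simp only [Fintype.card_fin] at this
  omega

/-- Near `z₀` the kernels cannot grow, and no kernel is smaller than the minimum over all flags; so
genericity is an open condition. -/
theorem IsGenericTuple.eventually {Z : Type*} [TopologicalSpace Z] {z₀ : Z} {a : Z → ℕ → V}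
    (ha : ∀ i < Module.finrank ℝ V, ∀ ξ : V →ₗ[ℝ] ℝ, ContinuousAt (fun z => ξ (a z i)) z₀)
    (h : IsGenericTuple A (a z₀)) : ∀ᶠ z in 𝓝 z₀, IsGenericTuple A (a z) := by
  have h1 : ∀ᶠ z in 𝓝 z₀, LinearIndependent ℝ fun i : Fin (Module.finrank ℝ V) => a z i :=
    eventually_linearIndependent (fun i ξ => ha i i.2 ξ) h.linearIndependent
  have h2 : ∀ j : Fin (Module.finrank ℝ V + 1), ∀ᶠ z in 𝓝 z₀,
      Module.finrank ℝ (tupleKer A (a z) j) ≤ minDim A j := by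
    intro j
    obtain ⟨r, P, hP, hr⟩ := exists_rank_family (A := A) (a z₀) j
    have := eventually_linearIndependent (x := fun z q => tupleEval A (a z) j (P q)) (z₀ := z₀)
      (fun q ξ => ?_) hP
    · filter_upwards [this] with z hz
      have h3 := finrank_tupleKer_add_le hz
      have h4 := h.finrank_eq j (by omega)
      omega
    · have e : (fun z => ξ (tupleEval A (a z) j (P q))) = fun z => ∑ i : Fin j,
          (ξ ∘ₗ LinearMap.single ℝ (fun _ : Fin j => W) i ∘ₗ (P q : V →ₗ[ℝ] W)) (a z i) := by
        ext z
        simp only [LinearMap.comp_apply, ← map_sum]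
        congr 1
        ext i
        simp [tupleEval, Finset.sum_apply, Pi.single_apply]
      rw [e]
      refine tendsto_finsetSum _ fun i _ => ha i (by omega) _
  filter_upwards [h1, Filter.eventually_all.2 h2] with z hz1 hz2
  exact ⟨hz1, fun j hj => le_antisymm (hz2 ⟨j, by omega⟩) (minDim_le_finrank_tupleKer A hz1 hj)⟩

/-- The same two bounds, along a line through the generic sequence `b`. The starting sequence `a` is
arbitrary, because only finitely many `t` can fail. -/
theorem IsGenericTuple.eventually_line {a b : ℕ → V} (h : IsGenericTuple A b) :
    ∀ᶠ t : ℝ in 𝓝[≠] 0, IsGenericTuple A (fun i => a i + t • (b i - a i)) := by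
  have h1 : ∀ᶠ t : ℝ in 𝓝[≠] 0, LinearIndependent ℝ fun i : Fin (Module.finrank ℝ V) =>
      a i + t • (b i - a i) := eventually_linearIndependent_line h.linearIndependent
  have h2 : ∀ j : Fin (Module.finrank ℝ V + 1), ∀ᶠ t : ℝ in 𝓝[≠] 0,
      Module.finrank ℝ (tupleKer A (fun i => a i + t • (b i - a i)) j) ≤ minDim A j := by
    intro j
    obtain ⟨r, P, hP, hr⟩ := exists_rank_family (A := A) b j
    have := eventually_linearIndependent_line (x := fun q => tupleEval A a j (P q)) hP
    filter_upwards [this] with t ht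
    have e : (fun q => tupleEval A a j (P q) + t • (tupleEval A b j (P q) - tupleEval A a j (P q))) =
        fun q => tupleEval A (fun i => a i + t • (b i - a i)) j (P q) := by
      ext q i
      simp [tupleEval]
    rw [e] at ht
    have h3 := finrank_tupleKer_add_le ht
    have h4 := h.finrank_eq j (by omega)
    omega
  filter_upwards [h1, Filter.eventually_all.2 h2] with t hz1 hz2
  exact ⟨hz1, fun j hj => le_antisymm (hz2 ⟨j, by omega⟩) (minDim_le_finrank_tupleKer A hz1 hj)⟩

theorem AdaptedBasis.exists_isGenericTuple {𝔤 : Type*} [LieRing 𝔤] [LieAlgebra ℝ 𝔤]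
    {𝔞 𝔟 : Submodule ℝ 𝔤} {k h s : ℕ} (𝓑 : AdaptedBasis 𝔞 𝔟 k h s) {A : Submodule ℝ (𝔞 →ₗ[ℝ] 𝔟)}
    (h𝓑 : 𝓑.IsGeneric A) (hk : Module.finrank ℝ 𝔞 = k) :
    ∃ a : ℕ → 𝔞, IsGenericTuple A a := by
  classical
  let a : ℕ → 𝔞 := fun i => if hi : i < k then 𝓑.vecA ⟨i, hi⟩ else 0
  obtain ⟨ℓ, hℓ, hspace⟩ := h𝓑
  refine ⟨a, ?_, fun j hj => ?_⟩
  · rw [hk]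
    have h1 : LinearIndependent ℝ (𝔞.subtype ∘ fun i : Fin k => a i) := by
      have : (𝔞.subtype ∘ fun i : Fin k => a i) = fun i => 𝓑.basis (Sum.inl i) := by
        ext i
        simp [a, AdaptedBasis.vecA]
      rw [this]
      exact 𝓑.basis.linearIndependent.comp Sum.inl Sum.inl_injective
    exact h1.of_comp
  · rw [← hℓ j hj]
    refine (finrank_restrictedKer_eq A ?_).symm
    rw [hspace j (hk ▸ hj)]
    congr 1
    ext v
    constructor
    · rintro ⟨i, hi, rfl⟩
      exact ⟨i, hi, by simp [a]⟩
    · rintro ⟨i, hi, rfl⟩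
      have hik : i < k := lt_of_lt_of_le hi (hk ▸ hj)
      exact ⟨⟨i, hik⟩, hi, by simp [a, hik]⟩

/-- The tuples `(P_1, …, P_p)` in `A` with `P_i(a_l) = P_l(a_i)`. -/
def symTuple (A : Submodule ℝ (V →ₗ[ℝ] W)) (a : ℕ → V) (p : ℕ) : Submodule ℝ (Fin p → A) where
  carrier := {P | ∀ i l : Fin p, (P i : V →ₗ[ℝ] W) (a l) = (P l : V →ₗ[ℝ] W) (a i)}
  add_mem' := fun {P Q} hP hQ i l => by simp [hP i l, hQ i l]
  zero_mem' := fun _ _ => rfl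
  smul_mem' := fun c P hP i l => by simp [hP i l]

/-- Omission of the last member of a symmetric tuple. -/
def symTupleInit (A : Submodule ℝ (V →ₗ[ℝ] W)) (a : ℕ → V) (p : ℕ) :
    symTuple A a (p + 1) →ₗ[ℝ] symTuple A a p where
  toFun P := ⟨fun i => P.1 i.castSucc, fun i l => P.2 i.castSucc l.castSucc⟩
  map_add' _ _ := rfl
  map_smul' _ _ := rfl

/-- When all members but the last are zero, symmetry forces the last one to vanish on the first `p`
vectors. -/
theorem finrank_ker_symTupleInit_le (a : ℕ → V) (p : ℕ) :
    Module.finrank ℝ (LinearMap.ker (symTupleInit A a p)) ≤ Module.finrank ℝ (tupleKer A a p) := by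
  let f : LinearMap.ker (symTupleInit A a p) →ₗ[ℝ] tupleKer A a p :=
    { toFun := fun P => ⟨P.1.1 (Fin.last p), fun i hi => by
        have h1 := P.1.2 (Fin.last p) (Fin.castSucc ⟨i, hi⟩)
        have h2 : P.1.1 (Fin.castSucc ⟨i, hi⟩) = 0 :=
          congrFun (congrArg Subtype.val (LinearMap.mem_ker.1 P.2)) ⟨i, hi⟩
        rw [h2] at h1
        simpa using h1⟩
      map_add' := fun _ _ => rfl
      map_smul' := fun _ _ => rfl }
  refine LinearMap.finrank_le_finrank_of_injective (f := f) ?_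
  intro P P' hPP'
  apply Subtype.ext
  apply Subtype.ext
  ext1 i
  refine Fin.lastCases ?_ (fun i => ?_) i
  · exact congrArg Subtype.val hPP'
  · exact (congrFun (congrArg Subtype.val (LinearMap.mem_ker.1 P.2)) i).trans
      (congrFun (congrArg Subtype.val (LinearMap.mem_ker.1 P'.2)) i).symm

theorem finrank_symTuple_succ_le (a : ℕ → V) (p : ℕ) :
    Module.finrank ℝ (symTuple A a (p + 1)) ≤
      Module.finrank ℝ (symTuple A a p) + Module.finrank ℝ (tupleKer A a p) := by
  have h1 := LinearMap.finrank_range_add_finrank_ker (V := symTuple A a (p + 1))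
    (V₂ := symTuple A a p) (symTupleInit A a p)
  have h2 := finrank_ker_symTupleInit_le (A := A) a p
  have h3 := Submodule.finrank_le (LinearMap.range (symTupleInit A a p))
  omega

/-- Equality in the dimension count leaves no room for a proper range. -/
theorem symTupleInit_surjective_of_finrank_eq {a : ℕ → V} {p : ℕ}
    (h : Module.finrank ℝ (symTuple A a (p + 1)) =
      Module.finrank ℝ (symTuple A a p) + Module.finrank ℝ (tupleKer A a p)) :
    Function.Surjective (symTupleInit A a p) := by
  have h1 := LinearMap.finrank_range_add_finrank_ker (V := symTuple A a (p + 1))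
    (V₂ := symTuple A a p) (symTupleInit A a p)
  have h2 := finrank_ker_symTupleInit_le (A := A) a p
  have h3 := Submodule.finrank_le (LinearMap.range (symTupleInit A a p))
  rw [← LinearMap.range_eq_top]
  exact Submodule.eq_top_of_finrank_eq (K := ℝ) (V := symTuple A a p) (by omega)

/-- Restriction of a member of the prolongation to a basis. -/
noncomputable def prolongationEquiv {a : ℕ → V}
    (ha : LinearIndependent ℝ fun i : Fin (Module.finrank ℝ V) => a i) :
    prolongation A ≃ₗ[ℝ] symTuple A a (Module.finrank ℝ V) :=
  let b := tupleBasis ha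
  have hb : ∀ i, b i = a i := tupleBasis_apply _
  { toFun := fun F => ⟨fun i => F.1 (a i), fun i l => (mem_prolongation_iff F.1).1 F.2 _ _⟩
    map_add' := fun _ _ => rfl
    map_smul' := fun _ _ => rfl
    invFun := fun P => ⟨b.constr ℝ P.1, by
      rw [mem_prolongation_iff]
      have key : A.subtype ∘ₗ b.constr ℝ P.1 = (A.subtype ∘ₗ b.constr ℝ P.1).flip := by
        refine b.ext fun i => b.ext fun l => ?_
        simp only [LinearMap.comp_apply, LinearMap.flip_apply, Module.Basis.constr_basis,
          Submodule.subtype_apply]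
        rw [hb, hb]
        exact P.2 i l
      exact fun v w => LinearMap.congr_fun (LinearMap.congr_fun key v) w⟩
    left_inv := fun F => by
      apply Subtype.ext
      refine b.ext fun i => ?_
      rw [Module.Basis.constr_basis, hb]
    right_inv := fun P => by
      apply Subtype.ext
      ext1 i
      change b.constr ℝ P.1 (a i) = P.1 i
      rw [← hb, Module.Basis.constr_basis] }

/-- Summation by parts. With `d j = dim A_j` it turns `s'_1 + 2 s'_2 + ⋯ + k s'_k` into `dim A_0 + ⋯
+ dim A_{k-1}`, the boundary term being zero. -/
theorem sum_mul_sub_eq (d : ℕ → ℕ) (n : ℕ) (hd : ∀ j < n, d (j + 1) ≤ d j) :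
    ∑ j ∈ Finset.Icc 1 n, j * (d (j - 1) - d j) + n * d n = ∑ j ∈ Finset.range n, d j := by
  induction n with
  | zero => simp
  | succ n ih =>
    have h1 := ih fun j hj => hd j (by omega)
    rw [Finset.sum_Icc_succ_top (by omega), Finset.sum_range_succ, ← h1]
    obtain ⟨c, hc⟩ := Nat.exists_eq_add_of_le (hd n (by omega))
    simp only [Nat.add_sub_cancel, hc, Nat.add_sub_cancel_left]
    ring

namespace IsGenericTuple

variable {a : ℕ → V}

theorem minDim_finrank (h : IsGenericTuple A a) : minDim A (Module.finrank ℝ V) = 0 := by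
  rw [← h.finrank_eq _ le_rfl, h.tupleKer_eq_bot, finrank_bot]

theorem minDim_succ_le (h : IsGenericTuple A a) {j : ℕ} (hj : j < Module.finrank ℝ V) : minDim A (j + 1) ≤ minDim A j := by
  rw [← h.finrank_eq _ hj, ← h.finrank_eq _ hj.le]
  exact Submodule.finrank_mono fun P hP i hi => hP i (by omega)

theorem finrank_prolongation (h : IsGenericTuple A a) (hA : IsInvolutive A) :
    Module.finrank ℝ (prolongation A) = ∑ j ∈ Finset.range (Module.finrank ℝ V), minDim A j := by
  rw [hA, ← sum_mul_sub_eq _ _ fun j hj => h.minDim_succ_le hj, h.minDim_finrank]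
  simp [character]

theorem finrank_symTuple_le (h : IsGenericTuple A a) {p q : ℕ} (hpq : p ≤ q) (hq : q ≤ Module.finrank ℝ V) :
    Module.finrank ℝ (symTuple A a q) ≤
      Module.finrank ℝ (symTuple A a p) + ∑ j ∈ Finset.Ico p q, minDim A j := by
  induction q, hpq using Nat.le_induction with
  | base => simp
  | succ q hpq ih =>
    have h1 := ih (by omega)
    have h2 := finrank_symTuple_succ_le (A := A) a q
    rw [h.finrank_eq q (by omega)] at h2
    rw [Finset.sum_Ico_succ_top hpq]
    omega

/-- The bounds from `0` to `p` and from `p` to `dim V` add up to the bound for the prolongation.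
Involutivity says that this total is attained, so both partial bounds are. -/
theorem finrank_symTuple (h : IsGenericTuple A a) (hA : IsInvolutive A) {p : ℕ} (hp : p ≤ Module.finrank ℝ V) :
    Module.finrank ℝ (symTuple A a p) = ∑ j ∈ Finset.range p, minDim A j := by
  have h0 : Module.finrank ℝ (symTuple A a 0) = 0 := Module.finrank_zero_of_subsingleton
  have h1 := h.finrank_symTuple_le (Nat.zero_le p) hp
  have h2 := h.finrank_symTuple_le hp le_rfl
  have h3 := h.finrank_prolongation hA
  rw [(prolongationEquiv h.linearIndependent).finrank_eq] at h3
  have h4 := Finset.sum_range_add_sum_Ico (minDim A) hp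
  rw [h0, Nat.Ico_zero_eq_range] at h1
  omega

/-- For an involutive tableau, a symmetric tuple over part of a generic basis extends to a member
of the prolongation. -/
theorem exists_prolongation (h : IsGenericTuple A a) (hA : IsInvolutive A) {p : ℕ} (hp : p ≤ Module.finrank ℝ V)
    {P : Fin p → A} (hP : P ∈ symTuple A a p) :
    ∃ F : V →ₗ[ℝ] A, F ∈ prolongation A ∧ ∀ i : Fin p, F (a i) = P i := by
  have key : ∀ q, p ≤ q → q ≤ Module.finrank ℝ V →
      ∃ P' ∈ symTuple A a q, ∀ (i : Fin p) (hi : (i : ℕ) < q), P' ⟨i, hi⟩ = P i := by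
    intro q hpq
    induction q, hpq using Nat.le_induction with
    | base => exact fun _ => ⟨P, hP, fun i hi => rfl⟩
    | succ q hpq ih =>
      intro hq
      obtain ⟨P', hP', hPP'⟩ := ih (by omega)
      -- The dimensions at `q` and `q + 1` differ by exactly `dim A_q`, so the tuple can be
      -- lengthened by one member.
      have hs := symTupleInit_surjective_of_finrank_eq (A := A) (a := a) (p := q) (by
        rw [h.finrank_symTuple hA hq, h.finrank_symTuple hA (by omega), h.finrank_eq q (by omega),
          Finset.sum_range_succ])
      obtain ⟨P'', hP''⟩ := hs ⟨P', hP'⟩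
      refine ⟨P''.1, P''.2, fun i hi => ?_⟩
      rw [← hPP' i (by omega)]
      exact congrFun (congrArg Subtype.val hP'') ⟨i, by omega⟩
  obtain ⟨P', hP', hPP'⟩ := key _ hp le_rfl
  let F := (prolongationEquiv h.linearIndependent).symm ⟨P', hP'⟩
  refine ⟨F.1, F.2, fun i => ?_⟩
  have := congrArg (fun S => S.1 ⟨i, by omega⟩)
    ((prolongationEquiv h.linearIndependent).apply_symm_apply ⟨P', hP'⟩)
  rw [← hPP' i (by omega)]
  exact this

theorem mem_symTuple_iff {n : ℕ} {ξ : Fin n → W →ₗ[ℝ] ℝ} (hξ : ∀ w, (∀ j, ξ j w = 0) → w = 0)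
    {p : ℕ} (P : Fin p → A) :
    P ∈ symTuple A a p ↔ ∀ t, symFunctional A ξ a t P = 0 := by
  constructor
  · intro hP t
    rw [symFunctional_apply, hP t.2.1 t.2.2, sub_self, map_zero]
  · intro hP i l
    exact sub_eq_zero.1 (hξ _ fun j => hP (j, i, l))

theorem symTuple_eq_dualCoannihilator {n : ℕ} {ξ : Fin n → W →ₗ[ℝ] ℝ}
    (hξ : ∀ w, (∀ j, ξ j w = 0) → w = 0) {p : ℕ} : symTuple A a p =
      (Submodule.span ℝ (Set.range (symFunctional A ξ a (p := p)))).dualCoannihilator := by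
  ext P
  rw [mem_symTuple_iff hξ, Submodule.mem_dualCoannihilator]
  constructor
  · intro hP φ hφ
    have : Submodule.span ℝ (Set.range (symFunctional A ξ a (p := p))) ≤
        LinearMap.ker (LinearMap.applyₗ P) := by
      rw [Submodule.span_le]
      rintro _ ⟨t, rfl⟩
      exact hP t
    exact this hφ
  · exact fun hP t => hP _ (Submodule.subset_span ⟨t, rfl⟩)

/-- A maximal independent set of the equations `P_i(a_l) = P_l(a_i)` for a generic basis remains one
for all nearby bases. -/
theorem exists_independent_equations {Z : Type*} [TopologicalSpace Z] {z₀ : Z} {a : Z → ℕ → V}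
    (hcont : ∀ i < Module.finrank ℝ V, ∀ ξ : V →ₗ[ℝ] ℝ, ContinuousAt (fun z => ξ (a z i)) z₀)
    (h : IsGenericTuple A (a z₀)) (hA : IsInvolutive A) {n : ℕ} {ξ : Fin n → W →ₗ[ℝ] ℝ}
    (hξ : ∀ w, (∀ j, ξ j w = 0) → w = 0) {p : ℕ} (hp : p ≤ Module.finrank ℝ V) :
    ∃ (κ : Type) (_ : Finite κ) (c : κ → Fin n × Fin p × Fin p), (∀ q, (c q).2.1 ≠ (c q).2.2) ∧
      LinearIndependent ℝ (fun q => symFunctional A ξ (a z₀) (c q)) ∧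
      ∀ᶠ z in 𝓝 z₀, ∀ P : Fin p → A, (∀ q, symFunctional A ξ (a z) (c q) P = 0) →
        P ∈ symTuple A (a z) p := by
  -- A subfamily of the equations at `z₀` that is a basis of their span.
  obtain ⟨κ, c, hinj, hspan, hli⟩ :=
    exists_linearIndependent' ℝ (symFunctional A ξ (a z₀) (p := p))
  have hfin : Finite κ := Finite.of_injective c hinj
  have := Fintype.ofFinite κ
  refine ⟨κ, hfin, c, fun q hq => ?_, hli, ?_⟩
  -- An equation with `i = l` is trivial and cannot belong to an independent family.
  · refine hli.ne_zero q (LinearMap.ext fun P => ?_)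
    simp only [Function.comp_apply]
    rw [symFunctional_apply, hq, sub_self, map_zero, LinearMap.zero_apply]
  have hev := eventually_linearIndependent (x := fun z q => symFunctional A ξ (a z) (c q))
    (z₀ := z₀) (fun q φ => ?_) hli
  -- The symmetric tuples at `z` have the same codimension as at `z₀`, namely the number of selected
  -- equations. These are still independent at `z`, so by dimension they cut out the symmetric
  -- tuples there.
  · filter_upwards [h.eventually hcont, hev] with z hz hliz P hP
    have h1 := h.finrank_symTuple hA hp
    have h2 := hz.finrank_symTuple hA hp
    rw [symTuple_eq_dualCoannihilator hξ, ← hspan] at h1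
    have h3 := Subspace.finrank_add_finrank_dualCoannihilator_eq
      (Submodule.span ℝ (Set.range (symFunctional A ξ (a z₀) ∘ c)))
    have h4 := Subspace.finrank_add_finrank_dualCoannihilator_eq
      (Submodule.span ℝ (Set.range fun q => symFunctional A ξ (a z) (c q)))
    rw [finrank_span_eq_card hli] at h3
    rw [finrank_span_eq_card hliz] at h4
    have hle : symTuple A (a z) p ≤
        (Submodule.span ℝ (Set.range fun q => symFunctional A ξ (a z) (c q))).dualCoannihilator := by
      rw [symTuple_eq_dualCoannihilator hξ]
      refine Submodule.dualCoannihilator_anti (Submodule.span_mono ?_)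
      rintro _ ⟨q, rfl⟩
      exact ⟨c q, rfl⟩
    rw [Submodule.eq_of_le_of_finrank_eq hle (by omega), Submodule.mem_dualCoannihilator]
    intro φ hφ
    have : Submodule.span ℝ (Set.range fun q => symFunctional A ξ (a z) (c q)) ≤
        LinearMap.ker (LinearMap.applyₗ P) := by
      rw [Submodule.span_le]
      rintro _ ⟨t, rfl⟩
      exact hP t
    exact this hφ
  -- Functionals on the dual space are evaluations, so only continuity on a fixed tuple is needed.
  · obtain ⟨P, rfl⟩ := (Module.evalEquiv ℝ (Fin p → A)).surjective φ
    simp only [Module.evalEquiv_apply, Module.Dual.eval_apply, symFunctional_apply, map_sub]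
    exact ContinuousAt.sub (hcont _ (by omega) (ξ _ ∘ₗ _)) (hcont _ (by omega) (ξ _ ∘ₗ _))

end IsGenericTuple

end Generic

end LieTableau

namespace LieTableau

open EDS

/-! ### The Maurer–Cartan form in charts -/

section MaurerCartan

variable {E : Type*} [NormedAddCommGroup E] [NormedSpace ℝ E]
  {G : Type*} [TopologicalSpace G] [ChartedSpace E G] [Group G] [LieGroup 𝓘(ℝ, E) ∞ G]

/-- The Maurer-Cartan form, in the preferred chart at `x₀`. -/
noncomputable def maurerCartan (x₀ : G) (u : E) : E →L[ℝ] E :=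
  fderiv ℝ (fun u' => extChartAt 𝓘(ℝ, E) (1 : G)
    (((extChartAt 𝓘(ℝ, E) x₀).symm u)⁻¹ * (extChartAt 𝓘(ℝ, E) x₀).symm u')) u

theorem mdifferentiableAt_extChartAt_symm {x₀ : G} {u : E}
    (hu : u ∈ (extChartAt 𝓘(ℝ, E) x₀).target) :
    MDifferentiableAt 𝓘(ℝ, E) 𝓘(ℝ, E) (extChartAt 𝓘(ℝ, E) x₀).symm u :=
  have : IsManifold 𝓘(ℝ, E) ∞ G := ContMDiffMul.toIsManifold
  ((contMDiffOn_extChartAt_symm (n := ∞) x₀).contMDiffAt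
    ((isOpen_extChartAt_target x₀).mem_nhds hu)).mdifferentiableAt (by simp)

theorem mdifferentiableAt_mul_left (g x : G) :
    MDifferentiableAt 𝓘(ℝ, E) 𝓘(ℝ, E) (fun x : G => g * x) x :=
  (contMDiff_mul_left (I := 𝓘(ℝ, E)) (n := ∞) (a := g)).contMDiffAt.mdifferentiableAt (by simp)

theorem mfderiv_mul_left_injective (g x : G) : Function.Injective
    (mfderiv 𝓘(ℝ, E) 𝓘(ℝ, E) (fun x : G => g * x) x : E →L[ℝ] E) := by
  have h1 := mfderiv_comp (I' := 𝓘(ℝ, E)) x (mdifferentiableAt_mul_left (E := E) g⁻¹ (g * x))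
    (mdifferentiableAt_mul_left (E := E) g x)
  have h2 : (fun x : G => g⁻¹ * x) ∘ (fun x : G => g * x) = id := by ext x; simp
  rw [h2, mfderiv_id] at h1
  have h3 : ∀ v : E, v = (mfderiv 𝓘(ℝ, E) 𝓘(ℝ, E) (fun x : G => g⁻¹ * x) (g * x) : E →L[ℝ] E)
      ((mfderiv 𝓘(ℝ, E) 𝓘(ℝ, E) (fun x : G => g * x) x : E →L[ℝ] E) v) :=
    fun v => congrArg (fun L : E →L[ℝ] E => L v) h1
  intro v w h
  rw [h3 v, h3 w, h]

/-- The chart at `1` has identity derivative there, so inserting it does not change the derivative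
of the left translation; the rest is the chain rule. -/
theorem maurerCartan_apply {x₀ : G} {u : E} (hu : u ∈ (extChartAt 𝓘(ℝ, E) x₀).target) (v : E) :
    (mfderiv 𝓘(ℝ, E) 𝓘(ℝ, E)
      (fun x : G => ((extChartAt 𝓘(ℝ, E) x₀).symm u)⁻¹ * x) ((extChartAt 𝓘(ℝ, E) x₀).symm u) :
        E →L[ℝ] E)
      ((mfderiv 𝓘(ℝ, E) 𝓘(ℝ, E) (extChartAt 𝓘(ℝ, E) x₀).symm u : E →L[ℝ] E) v) =
      maurerCartan x₀ u v := by
  have : IsManifold 𝓘(ℝ, E) ∞ G := ContMDiffMul.toIsManifold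
  have : IsManifold 𝓘(ℝ, E) 1 G := IsManifold.of_le (n := ∞) (by simp)
  have key : ∀ g : G, g = 1 → MDifferentiableAt 𝓘(ℝ, E) 𝓘(ℝ, E) (extChartAt 𝓘(ℝ, E) (1 : G)) g ∧
      ∀ w : E, (mfderiv 𝓘(ℝ, E) 𝓘(ℝ, E) (extChartAt 𝓘(ℝ, E) (1 : G)) g : E →L[ℝ] E) w = w := by
    rintro g rfl
    refine ⟨mdifferentiableAt_extChartAt (mem_chart_source E 1), fun w => ?_⟩
    have := mfderiv_extChartAt_self (I := 𝓘(ℝ, E)) (x := (1 : G))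
    rw [this]
    rfl
  obtain ⟨h1, h2⟩ := key (((extChartAt 𝓘(ℝ, E) x₀).symm u)⁻¹ * (extChartAt 𝓘(ℝ, E) x₀).symm u)
    (inv_mul_cancel _)
  have h3 := mdifferentiableAt_mul_left (E := E) ((extChartAt 𝓘(ℝ, E) x₀).symm u)⁻¹
    ((extChartAt 𝓘(ℝ, E) x₀).symm u)
  have h4 := mdifferentiableAt_extChartAt_symm hu
  rw [maurerCartan, ← mfderiv_eq_fderiv]
  have h5 := mfderiv_comp u (h1.comp _ h3) h4
  have h6 := mfderiv_comp _ h1 h3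
  have h7 := congrArg (fun L : E →L[ℝ] E => L v) h5
  have h8 := congrArg (fun L : E →L[ℝ] E => L ((mfderiv 𝓘(ℝ, E) 𝓘(ℝ, E)
    (extChartAt 𝓘(ℝ, E) x₀).symm u : E →L[ℝ] E) v)) h6
  refine Eq.trans ?_ h7.symm
  refine Eq.trans ?_ h8.symm
  exact (h2 _).symm

/-- It is a partial derivative, restricted to the diagonal, of a smooth map of two variables. -/
theorem contDiffOn_maurerCartan (x₀ : G) :
    ContDiffOn ℝ ∞ (maurerCartan (E := E) x₀) (extChartAt 𝓘(ℝ, E) x₀).target := by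
  have : IsManifold 𝓘(ℝ, E) ∞ G := ContMDiffMul.toIsManifold
  intro u hu
  refine ContDiffAt.contDiffWithinAt ?_
  refine ContDiffAt.fderiv (n := ∞) (f := fun u u' => extChartAt 𝓘(ℝ, E) (1 : G)
    (((extChartAt 𝓘(ℝ, E) x₀).symm u)⁻¹ * (extChartAt 𝓘(ℝ, E) x₀).symm u')) (g := fun u => u) ?_
    contDiffAt_id (by simp)
  rw [← contMDiffAt_iff_contDiffAt]
  have hs : ContMDiffAt 𝓘(ℝ, E) 𝓘(ℝ, E) ∞ (extChartAt 𝓘(ℝ, E) x₀).symm u :=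
    (contMDiffOn_extChartAt_symm (n := ∞) x₀).contMDiffAt
      ((isOpen_extChartAt_target x₀).mem_nhds hu)
  have hf : ContMDiffAt 𝓘(ℝ, E × E) 𝓘(ℝ, E) ∞
      (fun z : E × E => (extChartAt 𝓘(ℝ, E) x₀).symm z.1) (u, u) :=
    ContMDiffAt.comp (u, u) (g := (extChartAt 𝓘(ℝ, E) x₀).symm) (f := fun z : E × E => z.1)
      (by exact hs) contDiff_fst.contDiffAt.contMDiffAt
  have hg : ContMDiffAt 𝓘(ℝ, E × E) 𝓘(ℝ, E) ∞
      (fun z : E × E => (extChartAt 𝓘(ℝ, E) x₀).symm z.2) (u, u) :=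
    ContMDiffAt.comp (u, u) (g := (extChartAt 𝓘(ℝ, E) x₀).symm) (f := fun z : E × E => z.2)
      (by exact hs) contDiff_snd.contDiffAt.contMDiffAt
  have hmul := hf.inv.mul hg
  refine ContMDiffAt.comp (u, u) (g := extChartAt 𝓘(ℝ, E) (1 : G)) ?_ hmul
  have : ContMDiffAt 𝓘(ℝ, E) 𝓘(ℝ, E) ∞ (extChartAt 𝓘(ℝ, E) (1 : G)) 1 := contMDiffAt_extChartAt
  convert this
  simp

variable [CompleteSpace E]

/-- The Maurer-Cartan equation. -/
theorem fderiv_maurerCartan_sub (x₀ : G) (v w : E) (X Y : GroupLieAlgebra 𝓘(ℝ, E) G)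
    (hX : maurerCartan x₀ (extChartAt 𝓘(ℝ, E) x₀ x₀) v = X)
    (hY : maurerCartan x₀ (extChartAt 𝓘(ℝ, E) x₀ x₀) w = Y) :
    fderiv ℝ (maurerCartan (E := E) x₀) (extChartAt 𝓘(ℝ, E) x₀ x₀) v w -
      fderiv ℝ (maurerCartan (E := E) x₀) (extChartAt 𝓘(ℝ, E) x₀ x₀) w v =
    -(⁅X, Y⁆ : GroupLieAlgebra 𝓘(ℝ, E) G) := by
  have : IsManifold 𝓘(ℝ, E) ∞ G := ContMDiffMul.toIsManifold
  have : IsManifold 𝓘(ℝ, E) 1 G := IsManifold.of_le (n := ∞) (by simp)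
  set u₀ := extChartAt 𝓘(ℝ, E) x₀ x₀ with hu₀
  have hmem : u₀ ∈ (extChartAt 𝓘(ℝ, E) x₀).target := mem_extChartAt_target x₀
  have hx₀ : (extChartAt 𝓘(ℝ, E) x₀).symm u₀ = x₀ := extChartAt_to_inv x₀
  -- The left-invariant field of `a` read in the chart; the form takes the constant value `a` on it.
  let V : GroupLieAlgebra 𝓘(ℝ, E) G → E → E := fun a => VectorField.mpullbackWithin 𝓘(ℝ, E) 𝓘(ℝ, E)
    (extChartAt 𝓘(ℝ, E) x₀).symm
    (fun g : G => mulInvariantVectorField (I := 𝓘(ℝ, E)) (G := G) a g) (Set.range 𝓘(ℝ, E))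
  have hL : ∀ (a : GroupLieAlgebra 𝓘(ℝ, E) G) (g : G), (mfderiv 𝓘(ℝ, E) 𝓘(ℝ, E)
      (fun x : G => g⁻¹ * x) g : E →L[ℝ] E) (mulInvariantVectorField a g) = a := by
    intro a g
    have h1 := mfderiv_comp (I' := 𝓘(ℝ, E)) (1 : G) (mdifferentiableAt_mul_left (E := E) g⁻¹ (g * 1))
      (mdifferentiableAt_mul_left (E := E) g (1 : G))
    have h2 : (fun x : G => g⁻¹ * x) ∘ (fun x : G => g * x) = id := by ext x; simp
    rw [h2, mfderiv_id, mul_one] at h1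
    exact (congrArg (fun L : E →L[ℝ] E => L a) h1).symm
  have hV : ∀ a, ∀ u ∈ (extChartAt 𝓘(ℝ, E) x₀).target, maurerCartan x₀ u (V a u) = a := by
    intro a u hu
    rw [← maurerCartan_apply hu]
    have h1 := isInvertible_mfderivWithin_extChartAt_symm (I := 𝓘(ℝ, E)) hu
    have h2 := h1.self_apply_inverse (mulInvariantVectorField a _)
    have h3 : (mfderiv 𝓘(ℝ, E) 𝓘(ℝ, E) (extChartAt 𝓘(ℝ, E) x₀).symm u : E →L[ℝ] E) (V a u) =
      mulInvariantVectorField a ((extChartAt 𝓘(ℝ, E) x₀).symm u) := by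
      rw [← mfderivWithin_univ]
      simp only [V, VectorField.mpullbackWithin]
      rw [ModelWithCorners.range_eq_univ] at h2 ⊢
      exact h2
    rw [h3]
    exact hL a _
  have hVd : ∀ a, DifferentiableAt ℝ (V a) u₀ := by
    intro a
    have := (mdifferentiableAt_mulInvariantVectorField (I := 𝓘(ℝ, E)) (G := G) a (g := x₀)
      ).mdifferentiableWithinAt (s := Set.univ)
    have := this.differentiableWithinAt_mpullbackWithin_vectorField
    rw [ModelWithCorners.range_eq_univ, Set.preimage_univ, Set.univ_inter] at this
    simp only [V]
    rw [ModelWithCorners.range_eq_univ]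
    exact differentiableWithinAt_univ.1 this
  have hc : DifferentiableAt ℝ (maurerCartan (E := E) x₀) u₀ :=
    ((contDiffOn_maurerCartan x₀).contDiffAt ((isOpen_extChartAt_target x₀).mem_nhds hmem)
      ).differentiableAt (by simp)
  -- Differentiating this constancy trades derivatives of the form for derivatives of the field.
  have hder : ∀ a z, fderiv ℝ (maurerCartan (E := E) x₀) u₀ z (V a u₀) +
      maurerCartan x₀ u₀ (fderiv ℝ (V a) u₀ z) = 0 := by
    intro a z
    have h1 : HasFDerivAt (fun u => maurerCartan x₀ u (V a u)) _ u₀ :=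
      hc.hasFDerivAt.clm_apply (hVd a).hasFDerivAt
    have h2 : (fun u => maurerCartan x₀ u (V a u)) =ᶠ[𝓝 u₀] fun _ => a := by
      filter_upwards [(isOpen_extChartAt_target (I := 𝓘(ℝ, E)) x₀).mem_nhds hmem] with u hu
      exact hV a u hu
    have h3 := h1.unique ((hasFDerivAt_const (a : E) u₀).congr_of_eventuallyEq h2)
    have h4 := congrArg (fun L : E →L[ℝ] E => L z) h3
    simp at h4
    rw [add_comm]
    exact h4
  have hφ : ∀ z : E, (mfderiv 𝓘(ℝ, E) 𝓘(ℝ, E) (extChartAt 𝓘(ℝ, E) x₀).symm u₀ : E →L[ℝ] E) z = z := by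
    intro z
    have := mfderivWithin_range_extChartAt_symm (I := 𝓘(ℝ, E)) (x := x₀)
    rw [ModelWithCorners.range_eq_univ, mfderivWithin_univ] at this
    exact congrArg (fun L : E →L[ℝ] E => L z) this
  -- The bracket of left-invariant fields is left-invariant, and at the centre of the chart it is
  -- the bracket of their chart expressions.
  have hbr : maurerCartan x₀ u₀ (VectorField.lieBracket ℝ (V X) (V Y) u₀) = ⁅X, Y⁆ := by
    have h1 := congrFun (mulInvariantVector_mlieBracket (I := 𝓘(ℝ, E)) (G := G) X Y) x₀
    rw [← GroupLieAlgebra.bracket_def] at h1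
    have h2 : (VectorField.lieBracket ℝ (V X) (V Y) u₀ : E) =
        mulInvariantVectorField (I := 𝓘(ℝ, E)) (G := G) ⁅X, Y⁆ x₀ := by
      refine Eq.trans ?_ h1.symm
      have hE : ∀ (L : E →L[ℝ] E), L = ContinuousLinearMap.id ℝ E → ∀ z, L.inverse z = z := by
        rintro L rfl z
        rw [ContinuousLinearMap.inverse_id]
        rfl
      rw [← VectorField.mlieBracketWithin_univ, VectorField.mlieBracketWithin_apply]
      refine Eq.trans ?_ (hE _ (mfderiv_extChartAt_self (I := 𝓘(ℝ, E)) (x := x₀)) _).symm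
      simp only [V]
      rw [ModelWithCorners.range_eq_univ, Set.preimage_univ, Set.univ_inter]
      exact congrFun (VectorField.lieBracketWithin_univ (𝕜 := ℝ) (E := E)).symm _
    rw [← maurerCartan_apply hmem, hφ]
    have key : ∀ g : G, g = x₀ → ∀ z : E, z = mulInvariantVectorField (I := 𝓘(ℝ, E)) (G := G) ⁅X, Y⁆ x₀ →
        (mfderiv 𝓘(ℝ, E) 𝓘(ℝ, E) (fun x : G => g⁻¹ * x) g : E →L[ℝ] E) z = ⁅X, Y⁆ := by
      rintro g rfl z rfl
      exact hL _ _
    exact key _ hx₀ _ h2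
  have hinj : ∀ z z' : E, maurerCartan x₀ u₀ z = maurerCartan x₀ u₀ z' → z = z' := by
    intro z z' h
    rw [← maurerCartan_apply hmem, ← maurerCartan_apply hmem, hφ, hφ] at h
    exact mfderiv_mul_left_injective _ _ h
  -- By injectivity of the form, the given vectors are values of left-invariant fields.
  have hv : v = V X u₀ := hinj _ _ (hX.trans (hV X u₀ hmem).symm)
  have hw : w = V Y u₀ := hinj _ _ (hY.trans (hV Y u₀ hmem).symm)
  rw [← hbr, VectorField.lieBracket_eq, map_sub, ← hv, ← hw]
  have e1 := hder X w
  have e2 := hder Y v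
  rw [← hv] at e1
  rw [← hw] at e2
  rw [eq_neg_of_add_eq_zero_left e1, eq_neg_of_add_eq_zero_left e2]
  abel

end MaurerCartan
end LieTableau

namespace EDS

theorem DForm.d_apply_of_one {E : Type*} [NormedAddCommGroup E] [NormedSpace ℝ E]
    {H : Type*} [TopologicalSpace H] {I : ModelWithCorners ℝ E H}
    {M : Type*} [TopologicalSpace M] [ChartedSpace H M] [IsManifold I 1 M] [I.Boundaryless]
    {φ : DForm I M 1} (hφ : φ.IsSmooth)
    (x : M) (v : Fin 2 → E) : φ.d x v =
      fderiv ℝ (fun u => φ.inChart x u (fun _ => v 1)) (extChartAt I x x) (v 0) -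
      fderiv ℝ (fun u => φ.inChart x u (fun _ => v 0)) (extChartAt I x x) (v 1) := by
  have h : (mfderiv I 𝓘(ℝ, E) (extChartAt I x) x : E →L[ℝ] E) = ContinuousLinearMap.id ℝ E :=
    mfderiv_extChartAt_self
  have h2 : (fun i => (mfderiv I 𝓘(ℝ, E) (extChartAt I x) x : E →L[ℝ] E) (v i)) = v :=
    funext fun i => congrArg (fun L : E →L[ℝ] E => L (v i)) h
  have h1 : φ.d x v = extDeriv (φ.inChart x) (extChartAt I x x) v :=
    congrArg (fun w : Fin 2 → E => extDeriv (φ.inChart x) (extChartAt I x x) w) h2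
  have hd : DifferentiableAt ℝ (φ.inChart x) (extChartAt I x x) :=
    ((hφ x).contDiffAt ((isOpen_extChartAt_target x).mem_nhds (mem_extChartAt_target x))
      ).differentiableAt (by simp)
  rw [h1, extDeriv_apply hd, Fin.sum_univ_two]
  have r0 : (0 : Fin 2).removeNth v = fun _ => v 1 := by
    funext a; fin_cases a; rfl
  have r1 : (1 : Fin 2).removeNth v = fun _ => v 0 := by
    funext a; fin_cases a; rfl
  rw [r0, r1]
  simp [sub_eq_add_neg]

end EDS

namespace LieTableau

open EDS

/-! ### The trivialized tangent bundle and the structure equations -/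

section Forms

variable {E : Type*} [NormedAddCommGroup E] [NormedSpace ℝ E]
  {G : Type*} [TopologicalSpace G] [ChartedSpace E G] [Group G] [LieGroup 𝓘(ℝ, E) ∞ G]
  [CompleteSpace E]
  {𝔤 : Type*} [LieRing 𝔤] [LieAlgebra ℝ 𝔤] (e : GroupLieAlgebra 𝓘(ℝ, E) G ≃ₗ⁅ℝ⁆ 𝔤) {m : ℕ}

/-- The component in the Lie algebra of a tangent vector to `G × ℝ^m`. -/
noncomputable def groupPart (y : G × (Fin m → ℝ)) : TangentSpace (modelY E m) y →ₗ[ℝ] 𝔤 :=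
  let L : TangentSpace 𝓘(ℝ, E) y.1 →L[ℝ] E :=
    mfderiv 𝓘(ℝ, E) 𝓘(ℝ, E) (fun x : G => y.1⁻¹ * x) y.1
  let pr : TangentSpace (modelY E m) y →L[ℝ] TangentSpace 𝓘(ℝ, E) y.1 :=
    mfderiv (modelY E m) 𝓘(ℝ, E) (Prod.fst : G × (Fin m → ℝ) → G) y
  (e : GroupLieAlgebra 𝓘(ℝ, E) G →ₗ[ℝ] 𝔤) ∘ₗ
    ((L.comp pr : TangentSpace (modelY E m) y →L[ℝ] E) : TangentSpace (modelY E m) y →ₗ[ℝ] E)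

/-- The component in `ℝ^m` of a tangent vector to `G × ℝ^m`. -/
noncomputable def fibrePart (y : G × (Fin m → ℝ)) :
    TangentSpace (modelY E m) y →ₗ[ℝ] (Fin m → ℝ) :=
  LinearMap.snd ℝ E (Fin m → ℝ)

theorem groupPart_apply (y : G × (Fin m → ℝ)) (v : E × (Fin m → ℝ)) :
    groupPart e y v = e ((mfderiv 𝓘(ℝ, E) 𝓘(ℝ, E) (fun x : G => y.1⁻¹ * x) y.1 : E →L[ℝ] E) v.1) := by
  have h : (mfderiv (modelY E m) 𝓘(ℝ, E) (Prod.fst : G × (Fin m → ℝ) → G) y :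
      E × (Fin m → ℝ) →L[ℝ] E) = ContinuousLinearMap.fst ℝ E (Fin m → ℝ) := mfderiv_fst
  change e ((mfderiv 𝓘(ℝ, E) 𝓘(ℝ, E) (fun x : G => y.1⁻¹ * x) y.1 : E →L[ℝ] E)
    ((mfderiv (modelY E m) 𝓘(ℝ, E) (Prod.fst : G × (Fin m → ℝ) → G) y :
      E × (Fin m → ℝ) →L[ℝ] E) v)) = _
  rw [h]
  rfl

theorem maurerCartan_center (g : G) (v : E) : maurerCartan g (extChartAt 𝓘(ℝ, E) g g) v =
    (mfderiv 𝓘(ℝ, E) 𝓘(ℝ, E) (fun x : G => g⁻¹ * x) g : E →L[ℝ] E) v := by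
  have : IsManifold 𝓘(ℝ, E) ∞ G := ContMDiffMul.toIsManifold
  have : IsManifold 𝓘(ℝ, E) 1 G := IsManifold.of_le (n := ∞) (by simp)
  have hφ : ∀ z : E, (mfderiv 𝓘(ℝ, E) 𝓘(ℝ, E) (extChartAt 𝓘(ℝ, E) g).symm
      (extChartAt 𝓘(ℝ, E) g g) : E →L[ℝ] E) z = z := by
    intro z
    have := mfderivWithin_range_extChartAt_symm (I := 𝓘(ℝ, E)) (x := g)
    rw [ModelWithCorners.range_eq_univ, mfderivWithin_univ] at this
    exact congrArg (fun L : E →L[ℝ] E => L z) this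
  rw [← maurerCartan_apply (mem_extChartAt_target g), hφ]
  have key : ∀ g' : G, g' = g →
      (mfderiv 𝓘(ℝ, E) 𝓘(ℝ, E) (fun x : G => g'⁻¹ * x) g' : E →L[ℝ] E) v =
      (mfderiv 𝓘(ℝ, E) 𝓘(ℝ, E) (fun x : G => g⁻¹ * x) g : E →L[ℝ] E) v := by
    rintro _ rfl; rfl
  exact key _ (extChartAt_to_inv g)

theorem groupPart_eq_maurerCartan (y : G × (Fin m → ℝ)) (v : E × (Fin m → ℝ)) :
    groupPart e y v = e (maurerCartan y.1 (extChartAt 𝓘(ℝ, E) y.1 y.1) v.1) := by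
  rw [groupPart_apply, maurerCartan_center]

theorem extChartAt_modelY_symm (y : G × (Fin m → ℝ)) (u : E × (Fin m → ℝ)) :
    (extChartAt (modelY E m) y).symm u = ((extChartAt 𝓘(ℝ, E) y.1).symm u.1, u.2) := by
  rw [extChartAt_prod]
  rfl

theorem fst_mem_target {y : G × (Fin m → ℝ)} {u : E × (Fin m → ℝ)}
    (hu : u ∈ (extChartAt (modelY E m) y).target) : u.1 ∈ (extChartAt 𝓘(ℝ, E) y.1).target := by
  rw [extChartAt_prod] at hu
  exact hu.1

theorem mfderiv_extChartAt_modelY_symm {y : G × (Fin m → ℝ)} {u : E × (Fin m → ℝ)}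
    (hu : u ∈ (extChartAt (modelY E m) y).target) (v : E × (Fin m → ℝ)) :
    (mfderiv 𝓘(ℝ, E × (Fin m → ℝ)) (modelY E m) (extChartAt (modelY E m) y).symm u :
      E × (Fin m → ℝ) →L[ℝ] E × (Fin m → ℝ)) v =
    ((mfderiv 𝓘(ℝ, E) 𝓘(ℝ, E) (extChartAt 𝓘(ℝ, E) y.1).symm u.1 : E →L[ℝ] E) v.1, v.2) := by
  have hf : (extChartAt (modelY E m) y).symm =
      fun u : E × (Fin m → ℝ) => ((extChartAt 𝓘(ℝ, E) y.1).symm u.1, u.2) := by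
    funext u; exact extChartAt_modelY_symm y u
  have h1 := mdifferentiableAt_extChartAt_symm (fst_mem_target hu)
  have hfst : HasMFDerivAt 𝓘(ℝ, E × (Fin m → ℝ)) 𝓘(ℝ, E) (Prod.fst : E × (Fin m → ℝ) → E) u
      (ContinuousLinearMap.fst ℝ E (Fin m → ℝ)) := hasFDerivAt_fst.hasMFDerivAt
  have hsnd : HasMFDerivAt 𝓘(ℝ, E × (Fin m → ℝ)) 𝓘(ℝ, Fin m → ℝ)
      (Prod.snd : E × (Fin m → ℝ) → _) u
      (ContinuousLinearMap.snd ℝ E (Fin m → ℝ)) := hasFDerivAt_snd.hasMFDerivAt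
  have h2 := (HasMFDerivAt.comp u h1.hasMFDerivAt hfst).prodMk hsnd
  have h3 := h2.mfderiv
  rw [hf]
  exact congrArg (fun L : E × (Fin m → ℝ) →L[ℝ] E × (Fin m → ℝ) => L v) h3

theorem fibrePart_chart {y : G × (Fin m → ℝ)} {u : E × (Fin m → ℝ)}
    (hu : u ∈ (extChartAt (modelY E m) y).target) (v : E × (Fin m → ℝ)) :
    fibrePart ((extChartAt (modelY E m) y).symm u)
      ((mfderiv 𝓘(ℝ, E × (Fin m → ℝ)) (modelY E m) (extChartAt (modelY E m) y).symm u :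
      E × (Fin m → ℝ) →L[ℝ] E × (Fin m → ℝ)) v) = v.2 := by
  rw [mfderiv_extChartAt_modelY_symm hu]
  rfl

theorem groupPart_chart {y : G × (Fin m → ℝ)} {u : E × (Fin m → ℝ)}
    (hu : u ∈ (extChartAt (modelY E m) y).target) (v : E × (Fin m → ℝ)) :
    groupPart e ((extChartAt (modelY E m) y).symm u)
      ((mfderiv 𝓘(ℝ, E × (Fin m → ℝ)) (modelY E m) (extChartAt (modelY E m) y).symm u :
      E × (Fin m → ℝ) →L[ℝ] E × (Fin m → ℝ)) v) = e (maurerCartan y.1 u.1 v.1) := by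
  rw [mfderiv_extChartAt_modelY_symm hu]
  rw [← maurerCartan_apply (fst_mem_target hu)]
  have key : ∀ z : G × (Fin m → ℝ), z = ((extChartAt 𝓘(ℝ, E) y.1).symm u.1, u.2) →
      ∀ w : E × (Fin m → ℝ), groupPart e z w = e ((mfderiv 𝓘(ℝ, E) 𝓘(ℝ, E)
      (fun x : G => ((extChartAt 𝓘(ℝ, E) y.1).symm u.1)⁻¹ * x) ((extChartAt 𝓘(ℝ, E) y.1).symm u.1) :
        E →L[ℝ] E) w.1) := by
    rintro _ rfl w
    exact groupPart_apply e _ _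
  exact key _ (extChartAt_modelY_symm y u) _

end Forms
end LieTableau

namespace EDS

theorem contDiffOn_bilinear {V : Type*} [NormedAddCommGroup V] [NormedSpace ℝ V]
    {W₁ W₂ W : Type*} [NormedAddCommGroup W₁] [NormedSpace ℝ W₁] [FiniteDimensional ℝ W₁]
    [NormedAddCommGroup W₂] [NormedSpace ℝ W₂] [FiniteDimensional ℝ W₂]
    [NormedAddCommGroup W] [NormedSpace ℝ W]
    (B : W₁ →ₗ[ℝ] W₂ →ₗ[ℝ] W) {f : V → W₁} {g : V → W₂} {s : Set V}
    (hf : ContDiffOn ℝ ∞ f s) (hg : ContDiffOn ℝ ∞ g s) :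
    ContDiffOn ℝ ∞ (fun u => B (f u) (g u)) s := by
  let B' : W₁ →L[ℝ] W₂ →L[ℝ] W := LinearMap.toContinuousLinearMap
    ((LinearMap.toContinuousLinearMap : (W₂ →ₗ[ℝ] W) ≃ₗ[ℝ] W₂ →L[ℝ] W).toLinearMap ∘ₗ B)
  exact (B'.contDiff.comp_contDiffOn hf).clm_apply hg

theorem contDiffOn_linear {V : Type*} [NormedAddCommGroup V] [NormedSpace ℝ V]
    {W₁ W : Type*} [NormedAddCommGroup W₁] [NormedSpace ℝ W₁] [FiniteDimensional ℝ W₁]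
    [NormedAddCommGroup W] [NormedSpace ℝ W]
    (B : W₁ →ₗ[ℝ] W) {f : V → W₁} {s : Set V} (hf : ContDiffOn ℝ ∞ f s) :
    ContDiffOn ℝ ∞ (fun u => B (f u)) s :=
  (LinearMap.toContinuousLinearMap B).contDiff.comp_contDiffOn hf

end EDS

namespace LieTableau

open EDS

section Forms

variable {E : Type*} [NormedAddCommGroup E] [NormedSpace ℝ E] [FiniteDimensional ℝ E]
  {G : Type*} [TopologicalSpace G] [ChartedSpace E G] [Group G] [LieGroup 𝓘(ℝ, E) ∞ G]
  [CompleteSpace E]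
  {𝔤 : Type*} [LieRing 𝔤] [LieAlgebra ℝ 𝔤] (e : GroupLieAlgebra 𝓘(ℝ, E) G ≃ₗ⁅ℝ⁆ 𝔤) {m : ℕ}

/-- The linear isomorphism underlying the identification of `𝔤` with the tangent space at `1`. -/
noncomputable def modelEquiv : E ≃ₗ[ℝ] 𝔤 := e.toLinearEquiv

/-- The trivialization of the tangent bundle of `G × ℝ^m`. -/
noncomputable def trivialization (y : G × (Fin m → ℝ)) :
    TangentSpace (modelY E m) y ≃ₗ[ℝ] 𝔤 × (Fin m → ℝ) :=
  haveI : FiniteDimensional ℝ 𝔤 := (modelEquiv e).finiteDimensional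
  haveI : FiniteDimensional ℝ (TangentSpace (modelY E m) y) :=
    inferInstanceAs (FiniteDimensional ℝ (E × (Fin m → ℝ)))
  LinearEquiv.ofInjectiveOfFinrankEq ((groupPart e y).prod (fibrePart y)) (by
      rw [← LinearMap.ker_eq_bot, LinearMap.ker_eq_bot']
      intro (v : E × (Fin m → ℝ)) hv
      have h1 : groupPart e y v = 0 := congrArg Prod.fst hv
      have h2 : v.2 = 0 := congrArg Prod.snd hv
      rw [groupPart_apply] at h1
      have h3 := mfderiv_mul_left_injective (E := E) y.1⁻¹ y.1
        (((e.toLinearEquiv.map_eq_zero_iff).1 h1).trans (map_zero _).symm)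
      exact Prod.ext h3 h2) (by
      change Module.finrank ℝ (E × (Fin m → ℝ)) = _
      rw [Module.finrank_prod, Module.finrank_prod, (modelEquiv e).finrank_eq])

theorem trivialization_apply (y : G × (Fin m → ℝ)) (v : TangentSpace (modelY E m) y) :
    trivialization e y v = (groupPart e y v, fibrePart y v) := rfl

variable (ξ : 𝔤 →ₗ[ℝ] ℝ) (ζ : (Fin m → ℝ) →ₗ[ℝ] 𝔤 →ₗ[ℝ] ℝ)

/-- The 1-form on `G × ℝ^m` whose value at `(g, p)` is the left-invariant form `ξ + ζ p`. -/
noncomputable def affineForm : DForm (modelY E m) (G × (Fin m → ℝ)) 1 :=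
  fun y => leftInvariantForm e m (ξ + ζ y.2) y

theorem leftInvariantForm_apply (y : G × (Fin m → ℝ)) (v : Fin 1 → TangentSpace (modelY E m) y) :
    leftInvariantForm e m ξ y v = ξ (groupPart e y (v 0)) := rfl

theorem affineForm_apply (y : G × (Fin m → ℝ)) (v : Fin 1 → TangentSpace (modelY E m) y) :
    affineForm e ξ ζ y v = ξ (groupPart e y (v 0)) + ζ y.2 (groupPart e y (v 0)) := rfl

theorem affineForm_zero : affineForm e ξ (0 : (Fin m → ℝ) →ₗ[ℝ] 𝔤 →ₗ[ℝ] ℝ) =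
    leftInvariantForm e m ξ := by
  funext y
  simp [affineForm]

theorem inChart_affineForm {y : G × (Fin m → ℝ)} {u : E × (Fin m → ℝ)}
    (hu : u ∈ (extChartAt (modelY E m) y).target) (v : Fin 1 → E × (Fin m → ℝ)) :
    (affineForm e ξ ζ).inChart y u v = ξ (modelEquiv e (maurerCartan y.1 u.1 (v 0).1)) +
      ζ u.2 (modelEquiv e (maurerCartan y.1 u.1 (v 0).1)) := by
  rw [DForm.inChart_apply, affineForm_apply, groupPart_chart e hu, extChartAt_modelY_symm]
  rfl

theorem contDiffOn_maurerCartan_apply (y : G × (Fin m → ℝ)) (v : E) :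
    ContDiffOn ℝ ∞ (fun u : E × (Fin m → ℝ) => maurerCartan y.1 u.1 v)
      (extChartAt (modelY E m) y).target :=
  ((contDiffOn_maurerCartan y.1).comp contDiffOn_fst fun _ hu => fst_mem_target hu).clm_apply
    contDiffOn_const

theorem contDiffOn_affine_apply {V : Type*} [NormedAddCommGroup V] [NormedSpace ℝ V]
    {f : V → Fin m → ℝ} {g : V → E} {s : Set V}
    (hf : ContDiffOn ℝ ∞ f s) (hg : ContDiffOn ℝ ∞ g s) :
    ContDiffOn ℝ ∞ (fun u => ξ (modelEquiv e (g u)) + ζ (f u) (modelEquiv e (g u))) s :=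
  (contDiffOn_linear (ξ ∘ₗ (modelEquiv e).toLinearMap) hg).add
    (contDiffOn_bilinear (ζ.compl₂ (modelEquiv e).toLinearMap) hf hg)

theorem isSmooth_affineForm : (affineForm e ξ ζ).IsSmooth := by
  refine DForm.isSmooth_of_forall_apply fun y v => ?_
  refine ContDiffOn.congr ?_ fun u hu => inChart_affineForm e ξ ζ hu v
  exact contDiffOn_affine_apply e ξ ζ contDiffOn_snd (contDiffOn_maurerCartan_apply y _)

theorem modelEquiv_neg_bracket (X Y : GroupLieAlgebra 𝓘(ℝ, E) G) :
    modelEquiv e (-⁅X, Y⁆ : GroupLieAlgebra 𝓘(ℝ, E) G) = -⁅modelEquiv e X, modelEquiv e Y⁆ :=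
  (map_neg e.toLinearEquiv _).trans (congrArg Neg.neg (e.map_lie X Y))

/-- The structure equations. -/
theorem d_affineForm (y : G × (Fin m → ℝ)) (v : Fin 2 → TangentSpace (modelY E m) y) :
    (affineForm e ξ ζ).d y v =
      -(ξ + ζ y.2) ⁅groupPart e y (v 0), groupPart e y (v 1)⁆ +
      (ζ (fibrePart y (v 0)) (groupPart e y (v 1)) -
        ζ (fibrePart y (v 1)) (groupPart e y (v 0))) := by
  have : IsManifold 𝓘(ℝ, E) ∞ G := ContMDiffMul.toIsManifold
  have : IsManifold 𝓘(ℝ, E) 1 G := IsManifold.of_le (n := ∞) (by simp)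
  set u₀ : E × (Fin m → ℝ) := extChartAt (modelY E m) y y with hu₀
  have hu₁ : u₀.1 = extChartAt 𝓘(ℝ, E) y.1 y.1 := by
    rw [hu₀, extChartAt_prod]; rfl
  have hu₂ : u₀.2 = y.2 := by
    rw [hu₀, extChartAt_prod]; rfl
  have hmem : u₀ ∈ (extChartAt (modelY E m) y).target := mem_extChartAt_target y
  have hnhds := (isOpen_extChartAt_target (I := modelY E m) y).mem_nhds hmem
  have hc : DifferentiableAt ℝ (maurerCartan (E := E) y.1) u₀.1 :=
    ((contDiffOn_maurerCartan y.1).contDiffAt ((isOpen_extChartAt_target y.1).mem_nhds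
      (fst_mem_target hmem))).differentiableAt (by simp)
  -- The product rule: the derivative falls on the Maurer–Cartan form, where antisymmetrization
  -- produces the bracket, or on the coefficient `ζ p`, where it produces the fibre components.
  have hder : ∀ w z : E × (Fin m → ℝ),
      fderiv ℝ (fun u => (affineForm e ξ ζ).inChart y u (fun _ => w)) u₀ z =
      (ξ + ζ y.2) (modelEquiv e (fderiv ℝ (maurerCartan y.1) u₀.1 z.1 w.1)) +
        ζ z.2 (modelEquiv e (maurerCartan y.1 u₀.1 w.1)) := by
    intro w z
    have h1 : (fun u => (affineForm e ξ ζ).inChart y u (fun _ => w)) =ᶠ[𝓝 u₀] fun u =>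
        ξ (modelEquiv e (maurerCartan y.1 u.1 w.1)) +
          ζ u.2 (modelEquiv e (maurerCartan y.1 u.1 w.1)) := by
      filter_upwards [hnhds] with u hu
      exact inChart_affineForm e ξ ζ hu _
    let ξ' : E →L[ℝ] ℝ := LinearMap.toContinuousLinearMap (ξ ∘ₗ (modelEquiv e).toLinearMap)
    let ζ' : (Fin m → ℝ) →L[ℝ] E →L[ℝ] ℝ := LinearMap.toContinuousLinearMap
      ((LinearMap.toContinuousLinearMap : (E →ₗ[ℝ] ℝ) ≃ₗ[ℝ] E →L[ℝ] ℝ).toLinearMap ∘ₗ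
        (ζ.compl₂ (modelEquiv e).toLinearMap))
    have h2 : HasFDerivAt (fun u : E × (Fin m → ℝ) => maurerCartan y.1 u.1 w.1)
        (((fderiv ℝ (maurerCartan y.1) u₀.1).flip w.1).comp (ContinuousLinearMap.fst ℝ E (Fin m → ℝ)))
        u₀ := by
      have h3 : HasFDerivAt (fun u : E × (Fin m → ℝ) => maurerCartan y.1 u.1) _ u₀ :=
        hc.hasFDerivAt.comp u₀ hasFDerivAt_fst
      exact (h3.clm_apply (hasFDerivAt_const w.1 u₀)).congr_fderiv (by ext z <;> simp)
    have h3 : HasFDerivAt (fun u : E × (Fin m → ℝ) => ξ' (maurerCartan y.1 u.1 w.1) +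
      ζ' u.2 (maurerCartan y.1 u.1 w.1)) _ u₀ := (ξ'.hasFDerivAt.comp u₀ h2).add
        ((ζ'.hasFDerivAt.comp u₀ hasFDerivAt_snd).clm_apply h2)
    rw [(h3.congr_of_eventuallyEq h1).fderiv]
    have e1 : ∀ x : E, ξ' x = ξ (modelEquiv e x) := fun _ => rfl
    have e2 : ∀ p (x : E), ζ' p x = ζ p (modelEquiv e x) := fun _ _ => rfl
    simp [e1, e2, hu₂]
    ring
  have hd := (DForm.d_apply_of_one (isSmooth_affineForm e ξ ζ) y v).trans
    (congrArg₂ (fun a b : ℝ => a - b) (hder (v 1) (v 0)) (hder (v 0) (v 1)))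
  have hg : ∀ a, groupPart e y (v a) = modelEquiv e (maurerCartan y.1 u₀.1
      ((v : Fin 2 → E × (Fin m → ℝ)) a).1) := by
    intro a
    rw [hu₁]
    exact groupPart_eq_maurerCartan e y (v a)
  have hmc := fderiv_maurerCartan_sub y.1 ((v : Fin 2 → E × (Fin m → ℝ)) 0).1
    ((v : Fin 2 → E × (Fin m → ℝ)) 1).1 _ _ rfl rfl
  have hmc' := (congrArg (modelEquiv e) hmc).trans (modelEquiv_neg_bracket e _ _)
  rw [map_sub, ← hu₁, ← hg 0, ← hg 1] at hmc'
  rw [← map_neg, ← hmc', map_sub]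
  refine hd.trans ?_
  rw [← hg 0, ← hg 1]
  change _ = _ + (ζ ((v : Fin 2 → E × (Fin m → ℝ)) 0).2 (groupPart e y (v 1)) -
        ζ ((v : Fin 2 → E × (Fin m → ℝ)) 1).2 (groupPart e y (v 0)))
  ring

end Forms
end LieTableau

namespace LieTableau

open EDS

/-! ### The generators and the linear Pfaffian property -/

namespace AdaptedBasis

variable {𝔤 : Type*} [LieRing 𝔤] [LieAlgebra ℝ 𝔤] {𝔞 𝔟 : Submodule ℝ 𝔤} {k h s m : ℕ}
  (𝓑 : AdaptedBasis 𝔞 𝔟 k h s)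

theorem apply_eq_zero_of_mem_A {W : Type*} [AddCommGroup W] [Module ℝ W] (f : 𝔤 →ₗ[ℝ] W)
    (hf : ∀ i, f (𝓑.basis (Sum.inl i)) = 0) {x : 𝔤} (hx : x ∈ 𝔞) : f x = 0 := by
  have : 𝔞 ≤ LinearMap.ker f := by
    rw [← 𝓑.span_A, Submodule.span_le]
    rintro _ ⟨i, rfl⟩
    exact hf i
  exact this hx

theorem apply_eq_zero_of_mem_B {W : Type*} [AddCommGroup W] [Module ℝ W] (f : 𝔤 →ₗ[ℝ] W)
    (hf : ∀ i, f (𝓑.basis (Sum.inr (Sum.inl i))) = 0) {x : 𝔤} (hx : x ∈ 𝔟) : f x = 0 := by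
  have : 𝔟 ≤ LinearMap.ker f := by
    rw [← 𝓑.span_B, Submodule.span_le]
    rintro _ ⟨i, rfl⟩
    exact hf i
  exact this hx

theorem coord_inr_coe (b : Fin h ⊕ Fin s) (a : 𝔞) : 𝓑.basis.coord (Sum.inr b) (a : 𝔤) = 0 :=
  𝓑.apply_eq_zero_of_mem_A _ (fun i => by simp) a.2

theorem coord_inl_coe (i : Fin k) (b : 𝔟) : 𝓑.basis.coord (Sum.inl i) (b : 𝔤) = 0 :=
  𝓑.apply_eq_zero_of_mem_B _ (fun i => by simp) b.2

theorem coord_inr_inr_coe (i : Fin s) (b : 𝔟) :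
    𝓑.basis.coord (Sum.inr (Sum.inr i)) (b : 𝔤) = 0 :=
  𝓑.apply_eq_zero_of_mem_B _ (fun i => by simp) b.2

/-- The projection onto `𝔞`. -/
noncomputable def projA : 𝔤 →ₗ[ℝ] 𝔞 :=
  ∑ i, (𝓑.basis.coord (Sum.inl i)).smulRight (𝓑.vecA i)

theorem projA_apply (x : 𝔤) : 𝓑.projA x = ∑ i, 𝓑.basis.coord (Sum.inl i) x • 𝓑.vecA i := by
  simp [projA]

theorem coe_vecA (i : Fin k) : (𝓑.vecA i : 𝔤) = 𝓑.basis (Sum.inl i) := rfl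

theorem projA_basis (i : Fin k) : 𝓑.projA (𝓑.basis (Sum.inl i)) = 𝓑.vecA i := by
  rw [projA_apply, Finset.sum_eq_single i]
  · simp
  · intro j _ hj
    simp [hj.symm]
  · simp

theorem projA_basis_inr (b : Fin h ⊕ Fin s) : 𝓑.projA (𝓑.basis (Sum.inr b)) = 0 := by
  rw [projA_apply]
  exact Finset.sum_eq_zero fun i _ => by simp

theorem projA_coe (a : 𝔞) : 𝓑.projA (a : 𝔤) = a := by
  have := 𝓑.apply_eq_zero_of_mem_A (𝔞.subtype ∘ₗ 𝓑.projA - LinearMap.id) (fun i => by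
    simp [projA_basis, coe_vecA]) a.2
  exact Subtype.ext (sub_eq_zero.1 this)

theorem projA_coe_B (b : 𝔟) : 𝓑.projA (b : 𝔤) = 0 :=
  𝓑.apply_eq_zero_of_mem_B _ (fun _ => 𝓑.projA_basis_inr _) b.2

theorem coord_inl_projA (i : Fin k) (x : 𝔤) :
    𝓑.basis.coord (Sum.inl i) (𝓑.projA x : 𝔤) = 𝓑.basis.coord (Sum.inl i) x := by
  rw [projA_apply, AddSubmonoidClass.coe_finsetSum, map_sum, Finset.sum_eq_single i]
  · simp [coe_vecA]
  · intro j _ hj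
    simp [coe_vecA, hj]
  · simp

variable {A : Submodule ℝ (𝔞 →ₗ[ℝ] 𝔟)} (Q : Module.Basis (Fin m) ℝ A)

/-- The element `p^ε Q_ε` of the tableau. -/
noncomputable def tableauPoint (Q : Module.Basis (Fin m) ℝ A) :
    (Fin m → ℝ) →ₗ[ℝ] (𝔞 →ₗ[ℝ] 𝔟) :=
  A.subtype ∘ₗ Q.equivFun.symm.toLinearMap

theorem tableauPoint_mem (p : Fin m → ℝ) : tableauPoint Q p ∈ A := (Q.equivFun.symm p).2

theorem tableauPoint_apply (p : Fin m → ℝ) (a : 𝔞) :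
    (tableauPoint Q p a : 𝔤) = ∑ ε, p ε • ((Q ε : 𝔞 →ₗ[ℝ] 𝔟) a : 𝔤) := by
  simp [tableauPoint, Module.Basis.equivFun_symm_apply]

/-- The endomorphism `x ↦ x - Q(x_𝔞)`, with `Q = p^ε Q_ε`. -/
noncomputable def residual (p : Fin m → ℝ) : 𝔤 →ₗ[ℝ] 𝔤 :=
  LinearMap.id - 𝔟.subtype ∘ₗ tableauPoint Q p ∘ₗ 𝓑.projA

theorem residual_apply (p : Fin m → ℝ) (x : 𝔤) :
    𝓑.residual Q p x = x - (tableauPoint Q p (𝓑.projA x) : 𝔤) := rfl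

/-- The vectors dual to the `η^j`, `γ^a` and `α^i`. -/
noncomputable def dualVector (p : Fin m → ℝ) : (Fin h ⊕ Fin s) ⊕ Fin k → 𝔤 :=
  Sum.elim (fun b => 𝓑.basis (Sum.inr b))
    fun i => 𝓑.basis (Sum.inl i) + (tableauPoint Q p (𝓑.vecA i) : 𝔤)

/-- The linear forms on `𝔤` defining the `η^j`, `γ^a` and `α^i`. -/
noncomputable def dualCoord (p : Fin m → ℝ) : (Fin h ⊕ Fin s) ⊕ Fin k → 𝔤 →ₗ[ℝ] ℝ :=
  Sum.elim (fun b => 𝓑.basis.coord (Sum.inr b) ∘ₗ 𝓑.residual Q p)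
    fun i => 𝓑.basis.coord (Sum.inl i)

/-- The `α`-terms add up to `x_𝔞 + Q(x_𝔞)`, and the remainder `x - x_𝔞 - Q(x_𝔞)` has only `B` and
`C` components. -/
theorem eq_sum_dualCoord (p : Fin m → ℝ) (x : 𝔤) :
    x = ∑ c, 𝓑.dualCoord Q p c x • 𝓑.dualVector Q p c := by
  have h1 := 𝓑.basis.sum_repr (𝓑.residual Q p x)
  rw [Fintype.sum_sum_type] at h1
  have h2 : ∑ i, 𝓑.basis.repr (𝓑.residual Q p x) (Sum.inl i) • 𝓑.basis (Sum.inl i) =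
      (𝓑.projA x : 𝔤) := by
    rw [projA_apply, AddSubmonoidClass.coe_finsetSum]
    refine Finset.sum_congr rfl fun i _ => ?_
    have := 𝓑.coord_inl_coe i (tableauPoint Q p (𝓑.projA x))
    rw [Module.Basis.coord_apply] at this
    simp [residual_apply, this, coe_vecA]
  have h3 : ∑ i, 𝓑.basis.coord (Sum.inl i) x •
      (𝓑.basis (Sum.inl i) + (tableauPoint Q p (𝓑.vecA i) : 𝔤)) =
      (𝓑.projA x : 𝔤) + (tableauPoint Q p (𝓑.projA x) : 𝔤) := by
    simp only [smul_add, Finset.sum_add_distrib]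
    rw [projA_apply]
    simp [coe_vecA]
  rw [h2, residual_apply] at h1
  rw [Fintype.sum_sum_type]
  simp only [dualCoord, dualVector, Sum.elim_inl, Sum.elim_inr]
  rw [h3]
  have h4 : ∑ b, (𝓑.basis.coord (Sum.inr b) ∘ₗ 𝓑.residual Q p) x • 𝓑.basis (Sum.inr b) =
    x - (tableauPoint Q p (𝓑.projA x) : 𝔤) - 𝓑.projA x := by
    rw [← h1, add_sub_cancel_left]
    rfl
  rw [h4]
  abel

theorem dualCoord_dualVector (p : Fin m → ℝ) (c d : (Fin h ⊕ Fin s) ⊕ Fin k) :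
    𝓑.dualCoord Q p c (𝓑.dualVector Q p d) = if c = d then 1 else 0 := by
  rcases c with b | i <;> rcases d with b' | j
  · simp [dualCoord, dualVector, residual_apply, projA_basis_inr, Finsupp.single_apply, eq_comm]
  · simp [dualCoord, dualVector, residual_apply, projA_basis, projA_coe_B]
  · simp [dualCoord, dualVector]
  · have := 𝓑.coord_inl_coe i (tableauPoint Q p (𝓑.vecA j))
    rw [Module.Basis.coord_apply] at this
    simp [dualCoord, dualVector, this, Finsupp.single_apply, eq_comm]

end AdaptedBasis

section System

variable {E : Type*} [NormedAddCommGroup E] [NormedSpace ℝ E] [FiniteDimensional ℝ E]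
  {G : Type*} [TopologicalSpace G] [ChartedSpace E G] [Group G] [LieGroup 𝓘(ℝ, E) ∞ G]
  [CompleteSpace E]
  {𝔤 : Type*} [LieRing 𝔤] [LieAlgebra ℝ 𝔤] (e : GroupLieAlgebra 𝓘(ℝ, E) G ≃ₗ⁅ℝ⁆ 𝔤) {m : ℕ}

section Affine

variable (ξ : 𝔤 →ₗ[ℝ] ℝ) (ζ : (Fin m → ℝ) →ₗ[ℝ] 𝔤 →ₗ[ℝ] ℝ)

/-- The Lie bracket of `𝔤`, on the model space. -/
noncomputable def modelBracket : E →ₗ[ℝ] E →ₗ[ℝ] E :=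
  (((LieModule.toEnd ℝ 𝔤 𝔤 : 𝔤 →ₗ[ℝ] (𝔤 →ₗ[ℝ] 𝔤))).compl₁₂ (modelEquiv e).toLinearMap
    (modelEquiv e).toLinearMap).compr₂ (modelEquiv e).symm.toLinearMap

theorem modelEquiv_modelBracket (x y : E) :
    modelEquiv e (modelBracket e x y) = ⁅modelEquiv e x, modelEquiv e y⁆ := by
  simp [modelBracket]

/-- `DForm.d` uses a different chart at each point, so smoothness is read off from the structure
equations, whose right-hand side is written in a single chart with the Maurer–Cartan form and the
bracket. -/
theorem isSmooth_d_affineForm : (affineForm e ξ ζ).d.IsSmooth := by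
  refine DForm.isSmooth_of_forall_apply fun y v => ?_
  have h : ∀ u ∈ (extChartAt (modelY E m) y).target, (affineForm e ξ ζ).d.inChart y u v =
      -(ξ (modelEquiv e (modelBracket e (maurerCartan y.1 u.1 (v 0).1) (maurerCartan y.1 u.1 (v 1).1))) +
        ζ u.2 (modelEquiv e (modelBracket e (maurerCartan y.1 u.1 (v 0).1)
          (maurerCartan y.1 u.1 (v 1).1)))) +
      ((ζ (v 0).2 ∘ₗ (modelEquiv e).toLinearMap) (maurerCartan y.1 u.1 (v 1).1) -
        (ζ (v 1).2 ∘ₗ (modelEquiv e).toLinearMap) (maurerCartan y.1 u.1 (v 0).1)) := by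
    intro u hu
    rw [DForm.inChart_apply, d_affineForm, groupPart_chart e hu, groupPart_chart e hu,
      fibrePart_chart hu, fibrePart_chart hu, extChartAt_modelY_symm, modelEquiv_modelBracket]
    rfl
  refine ContDiffOn.congr ?_ h
  have hmc := fun w => contDiffOn_maurerCartan_apply (m := m) y (w : E)
  refine (contDiffOn_affine_apply e ξ ζ contDiffOn_snd
    (contDiffOn_bilinear (modelBracket e) (hmc _) (hmc _))).neg.add ?_
  exact (contDiffOn_linear _ (hmc _)).sub (contDiffOn_linear _ (hmc _))

/-- The 1-form with given values. -/
noncomputable def oneFormOf (f : ∀ y : G × (Fin m → ℝ), TangentSpace (modelY E m) y →ₗ[ℝ] ℝ) :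
    DForm (modelY E m) (G × (Fin m → ℝ)) 1 := fun y =>
  let f' : E × (Fin m → ℝ) →ₗ[ℝ] ℝ := f y
  let L' : E × (Fin m → ℝ) →L[ℝ] ℝ := LinearMap.toContinuousLinearMap f'
  let L : TangentSpace (modelY E m) y →L[ℝ] ℝ := L'
  ContinuousAlternatingMap.ofSubsingleton ℝ _ ℝ 0 L

/-- Expanding the `𝔤`-components by `hX` puts some `η c` into every term of the structure equations.
-/
theorem d_affineForm_mem {κ : Type*} [Fintype κ] (η : κ → DForm (modelY E m) (G × (Fin m → ℝ)) 1)
    (E₀ : κ → 𝔤) (E₁ : κ → (Fin m → ℝ) →ₗ[ℝ] 𝔤)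
    (hX : ∀ y v, groupPart e y v = ∑ c, η c y (fun _ => v) • (E₀ c + E₁ c y.2)) :
    AlgIdeal (OneForms η) 2 (affineForm e ξ ζ).d := by
  -- The cofactors of the `η c`. The bracket is expanded once in each of its arguments, hence the
  -- factor one half.
  let ψ : κ → DForm (modelY E m) (G × (Fin m → ℝ)) 1 := fun c => oneFormOf fun y =>
    -((2 : ℝ)⁻¹ • ((ξ + ζ y.2) ∘ₗ (LieModule.toEnd ℝ 𝔤 𝔤 (E₀ c + E₁ c y.2) : 𝔤 →ₗ[ℝ] 𝔤) ∘ₗ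
      groupPart e y)) - (ζ.flip (E₀ c + E₁ c y.2)) ∘ₗ fibrePart y
  have hψ : ∀ c, (ψ c).IsSmooth := by
    intro c
    refine DForm.isSmooth_of_forall_apply fun y v => ?_
    set g : E × (Fin m → ℝ) → E := fun u => (modelEquiv e).symm (E₀ c + E₁ c u.2) with hg
    have hgs : ContDiffOn ℝ ∞ g (extChartAt (modelY E m) y).target := by
      have : g = fun u => (modelEquiv e).symm (E₀ c) +
        ((modelEquiv e).symm.toLinearMap ∘ₗ E₁ c) u.2 := by
        funext u; simp [hg]
      rw [this]
      exact contDiffOn_const.add (contDiffOn_linear _ contDiffOn_snd)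
    have h : ∀ u ∈ (extChartAt (modelY E m) y).target, (ψ c).inChart y u v =
        -((2 : ℝ)⁻¹ * (ξ (modelEquiv e (modelBracket e (g u) (maurerCartan y.1 u.1 (v 0).1))) +
          ζ u.2 (modelEquiv e (modelBracket e (g u) (maurerCartan y.1 u.1 (v 0).1))))) -
        (ζ (v 0).2 ∘ₗ (modelEquiv e).toLinearMap) (g u) := by
      intro u hu
      have hgu : modelEquiv e (g u) = E₀ c + E₁ c u.2 := by simp [hg]
      rw [modelEquiv_modelBracket, LinearMap.comp_apply, LinearEquiv.coe_coe, hgu]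
      have e1 : ∀ (y : G × (Fin m → ℝ)) (w : TangentSpace (modelY E m) y),
        ψ c y (fun _ => w) = -((2 : ℝ)⁻¹ * (ξ ⁅E₀ c + E₁ c y.2, groupPart e y w⁆ +
          ζ y.2 ⁅E₀ c + E₁ c y.2, groupPart e y w⁆)) - ζ (fibrePart y w) (E₀ c + E₁ c y.2) :=
          fun _ _ => rfl
      have e2 := (DForm.inChart_apply (ψ c) y u (fun _ => v 0)).trans (e1 _ _)
      rw [groupPart_chart e hu, fibrePart_chart hu, extChartAt_modelY_symm] at e2
      have e3 : v = fun _ => v 0 := by ext1 a; rw [Subsingleton.elim a 0]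
      rw [e3]
      exact e2
    refine ContDiffOn.congr ?_ h
    have hmc := fun w => contDiffOn_maurerCartan_apply (m := m) y (w : E)
    refine (contDiffOn_const.mul (contDiffOn_affine_apply e ξ ζ contDiffOn_snd
      (contDiffOn_bilinear (modelBracket e) hgs (hmc _)))).neg.sub ?_
    exact contDiffOn_linear _ hgs
  have hmem : ∀ S : Finset κ, AlgIdeal (OneForms η) 2
      (fun y => ∑ c ∈ S, wedge (n := 2) rfl (η c y) (ψ c y)) := by
    classical
    intro S
    induction S using Finset.induction_on with
    | empty => simpa only [Finset.sum_empty] using! AlgIdeal.zero 2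
    | insert c S hc ih =>
      simp only [Finset.sum_insert hc]
      exact .add (.wedge_right rfl (.of (.of c)) (hψ c)) ih
  convert hmem Finset.univ using 1
  funext y
  ext v
  rw [d_affineForm, ContinuousAlternatingMap.sum_apply]
  simp only [wedge_one_one_apply]
  have e1 : ∀ c (w : TangentSpace (modelY E m) y),
        ψ c y (fun _ => w) = -((2 : ℝ)⁻¹ * ((ξ + ζ y.2) ⁅E₀ c + E₁ c y.2, groupPart e y w⁆)) -
          ζ (fibrePart y w) (E₀ c + E₁ c y.2) :=
          fun _ _ => rfl
  simp only [e1]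
  set X := groupPart e y (v 0) with hX0
  set Z := groupPart e y (v 1) with hX1
  have f1 : ∀ W : 𝔤, ∀ a, (ξ + ζ y.2) ⁅groupPart e y (v a), W⁆ =
      ∑ c, η c y (fun _ => v a) * (ξ + ζ y.2) ⁅E₀ c + E₁ c y.2, W⁆ := by
    intro W a
    rw [hX y (v a), sum_lie, map_sum]
    simp only [smul_lie, map_smul, smul_eq_mul]
  have f2 : ∀ p, ∀ a, ζ p (groupPart e y (v a)) =
      ∑ c, η c y (fun _ => v a) * ζ p (E₀ c + E₁ c y.2) := by
    intro p a
    rw [hX y (v a), map_sum]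
    simp only [map_smul, smul_eq_mul]
  have g1 : (ξ + ζ y.2) ⁅X, Z⁆ = (2 : ℝ)⁻¹ * ((ξ + ζ y.2) ⁅X, Z⁆ - (ξ + ζ y.2) ⁅Z, X⁆) := by
    rw [← lie_skew Z X, map_neg]
    ring
  rw [g1, f1 Z 0, f1 X 1, f2 _ 0, f2 _ 1]
  simp only [Finset.mul_sum, ← Finset.sum_sub_distrib, ← Finset.sum_neg_distrib,
    ← Finset.sum_add_distrib]
  refine Finset.sum_congr rfl fun c _ => ?_
  ring

end Affine

end System
end LieTableau

namespace LieTableau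

open EDS

section System

variable {E : Type*} [NormedAddCommGroup E] [NormedSpace ℝ E] [FiniteDimensional ℝ E]
  {G : Type*} [TopologicalSpace G] [ChartedSpace E G] [Group G] [LieGroup 𝓘(ℝ, E) ∞ G]
  [CompleteSpace E]
  {𝔤 : Type*} [LieRing 𝔤] [LieAlgebra ℝ 𝔤] (e : GroupLieAlgebra 𝓘(ℝ, E) G ≃ₗ⁅ℝ⁆ 𝔤)
  {𝔞 𝔟 : Submodule ℝ 𝔤} {A : Submodule ℝ (𝔞 →ₗ[ℝ] 𝔟)} {k h s m : ℕ}
  (𝓑 : AdaptedBasis 𝔞 𝔟 k h s) (Q : Module.Basis (Fin m) ℝ A)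

open AdaptedBasis

/-- The linear dependence on the fibre coordinates of the generators. -/
noncomputable def generatorSlope (b : Fin h ⊕ Fin s) : (Fin m → ℝ) →ₗ[ℝ] 𝔤 →ₗ[ℝ] ℝ :=
  -((tableauPoint Q).compl₂ 𝓑.projA).compr₂ (𝓑.basis.coord (Sum.inr b) ∘ₗ 𝔟.subtype)

theorem generatorSlope_apply (b : Fin h ⊕ Fin s) (p : Fin m → ℝ) (x : 𝔤) :
    generatorSlope 𝓑 Q b p x =
      -𝓑.basis.coord (Sum.inr b) (tableauPoint Q p (𝓑.projA x) : 𝔤) := rfl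

theorem coord_add_generatorSlope (b : Fin h ⊕ Fin s) (p : Fin m → ℝ) (x : 𝔤) :
    𝓑.basis.coord (Sum.inr b) x + generatorSlope 𝓑 Q b p x =
      𝓑.basis.coord (Sum.inr b) (𝓑.residual Q p x) := by
  rw [residual_apply, map_sub, generatorSlope_apply, sub_eq_add_neg]

/-- The `η^j` and `γ^a` are the `B` and `C` components of `x - Q(x_𝔞)`; for `γ^a` the correction
drops out, since `Q` takes values in `𝔟`. -/
theorem generators_eq (b : Fin h ⊕ Fin s) : generators e 𝓑 Q b =
    affineForm e (𝓑.basis.coord (Sum.inr b)) (generatorSlope 𝓑 Q b) := by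
  funext y
  ext v
  rw [affineForm_apply, coord_add_generatorSlope, residual_apply, map_sub]
  rcases b with j | a
  · have h1 : generators e 𝓑 Q (Sum.inl j) y v =
        𝓑.basis.coord (Sum.inr (Sum.inl j)) (groupPart e y (v 0)) -
        ∑ ε : Fin m, ∑ i : Fin k, (y.2 ε * 𝓑.coeff Q j ε i) *
          𝓑.basis.coord (Sum.inl i) (groupPart e y (v 0)) := by
      change etaForm e 𝓑 Q j y v = _
      simp only [etaForm, ContinuousAlternatingMap.sub_apply, ContinuousAlternatingMap.sum_apply,
        ContinuousAlternatingMap.smul_apply, betaForm, alphaForm, leftInvariantForm_apply,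
        smul_eq_mul]
    rw [h1]
    congr 1
    rw [tableauPoint_apply, map_sum]
    refine Finset.sum_congr rfl fun ε _ => ?_
    rw [map_smul, smul_eq_mul, projA_apply]
    simp only [map_sum, map_smul, AddSubmonoidClass.coe_finsetSum, SetLike.val_smul, smul_eq_mul,
      Finset.mul_sum, coeff]
    refine Finset.sum_congr rfl fun i _ => ?_
    ring
  · rw [𝓑.coord_inr_inr_coe, sub_zero]
    rfl

theorem generators_apply (b : Fin h ⊕ Fin s) (y : G × (Fin m → ℝ))
    (v : Fin 1 → TangentSpace (modelY E m) y) : generators e 𝓑 Q b y v =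
      𝓑.basis.coord (Sum.inr b) (𝓑.residual Q y.2 (groupPart e y (v 0))) := by
  rw [generators_eq, affineForm_apply, coord_add_generatorSlope]

theorem d_generators_apply (b : Fin h ⊕ Fin s) (y : G × (Fin m → ℝ))
    (v : Fin 2 → TangentSpace (modelY E m) y) : (generators e 𝓑 Q b).d y v =
      -𝓑.basis.coord (Sum.inr b)
        (𝓑.residual Q y.2 ⁅groupPart e y (v 0), groupPart e y (v 1)⁆ +
          ((tableauPoint Q (fibrePart y (v 0)) (𝓑.projA (groupPart e y (v 1))) : 𝔤) -
          (tableauPoint Q (fibrePart y (v 1)) (𝓑.projA (groupPart e y (v 0))) : 𝔤))) := by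
  rw [generators_eq, d_affineForm, LinearMap.add_apply, coord_add_generatorSlope,
    generatorSlope_apply, generatorSlope_apply, map_add, map_sub]
  ring

theorem isSmooth_generators (b : Fin h ⊕ Fin s) : (generators e 𝓑 Q b).IsSmooth := by
  rw [generators_eq]
  exact isSmooth_affineForm e _ _

theorem isSmooth_d_generators (b : Fin h ⊕ Fin s) : (generators e 𝓑 Q b).d.IsSmooth := by
  rw [generators_eq]
  exact isSmooth_d_affineForm e _ _

theorem isSmooth_leftInvariantForm (ξ : 𝔤 →ₗ[ℝ] ℝ) :
    (leftInvariantForm e m ξ).IsSmooth := by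
  rw [← affineForm_zero]
  exact isSmooth_affineForm e _ _

theorem coframe_apply (c : (Fin h ⊕ Fin s) ⊕ Fin k) (y : G × (Fin m → ℝ))
    (v : Fin 1 → TangentSpace (modelY E m) y) :
    Sum.elim (generators e 𝓑 Q) (alphaForm e 𝓑 m) c y v =
      𝓑.dualCoord Q y.2 c (groupPart e y (v 0)) := by
  rcases c with b | i
  · exact generators_apply e 𝓑 Q b y v
  · rfl

theorem isLinearPfaffian : IsLinearPfaffian (generators e 𝓑 Q) (alphaForm e 𝓑 m) where
  smooth_θ := isSmooth_generators e 𝓑 Q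
  smooth_α i := isSmooth_leftInvariantForm e _
  linearIndependent y := by
    rw [Fintype.linearIndependent_iff]
    intro g hg d
    have h1 := congrArg (fun φ : TangentSpace (modelY E m) y [⋀^Fin 1]→L[ℝ] ℝ => φ fun _ =>
      (trivialization e y).symm (𝓑.dualVector Q y.2 d, 0)) hg
    have h2 : groupPart e y ((trivialization e y).symm (𝓑.dualVector Q y.2 d, 0)) =
        𝓑.dualVector Q y.2 d :=
      congrArg Prod.fst ((trivialization e y).apply_symm_apply (𝓑.dualVector Q y.2 d, 0))
    have h3 : ∀ c, (Sum.elim (fun i => generators e 𝓑 Q i y) (fun i => alphaForm e 𝓑 m i y) c :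
        TangentSpace (modelY E m) y [⋀^Fin 1]→L[ℝ] ℝ) (fun _ =>
          (trivialization e y).symm (𝓑.dualVector Q y.2 d, 0)) = if c = d then 1 else 0 := by
      intro c
      rw [← 𝓑.dualCoord_dualVector Q y.2, ← h2, ← coframe_apply e 𝓑 Q c y (fun _ => _)]
      rcases c with b | i <;> simp [h2]
    simp only [ContinuousAlternatingMap.sum_apply, ContinuousAlternatingMap.smul_apply, h3] at h1
    simpa using h1
  -- The vectors dual to `η`, `γ`, `α` are affine in `p`: the `B_j` and `C_a` are constant and `A_i`
  -- is tilted to `A_i + Q(A_i)`.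
  linear b := by
    rw [generators_eq]
    refine d_affineForm_mem e _ _ _
      (Sum.elim (fun b => 𝓑.basis (Sum.inr b)) fun i => 𝓑.basis (Sum.inl i))
      (Sum.elim (fun _ => 0) fun i => 𝔟.subtype ∘ₗ (tableauPoint Q).flip (𝓑.vecA i)) ?_
    intro y v
    conv_lhs => rw [𝓑.eq_sum_dualCoord Q y.2 (groupPart e y v)]
    refine Finset.sum_congr rfl fun c _ => ?_
    rw [coframe_apply]
    congr 1
    rcases c with b | i
    · simp [dualVector]
    · simp [dualVector]

end System
end LieTableau

namespace LieTableau

open EDS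

/-! ### Integral elements parametrized by symmetric tuples -/

section Polar

variable {V W : Type*} [AddCommGroup V] [Module ℝ V] [AddCommGroup W] [Module ℝ W]
  {A : Submodule ℝ (V →ₗ[ℝ] W)} {p : ℕ}

/-- The polar equations of an integral element, in the parameter space. -/
def polarParam (a : ℕ → V) (P : Fin p → A) : Submodule ℝ (V × A) where
  carrier := {x | ∀ i : Fin p, (x.2 : V →ₗ[ℝ] W) (a i) = (P i : V →ₗ[ℝ] W) x.1}
  add_mem' := fun {x y} hx hy i => by simp [hx i, hy i]
  zero_mem' := fun i => by simp
  smul_mem' := fun c x hx i => by simp [hx i]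

/-- An extension `F` of `P` in the prolongation makes the pairs `(x, F x)` solutions, by its
symmetry; hence the projection to `V` is onto. Its kernel is the space of members of `A` vanishing
on the first `p` vectors. -/
theorem finrank_polarParam [FiniteDimensional ℝ V] [FiniteDimensional ℝ W]
    {a : ℕ → V} (ha : IsGenericTuple A a) (hp : p ≤ Module.finrank ℝ V) (hinv : IsInvolutive A) {P : Fin p → A} (hP : P ∈ symTuple A a p) :
    Module.finrank ℝ (polarParam a P) = Module.finrank ℝ V + minDim A p := by
  obtain ⟨F, hF, hFP⟩ := ha.exists_prolongation hinv hp hP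
  rw [mem_prolongation_iff] at hF
  rw [← ha.finrank_eq p hp]
  have h1 : (x : V) → (x, F x) ∈ polarParam a P := fun x i => by
    change (F x : V →ₗ[ℝ] W) (a i) = _
    rw [hF, hFP]
  let f : polarParam a P →ₗ[ℝ] V := LinearMap.fst ℝ V A ∘ₗ (polarParam a P).subtype
  have hf := LinearMap.finrank_range_add_finrank_ker (V := polarParam a P) (V₂ := V) f
  have hs : LinearMap.range f = ⊤ := LinearMap.range_eq_top.2 fun x => ⟨⟨_, h1 x⟩, rfl⟩
  let φ : LinearMap.ker f ≃ₗ[ℝ] tupleKer A a p :=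
    { toFun := fun x => ⟨x.1.1.2, fun i hi => by
        have h2 := x.1.2 ⟨i, hi⟩
        have h3 : x.1.1.1 = 0 := x.2
        simpa [h3] using h2⟩
      map_add' := fun x y => rfl
      map_smul' := fun c x => rfl
      invFun := fun x => ⟨⟨(0, x.1), fun i => by simpa using x.2 i i.2⟩, rfl⟩
      left_inv := fun x => by
        have h3 : x.1.1.1 = 0 := x.2
        exact Subtype.ext (Subtype.ext (Prod.ext h3.symm rfl))
      right_inv := fun x => rfl }
  rw [← hf, hs, finrank_top, φ.finrank_eq]

end Polar

section Algebra

variable {𝔤 : Type*} [LieRing 𝔤] [LieAlgebra ℝ 𝔤]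
  {𝔞 𝔟 : Submodule ℝ 𝔤} {A : Submodule ℝ (𝔞 →ₗ[ℝ] 𝔟)} {k h s m : ℕ}

theorem AdaptedBasis.finrank_A (𝓑 : AdaptedBasis 𝔞 𝔟 k h s) : Module.finrank ℝ 𝔞 = k := by
  have h1 : LinearIndependent ℝ fun i : Fin k => 𝓑.basis (Sum.inl i) :=
    𝓑.basis.linearIndependent.comp Sum.inl Sum.inl_injective
  have h2 := finrank_span_eq_card h1
  rwa [𝓑.span_A, Fintype.card_fin] at h2

theorem components_add (hd : Disjoint 𝔞 𝔟) (a : 𝔞) (b : 𝔟) :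
    components 𝔞 𝔟 ((a : 𝔤) + b) = (a, b) := by
  have hinj : Function.Injective (fun p : 𝔞 × 𝔟 => (p.1 : 𝔤) + (p.2 : 𝔤)) := by
    rintro ⟨a, b⟩ ⟨a', b'⟩ hab
    have h1 : (a : 𝔤) - a' = b' - b := by
      rw [sub_eq_sub_iff_add_eq_add, add_comm (b' : 𝔤)]
      exact hab
    have h2 : (a : 𝔤) - a' = 0 := Submodule.disjoint_def.1 hd _ (𝔞.sub_mem a.2 a'.2)
      (h1 ▸ 𝔟.sub_mem b'.2 b.2)
    rw [h2] at h1
    exact Prod.ext (Subtype.ext (sub_eq_zero.1 h2)) (Subtype.ext (sub_eq_zero.1 h1.symm).symm)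
  exact Function.leftInverse_invFun hinj (a, b)

variable (𝓑 : AdaptedBasis 𝔞 𝔟 k h s) (Q : Module.Basis (Fin m) ℝ A)

open AdaptedBasis

namespace IsTableauOver

variable (hA : IsTableauOver A)

/-- The bracket is `x + z` with `x ∈ 𝔞`, `z ∈ 𝔟`; its residual `x + z - Q(x)` differs from `τ_Q` by
`x`, which has no `B` or `C` component. -/
theorem coord_residual_graphBracket (hA : IsTableauOver A) (b : Fin h ⊕ Fin s) (p : Fin m → ℝ)
    (a₁ a₂ : 𝔞) :
    𝓑.basis.coord (Sum.inr b) (𝓑.residual Q p (graphBracket (tableauPoint Q p) a₁ a₂)) =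
      𝓑.basis.coord (Sum.inr b) (tau (tableauPoint Q p) a₁ a₂ : 𝔤) := by
  have h1 := hA.R_eq_zero _ (tableauPoint_mem Q p) a₁ a₂
  rw [Submodule.mkQ_apply, Submodule.Quotient.mk_eq_zero, Submodule.mem_sup] at h1
  obtain ⟨x, hx, z, hz, hxz⟩ := h1
  have h2 := components_add hA.disjoint ⟨x, hx⟩ ⟨z, hz⟩
  simp only [hxz] at h2
  rw [tau, h2, ← hxz, residual_apply, map_add, 𝓑.projA_coe ⟨x, hx⟩, 𝓑.projA_coe_B ⟨z, hz⟩, add_zero,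
    map_sub, map_add, 𝓑.coord_inr_coe b ⟨x, hx⟩, zero_add, Submodule.coe_sub, map_sub]

/-- A linear map into the tableau which absorbs the torsion `τ_Q`. -/
noncomputable def torsionPotential (hA : IsTableauOver A) (p : Fin m → ℝ) : 𝔞 →ₗ[ℝ] A :=
  -- The one half is that of `rho`; the sign makes the shift of the fibre part cancel the torsion.
  (-2⁻¹ : ℝ) • (hA.tau_mem _ (tableauPoint_mem Q p)).choose

theorem tau_add_torsionPotential (p : Fin m → ℝ) (a₁ a₂ : 𝔞) :
    tau (tableauPoint Q p) a₁ a₂ = (hA.torsionPotential Q p a₂ : 𝔞 →ₗ[ℝ] 𝔟) a₁ -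
      (hA.torsionPotential Q p a₁ : 𝔞 →ₗ[ℝ] 𝔟) a₂ := by
  rw [← (hA.tau_mem _ (tableauPoint_mem Q p)).choose_spec a₁ a₂]
  simp only [rho, torsionPotential, LinearMap.coe_mk, AddHom.coe_mk, LinearMap.smul_apply,
    LinearMap.sub_apply, LinearMap.flip_apply, LinearMap.comp_apply,
    Submodule.subtype_apply, Submodule.coe_smul]
  module

end IsTableauOver

theorem eq_zero_of_coord_eq_zero (z : 𝔟) (hz : ∀ j, 𝓑.basis.coord (Sum.inr (Sum.inl j)) (z : 𝔤) = 0) :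
    z = 0 := by
  refine Subtype.ext (𝓑.basis.ext_elem fun c => ?_)
  rcases c with i | j | a
  · simpa using 𝓑.coord_inl_coe i z
  · simpa using hz j
  · simpa using 𝓑.coord_inr_inr_coe a z

end Algebra

section Zeros

variable {E : Type*} [NormedAddCommGroup E] [NormedSpace ℝ E] [FiniteDimensional ℝ E]
  {G : Type*} [TopologicalSpace G] [ChartedSpace E G] [Group G] [LieGroup 𝓘(ℝ, E) ∞ G]
  [CompleteSpace E]
  {𝔤 : Type*} [LieRing 𝔤] [LieAlgebra ℝ 𝔤] (e : GroupLieAlgebra 𝓘(ℝ, E) G ≃ₗ⁅ℝ⁆ 𝔤)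
  {𝔞 𝔟 : Submodule ℝ 𝔤} {A : Submodule ℝ (𝔞 →ₗ[ℝ] 𝔟)} {k h s m : ℕ}
  (𝓑 : AdaptedBasis 𝔞 𝔟 k h s) (Q : Module.Basis (Fin m) ℝ A) (hA : IsTableauOver A)

open AdaptedBasis

/-- A parametrization, by `𝔞 × A`, of the zeros of the generators at a point.  The torsion is
absorbed. -/
noncomputable def zeroVector (y : G × (Fin m → ℝ)) : 𝔞 × A →ₗ[ℝ] TangentSpace (modelY E m) y :=
  (trivialization e y).symm.toLinearMap ∘ₗ
    ((𝔞.subtype + 𝔟.subtype ∘ₗ tableauPoint Q y.2) ∘ₗ LinearMap.fst ℝ 𝔞 A).prod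
      (Q.equivFun.toLinearMap ∘ₗ
        (LinearMap.snd ℝ 𝔞 A + hA.torsionPotential Q y.2 ∘ₗ LinearMap.fst ℝ 𝔞 A))

theorem trivialization_zeroVector (y : G × (Fin m → ℝ)) (x : 𝔞 × A) :
    trivialization e y (zeroVector e Q hA y x) = ((x.1 : 𝔤) + (tableauPoint Q y.2 x.1 : 𝔤),
      Q.equivFun (x.2 + hA.torsionPotential Q y.2 x.1)) :=
  (trivialization e y).apply_symm_apply _

theorem groupPart_zeroVector (y : G × (Fin m → ℝ)) (x : 𝔞 × A) :
    groupPart e y (zeroVector e Q hA y x) = (x.1 : 𝔤) + (tableauPoint Q y.2 x.1 : 𝔤) :=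
  congrArg Prod.fst (trivialization_zeroVector e Q hA y x)

theorem tableauPoint_fibrePart_zeroVector (y : G × (Fin m → ℝ)) (x : 𝔞 × A) :
    tableauPoint Q (fibrePart y (zeroVector e Q hA y x)) =
      (x.2 : 𝔞 →ₗ[ℝ] 𝔟) + (hA.torsionPotential Q y.2 x.1 : 𝔞 →ₗ[ℝ] 𝔟) := by
  have h1 : fibrePart y (zeroVector e Q hA y x) = Q.equivFun (x.2 + hA.torsionPotential Q y.2 x.1) :=
    congrArg Prod.snd (trivialization_zeroVector e Q hA y x)
  rw [h1, tableauPoint, LinearMap.comp_apply, LinearEquiv.coe_coe, LinearEquiv.symm_apply_apply]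
  rfl

theorem projA_groupPart_zeroVector (y : G × (Fin m → ℝ)) (x : 𝔞 × A) :
    𝓑.projA (groupPart e y (zeroVector e Q hA y x)) = x.1 := by
  rw [groupPart_zeroVector, map_add, 𝓑.projA_coe, 𝓑.projA_coe_B, add_zero]

theorem zeroVector_injective (𝓑 : AdaptedBasis 𝔞 𝔟 k h s) (y : G × (Fin m → ℝ)) :
    Function.Injective (zeroVector e Q hA y) := by
  intro x x' hx
  have h1 : x.1 = x'.1 := by
    rw [← projA_groupPart_zeroVector e 𝓑 Q hA y x, hx, projA_groupPart_zeroVector]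
  have h2 := congrArg Prod.snd ((trivialization_zeroVector e Q hA y x).symm.trans
    ((congrArg (trivialization e y) hx).trans (trivialization_zeroVector e Q hA y x')))
  have h3 := Q.equivFun.injective h2
  rw [h1] at h3
  exact Prod.ext h1 (add_right_cancel h3)

theorem generators_zeroVector (y : G × (Fin m → ℝ)) (x : 𝔞 × A) (b : Fin h ⊕ Fin s) :
    generators e 𝓑 Q b y (fun _ => zeroVector e Q hA y x) = 0 := by
  rw [generators_apply, residual_apply, projA_groupPart_zeroVector, groupPart_zeroVector,
    add_sub_cancel_right, 𝓑.coord_inr_coe]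

/-- The generators vanish when the residual of the `𝔤`-part has no `B` or `C` component, that is,
when it equals `x_𝔞`; the fibre part is unconstrained and determines `P`. -/
theorem generators_eq_zero_iff (y : G × (Fin m → ℝ)) (v : TangentSpace (modelY E m) y) :
    (∀ b, generators e 𝓑 Q b y (fun _ => v) = 0) ↔ ∃ x, zeroVector e Q hA y x = v := by
  constructor
  · intro hv
    set a := 𝓑.projA (groupPart e y v) with ha
    obtain ⟨P, hP⟩ : ∃ P : A, P + hA.torsionPotential Q y.2 a = Q.equivFun.symm (fibrePart y v) :=
      ⟨Q.equivFun.symm (fibrePart y v) + (-1 : ℝ) • hA.torsionPotential Q y.2 a, 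
        Subtype.ext (LinearMap.ext fun x => by simp)⟩
    refine ⟨(a, P), ?_⟩
    apply (trivialization e y).injective
    rw [trivialization_zeroVector, trivialization_apply]
    refine Prod.ext ?_ (by rw [hP, LinearEquiv.apply_symm_apply])
    change (a : 𝔤) + (tableauPoint Q y.2 a : 𝔤) = groupPart e y v
    have h1 : ∀ c, 𝓑.basis.coord c (𝓑.residual Q y.2 (groupPart e y v)) =
        𝓑.basis.coord c (a : 𝔤) := by
      intro c
      rcases c with i | b
      · rw [residual_apply, map_sub, 𝓑.coord_inl_coe, sub_zero, ha, 𝓑.coord_inl_projA]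
      · rw [𝓑.coord_inr_coe, ← hv b, generators_apply]
    have h2 : 𝓑.residual Q y.2 (groupPart e y v) = a := 𝓑.basis.ext_elem h1
    rw [residual_apply, ← ha, sub_eq_iff_eq_add] at h2
    exact h2.symm
  · rintro ⟨x, rfl⟩ b
    exact generators_zeroVector e 𝓑 Q hA y x b

/-- The bracket contributes `τ_Q`, the shift by the torsion potential contributes its opposite, and
only the skew expression in the parameters remains. -/
theorem d_generators_zeroVector (y : G × (Fin m → ℝ)) (x₁ x₂ : 𝔞 × A) (b : Fin h ⊕ Fin s) :
    (generators e 𝓑 Q b).d y ![zeroVector e Q hA y x₁, zeroVector e Q hA y x₂] =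
      -𝓑.basis.coord (Sum.inr b)
        (((x₁.2 : 𝔞 →ₗ[ℝ] 𝔟) x₂.1 - (x₂.2 : 𝔞 →ₗ[ℝ] 𝔟) x₁.1 : 𝔟) : 𝔤) := by
  rw [d_generators_apply]
  simp only [Matrix.cons_val_zero, Matrix.cons_val_one]
  rw [projA_groupPart_zeroVector, projA_groupPart_zeroVector, tableauPoint_fibrePart_zeroVector,
    tableauPoint_fibrePart_zeroVector, groupPart_zeroVector, groupPart_zeroVector, map_add]
  have h1 := hA.coord_residual_graphBracket 𝓑 Q b y.2 x₁.1 x₂.1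
  rw [graphBracket] at h1
  rw [h1, ← map_add, hA.tau_add_torsionPotential Q]
  congr 2
  simp only [LinearMap.add_apply, Submodule.coe_add, Submodule.coe_sub]
  abel

theorem d_generators_zeroVector_eq_zero_iff (y : G × (Fin m → ℝ)) (x₁ x₂ : 𝔞 × A) :
    (∀ b, (generators e 𝓑 Q b).d y ![zeroVector e Q hA y x₁, zeroVector e Q hA y x₂] = 0) ↔
      (x₁.2 : 𝔞 →ₗ[ℝ] 𝔟) x₂.1 = (x₂.2 : 𝔞 →ₗ[ℝ] 𝔟) x₁.1 := by
  simp only [d_generators_zeroVector, neg_eq_zero]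
  refine ⟨fun hb => sub_eq_zero.1 (eq_zero_of_coord_eq_zero 𝓑 _ fun j => hb (Sum.inl j)),
    fun hb b => ?_⟩
  rw [hb, sub_self, Submodule.coe_zero, map_zero]

section Flag

variable [FiniteDimensional ℝ 𝔤] {a : ℕ → 𝔞} (ha : IsGenericTuple A a) {p : ℕ}
  (hp : p ≤ Module.finrank ℝ 𝔞)

/-- The left-invariant coframe dual to the first members of a generic sequence in `𝔞`. -/
noncomputable def tupleCoframe (e : GroupLieAlgebra 𝓘(ℝ, E) G ≃ₗ⁅ℝ⁆ 𝔤)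
    (𝓑 : AdaptedBasis 𝔞 𝔟 k h s) (m : ℕ) (ha : IsGenericTuple A a)
    (hp : p ≤ Module.finrank ℝ 𝔞) (i : Fin p) : DForm (modelY E m) (G × (Fin m → ℝ)) 1 :=
  leftInvariantForm e m ((tupleBasis ha.linearIndependent).coord (Fin.castLE hp i) ∘ₗ 𝓑.projA)

theorem isSmooth_tupleCoframe (i : Fin p) : (tupleCoframe e 𝓑 m ha hp i).IsSmooth :=
  isSmooth_leftInvariantForm e _

theorem tupleCoframe_apply (y : G × (Fin m → ℝ)) (v : TangentSpace (modelY E m) y) (i : Fin p) :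
    tupleCoframe e 𝓑 m ha hp i y (fun _ => v) =
      (tupleBasis ha.linearIndependent).coord (Fin.castLE hp i) (𝓑.projA (groupPart e y v)) := rfl

theorem tupleCoframe_zeroVector (y : G × (Fin m → ℝ)) (P : Fin p → A) (i l : Fin p) :
    tupleCoframe e 𝓑 m ha hp i y (fun _ => zeroVector e Q hA y (a l, P l)) =
      if l = i then 1 else 0 := by
  have h1 : a l = tupleBasis ha.linearIndependent (Fin.castLE hp l) := by
    rw [tupleBasis_apply]; rfl
  rw [tupleCoframe_apply, projA_groupPart_zeroVector, h1, Module.Basis.coord_apply,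
    Module.Basis.repr_self, Finsupp.single_apply]
  simp

/-- The polar space is the injective image of the parametrized polar equations' solutions, so its
dimension depends neither on `P` nor on `y`. -/
theorem finrank_polarSpace (ha : IsGenericTuple A a) (hp : p ≤ Module.finrank ℝ 𝔞)
    (y : G × (Fin m → ℝ)) {P : Fin p → A} (hP : P ∈ symTuple A a p) :
    Module.finrank ℝ (polarSpace (systemIdeal e 𝓑 Q) p y
      (Submodule.span ℝ (Set.range fun i : Fin p => zeroVector e Q hA y (a i, P i)))) =
      Module.finrank ℝ 𝔞 + minDim A p := by
  rw [← finrank_polarParam ha hp hA.involutive hP]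
  have h1 : polarSpace (systemIdeal e 𝓑 Q) p y
      (Submodule.span ℝ (Set.range fun i : Fin p => zeroVector e Q hA y (a i, P i))) =
      (polarParam a P).map (zeroVector e Q hA y) := by
    ext v
    rw [systemIdeal, mem_polarSpace_iff (isSmooth_generators e 𝓑 Q) (isSmooth_d_generators e 𝓑 Q) _
      (fun b i => generators_zeroVector e 𝓑 Q hA y _ b)
      (fun b i l => (d_generators_zeroVector_eq_zero_iff e 𝓑 Q hA y _ _).2 (hP i l) b)
      (tupleCoframe e 𝓑 m ha hp) (isSmooth_tupleCoframe e 𝓑 ha hp)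
      (fun i l => tupleCoframe_zeroVector e 𝓑 Q hA ha hp y P i l),
      generators_eq_zero_iff e 𝓑 Q hA, Submodule.mem_map]
    constructor
    · rintro ⟨⟨x, rfl⟩, h2⟩
      exact ⟨x, fun i => (d_generators_zeroVector_eq_zero_iff e 𝓑 Q hA y _ _).1 fun b => h2 b i,
        rfl⟩
    · rintro ⟨x, hx, rfl⟩
      exact ⟨⟨x, rfl⟩, fun b i =>
        (d_generators_zeroVector_eq_zero_iff e 𝓑 Q hA y x (a i, P i)).2 (hx i) b⟩
  rw [h1]
  exact (Submodule.equivMapOfInjective _ (zeroVector_injective e Q hA 𝓑 y) _).finrank_eq.symm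

end Flag

end Zeros
end LieTableau

namespace LieTableau

open EDS

/-! ### Kähler-ordinary and Kähler-regular elements over generic sequences -/

section Ordinary

variable {E : Type*} [NormedAddCommGroup E] [NormedSpace ℝ E] [FiniteDimensional ℝ E]
  {G : Type*} [TopologicalSpace G] [ChartedSpace E G] [Group G] [LieGroup 𝓘(ℝ, E) ∞ G]
  [CompleteSpace E]
  {𝔤 : Type*} [LieRing 𝔤] [LieAlgebra ℝ 𝔤] [FiniteDimensional ℝ 𝔤]
  (e : GroupLieAlgebra 𝓘(ℝ, E) G ≃ₗ⁅ℝ⁆ 𝔤)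
  {𝔞 𝔟 : Submodule ℝ 𝔤} {A : Submodule ℝ (𝔞 →ₗ[ℝ] 𝔟)} {k h s m : ℕ}
  (𝓑 : AdaptedBasis 𝔞 𝔟 k h s) (Q : Module.Basis (Fin m) ℝ A) (hA : IsTableauOver A)
  {a : ℕ → 𝔞} {p : ℕ}

theorem isManifold_config : IsManifold (modelY E m) 1 (G × (Fin m → ℝ)) := by
  have : IsManifold 𝓘(ℝ, E) ∞ G := ContMDiffMul.toIsManifold
  have : IsManifold 𝓘(ℝ, E) 1 G := IsManifold.of_le (n := ∞) (by simp)
  infer_instance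

theorem isKahlerOrdinary_zeroVector (ha : IsGenericTuple A a) (hp : p ≤ Module.finrank ℝ 𝔞)
    (y : G × (Fin m → ℝ)) {P : Fin p → A} (hP : P ∈ symTuple A a p) :
    IsKahlerOrdinary (systemIdeal e 𝓑 Q) p y
      (Submodule.span ℝ (Set.range fun i : Fin p => zeroVector e Q hA y (a i, P i))) := by
  have := isManifold_config (E := E) (G := G) (m := m)
  set w : Fin p → TangentSpace (modelY E m) y := fun i => zeroVector e Q hA y (a i, P i) with hw
  set α := tupleCoframe e 𝓑 m ha hp with hα
  have hαs : ∀ i, (α i).IsSmooth := isSmooth_tupleCoframe e 𝓑 ha hp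
  have hdual : ∀ i l, α i y (fun _ => w l) = if l = i then 1 else 0 :=
    fun i l => tupleCoframe_zeroVector e 𝓑 Q hA ha hp y P i l
  -- The `𝔞`-components of the dual frames of nearby planes, completed by the fixed members of `a`
  -- so that genericity can be asked of the sequence.
  let a' : (E × (Fin m → ℝ)) × (Fin p → E × (Fin m → ℝ)) → ℕ → 𝔞 := fun z i =>
    if hi : i < p then 𝓑.projA (groupPart e (basePoint (modelY E m) y z)
      (dualFrame α (basePoint (modelY E m) y z) (frameAt (modelY E m) y z) ⟨i, hi⟩)) else a i
  have hz₀ : frameCoord y w = (extChartAt (modelY E m) y y, (w : Fin p → E × (Fin m → ℝ))) :=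
    frameCoord_eq y w
  have htarget : (frameCoord y w).1 ∈ (extChartAt (modelY E m) y).target := mem_extChartAt_target y
  have hdet₀ : (Matrix.of fun l i => α i (basePoint (modelY E m) y (frameCoord y w))
      (fun _ => frameAt (modelY E m) y (frameCoord y w) l)).det ≠ 0 := by
    rw [hz₀]
    refine of_frame_at_center y w
      (fun y w => (Matrix.of fun l i => α i y (fun _ => w l)).det ≠ 0) ?_
    have : (Matrix.of fun l i => α i y (fun _ => w l)) = 1 := by
      ext i j; simp [hdual, Matrix.one_apply]
    rw [this, Matrix.det_one]
    exact one_ne_zero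
  have ha'₀ : a' (frameCoord y w) = a := by
    funext i
    by_cases hi : i < p
    · simp only [a', dif_pos hi]
      rw [hz₀]
      refine of_frame_at_center y w
        (fun y w => 𝓑.projA (groupPart e y (dualFrame α y w ⟨i, hi⟩)) = a i) ?_
      rw [dualFrame_of_dual hdual]
      exact projA_groupPart_zeroVector e 𝓑 Q hA y _
    · simp only [a', dif_neg hi]
  have hcont : ∀ i < Module.finrank ℝ 𝔞, ∀ ξ : 𝔞 →ₗ[ℝ] ℝ,
      ContinuousAt (fun z => ξ (a' z i)) (frameCoord y w) := by
    intro i _ ξ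
    by_cases hi : i < p
    · simp only [a', dif_pos hi]
      exact continuousAt_apply_dualFrame hαs
        (isSmooth_leftInvariantForm e (m := m) (ξ ∘ₗ 𝓑.projA)) y htarget hdet₀ ⟨i, hi⟩
    · simp only [a', dif_neg hi]
      exact continuousAt_const
  let ξ : Fin h → 𝔟 →ₗ[ℝ] ℝ := fun j => 𝓑.basis.coord (Sum.inr (Sum.inl j)) ∘ₗ 𝔟.subtype
  have hξ : ∀ z : 𝔟, (∀ j, ξ j z = 0) → z = 0 := eq_zero_of_coord_eq_zero 𝓑
  obtain ⟨κ, hκ, c, hc, hli, hev⟩ := IsGenericTuple.exists_independent_equations hcont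
    (ha'₀.symm ▸ ha) hA.involutive hξ hp
  rw [ha'₀] at hli
  have hdzero : ∀ (y : G × (Fin m → ℝ)) (x₁ x₂ : 𝔞 × A) (j : Fin h),
      (generators e 𝓑 Q (Sum.inl j)).d y ![zeroVector e Q hA y x₁, zeroVector e Q hA y x₂] =
      -ξ j ((x₁.2 : 𝔞 →ₗ[ℝ] 𝔟) x₂.1 - (x₂.2 : 𝔞 →ₗ[ℝ] 𝔟) x₁.1) :=
    fun y x₁ x₂ j => d_generators_zeroVector e 𝓑 Q hA y x₁ x₂ (Sum.inl j)
  -- Only derivatives of the `η^j` are selected: those of the `γ^a` vanish on all zeros of the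
  -- generators.
  refine isKahlerOrdinary_span (isSmooth_generators e 𝓑 Q) (isSmooth_d_generators e 𝓑 Q) w
    (fun b i => generators_zeroVector e 𝓑 Q hA y _ b)
    (fun b i l => (d_generators_zeroVector_eq_zero_iff e 𝓑 Q hA y _ _).2 (hP i l) b)
    α hαs hdual (fun q => (Sum.inl (c q).1, (c q).2)) hc ?_ ?_
  · intro g₁ g₂ hg
    have := Fintype.ofFinite κ
    simp only [finsum_eq_sum_of_fintype] at hg
    -- Vertical variations, which change only the `A`-parameters, are killed by the generators and
    -- leave a relation between the symmetry functionals.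
    have hg₂ : g₂ = 0 := by
      have h1 : ∑ q, g₂ q • symFunctional A ξ a (c q) = 0 := by
        refine LinearMap.ext fun R => ?_
        have h2 := hg (fun i => zeroVector e Q hA y (0, R i)) fun i l => by
          rw [hα, tupleCoframe_apply, projA_groupPart_zeroVector, map_zero]
        simp only [generators_zeroVector, mul_zero, Finset.sum_const_zero, zero_add] at h2
        rw [LinearMap.sum_apply, LinearMap.zero_apply, ← neg_eq_zero, ← h2, ← Finset.sum_neg_distrib]
        refine Finset.sum_congr rfl fun q _ => ?_
        rw [hdzero, hdzero, LinearMap.smul_apply, symFunctional_apply]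
        simp only [map_zero, sub_zero, zero_sub, map_neg, map_sub, smul_eq_mul]
        ring
      exact funext (Fintype.linearIndependent_iff.1 hli g₂ h1)
    refine ⟨?_, hg₂⟩
    funext ⟨b, i⟩
    -- A vector dual to the generator `b` and killed by `α`; placed in slot `i` it isolates `g₁ (b,
    -- i)`.
    set u := (trivialization e y).symm (𝓑.basis (Sum.inr b), 0) with hu
    have hgu : groupPart e y u = 𝓑.basis (Sum.inr b) :=
      congrArg Prod.fst ((trivialization e y).apply_symm_apply _)
    have hθu : ∀ b', generators e 𝓑 Q b' y (fun _ => u) = if b' = b then 1 else 0 := by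
      intro b'
      rw [generators_apply, AdaptedBasis.residual_apply, hgu, 𝓑.projA_basis_inr]
      simp [Finsupp.single_apply, eq_comm]
    have h2 := hg (fun l => if l = i then u else 0) fun j l => by
      by_cases hl : l = i
      · simp only [if_pos hl]
        rw [hα, tupleCoframe_apply, hgu, 𝓑.projA_basis_inr, map_zero]
      · simp only [if_neg hl]
        rw [hα, tupleCoframe_apply, map_zero, map_zero, map_zero]
    rw [hg₂] at h2
    simp only [Pi.zero_apply, zero_mul, Finset.sum_const_zero, add_zero] at h2
    rw [Finset.sum_eq_single (b, i)] at h2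
    · simpa [hθu] using h2
    · rintro ⟨b', i'⟩ - hne
      by_cases hi : i' = i
      · have hb : b' ≠ b := fun hb => hne (by rw [hb, hi])
        simp [hi, hθu, hb]
      · simp only [if_neg hi]
        rw [generators_apply, map_zero, map_zero, map_zero, mul_zero]
    · simp
  -- At a nearby point the zeros of the generators are again given by pairs; the selected equations
  -- make the `A`-parameters symmetric, which gives all the others.
  · filter_upwards [hev] with z hz w' hw' _ hθ hd
    choose x hx using fun i => (generators_eq_zero_iff e 𝓑 Q hA _ (w' i)).1 fun b => hθ b i
    have hxa : ∀ i : Fin p, (x i).1 = a' z i := by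
      intro i
      simp only [a', dif_pos i.2]
      rw [← projA_groupPart_zeroVector e 𝓑 Q hA _ (x i), hx, hw']
    have hR := hz (fun i => (x i).2) fun q => by
      have h1 := hd q
      rw [← hx, ← hx, hdzero, neg_eq_zero, hxa, hxa] at h1
      exact h1
    intro b i l
    rw [← hx, ← hx]
    refine (d_generators_zeroVector_eq_zero_iff e 𝓑 Q hA _ _ _).2 ?_ b
    rw [hxa, hxa]
    exact hR i l

/-- The vectors of an integral element, in the parametrization of the zeros of the generators. -/
theorem exists_param_of_isIntegralElement {n : ℕ} {y : G × (Fin m → ℝ)}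
    {S : Submodule ℝ (TangentSpace (modelY E m) y)}
    (hS : IsIntegralElement (systemIdeal e 𝓑 Q) n y S)
    (v : Fin p → TangentSpace (modelY E m) y) (hv : ∀ i, v i ∈ S)
    (hva : ∀ i, 𝓑.projA (groupPart e y (v i)) = a i) :
    ∃ P ∈ symTuple A a p, ∀ i : Fin p, zeroVector e Q hA y (a i, P i) = v i := by
  choose x hx using fun i => (generators_eq_zero_iff e 𝓑 Q hA y (v i)).1 fun b =>
    hS.2 1 _ (DiffIdeal.of_mem b) _ fun _ => hv i
  have hxa : ∀ i : Fin p, (x i).1 = a i := by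
    intro i
    rw [← hva, ← projA_groupPart_zeroVector e 𝓑 Q hA _ (x i), hx]
  refine ⟨fun i => (x i).2, fun i l => ?_, fun i => ?_⟩
  · have h1 := (d_generators_zeroVector_eq_zero_iff e 𝓑 Q hA y (x i) (x l)).1 fun b =>
      hS.2 2 _ (DiffIdeal.d_mem b) _ fun c => by
        rw [hx, hx]
        fin_cases c <;> exact hv _
    rwa [hxa, hxa] at h1
  · rw [← hx, ← hxa]

/-- Nearby integral elements lie over nearby sequences. These are still generic, so the same formula
gives their polar dimension. -/
theorem isKahlerRegular_zeroVector (ha : IsGenericTuple A a) (hp : p ≤ Module.finrank ℝ 𝔞)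
    (y : G × (Fin m → ℝ)) {P : Fin p → A} (hP : P ∈ symTuple A a p) :
    IsKahlerRegular (systemIdeal e 𝓑 Q) p y
      (Submodule.span ℝ (Set.range fun i : Fin p => zeroVector e Q hA y (a i, P i))) := by
  have := isManifold_config (E := E) (G := G) (m := m)
  refine ⟨isKahlerOrdinary_zeroVector e 𝓑 Q hA ha hp y hP, ?_⟩
  set w : Fin p → TangentSpace (modelY E m) y := fun i => zeroVector e Q hA y (a i, P i) with hw
  refine ⟨w, ⟨linearIndependent_of_dual
    (fun i l => tupleCoframe_zeroVector e 𝓑 Q hA ha hp y P i l), rfl⟩, ?_⟩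
  let a' : (E × (Fin m → ℝ)) × (Fin p → E × (Fin m → ℝ)) → ℕ → 𝔞 := fun z i =>
    if hi : i < p then 𝓑.projA (groupPart e (basePoint (modelY E m) y z)
      (frameAt (modelY E m) y z ⟨i, hi⟩)) else a i
  have hz₀ : frameCoord y w = (extChartAt (modelY E m) y y, (w : Fin p → E × (Fin m → ℝ))) :=
    frameCoord_eq y w
  have htarget : (frameCoord y w).1 ∈ (extChartAt (modelY E m) y).target := mem_extChartAt_target y
  have ha'₀ : a' (frameCoord y w) = a := by
    funext i
    by_cases hi : i < p
    · simp only [a', dif_pos hi]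
      rw [hz₀]
      exact of_frame_at_center y w (fun y w => 𝓑.projA (groupPart e y (w ⟨i, hi⟩)) = a i)
        (projA_groupPart_zeroVector e 𝓑 Q hA y _)
    · simp only [a', dif_neg hi]
  have hcont : ∀ i < Module.finrank ℝ 𝔞, ∀ ξ : 𝔞 →ₗ[ℝ] ℝ,
      ContinuousAt (fun z => ξ (a' z i)) (frameCoord y w) := by
    intro i _ ξ
    by_cases hi : i < p
    · simp only [a', dif_pos hi]
      exact continuousAt_apply_frameAt (isSmooth_leftInvariantForm e (m := m) (ξ ∘ₗ 𝓑.projA)) y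
        htarget ⟨i, hi⟩
    · simp only [a', dif_neg hi]
      exact continuousAt_const
  filter_upwards [IsGenericTuple.eventually hcont (ha'₀.symm ▸ ha)] with z hz hord
  rw [finrank_polarSpace e 𝓑 Q hA ha hp y hP]
  obtain ⟨R, hR, hRz⟩ := exists_param_of_isIntegralElement e 𝓑 Q hA (a := a' z) hord.1
    (frameAt (modelY E m) y z) (fun i => Submodule.subset_span ⟨i, rfl⟩) fun i => by
      simp only [a', dif_pos i.2]
  have h1 := finrank_polarSpace e 𝓑 Q hA hz hp (basePoint (modelY E m) y z) hR
  rw [funext hRz] at h1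
  exact h1

end Ordinary
end LieTableau

namespace LieTableau

open EDS

/-! ### Involution and Cartan characters -/

section Main

variable {E : Type*} [NormedAddCommGroup E] [NormedSpace ℝ E] [FiniteDimensional ℝ E]
  {G : Type*} [TopologicalSpace G] [ChartedSpace E G] [Group G] [LieGroup 𝓘(ℝ, E) ∞ G]
  [CompleteSpace E]
  {𝔤 : Type*} [LieRing 𝔤] [LieAlgebra ℝ 𝔤] [FiniteDimensional ℝ 𝔤]
  (e : GroupLieAlgebra 𝓘(ℝ, E) G ≃ₗ⁅ℝ⁆ 𝔤)
  {𝔞 𝔟 : Submodule ℝ 𝔤} {A : Submodule ℝ (𝔞 →ₗ[ℝ] 𝔟)} {k h s m : ℕ}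
  (𝓑 : AdaptedBasis 𝔞 𝔟 k h s) (Q : Module.Basis (Fin m) ℝ A) (hA : IsTableauOver A)

/-- The zero tuple is symmetric, so the vectors with parameters `(a_i, 0)` span an ordinary flag at
every point. -/
theorem isInInvolution (hA : IsTableauOver A) (h𝓑 : 𝓑.IsGeneric A) :
    IsInInvolution (systemIdeal e 𝓑 Q) (independenceForm e 𝓑 m) := by
  intro y
  have hk := 𝓑.finrank_A
  obtain ⟨a, ha⟩ := 𝓑.exists_isGenericTuple h𝓑 hk
  have h0 : ∀ p, (0 : Fin p → A) ∈ symTuple A a p := fun p => Submodule.zero_mem _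
  let S : ℕ → Submodule ℝ (TangentSpace (modelY E m) y) := fun p =>
    Submodule.span ℝ (Set.range fun i : Fin p => zeroVector e Q hA y (a i, (0 : Fin p → A) i))
  have hord : ∀ p ≤ k, IsKahlerOrdinary (systemIdeal e 𝓑 Q) p y (S p) := fun p hp =>
    isKahlerOrdinary_zeroVector e 𝓑 Q hA ha (hp.trans hk.ge) y (h0 p)
  refine ⟨S k, ⟨(hord k le_rfl).1, fun j => zeroVector e Q hA y (𝓑.vecA j, 0), fun j => ?_, ?_⟩, S,
    ⟨fun p _ => ?_, fun p hp => (hord p hp).1, hord 0 (Nat.zero_le _), fun p hp =>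
      isKahlerRegular_zeroVector e 𝓑 Q hA ha (hp.le.trans hk.ge) y (h0 p)⟩, rfl⟩
  -- The plane is spanned over the generic sequence, while `ω` is evaluated on lifts of the `A_j`;
  -- these lie in the plane by linearity in the first parameter.
  · have h1 := (tupleBasis ha.linearIndependent).sum_repr (𝓑.vecA j)
    have h2 : zeroVector e Q hA y (𝓑.vecA j, 0) =
        (zeroVector e Q hA y ∘ₗ LinearMap.inl ℝ 𝔞 A) (𝓑.vecA j) := rfl
    change zeroVector e Q hA y (𝓑.vecA j, 0) ∈ S k
    rw [h2, show 𝓑.vecA j = _ from h1.symm, map_sum]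
    refine Submodule.sum_mem _ fun i _ => ?_
    rw [map_smul, tupleBasis_apply]
    exact Submodule.smul_mem _ _ (Submodule.subset_span ⟨⟨i, i.2.trans_eq hk⟩, rfl⟩)
  · have h1 : independenceForm e 𝓑 m y (fun j => zeroVector e Q hA y (𝓑.vecA j, 0)) = 1 := by
      refine wedgeOneForms_of_dual _ _ fun i j => ?_
      rw [alphaForm, leftInvariantForm_apply, ← 𝓑.coord_inl_projA, projA_groupPart_zeroVector,
        AdaptedBasis.coe_vecA]
      simp [Finsupp.single_apply]
    rw [h1]
    exact one_ne_zero
  · refine Submodule.span_le.2 ?_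
    rintro _ ⟨i, rfl⟩
    exact Submodule.subset_span ⟨i.castSucc, rfl⟩

/-- An integral element on which the independence form does not vanish projects onto `𝔞`. -/
theorem exists_lift_of_isIntegralElementOf {y : G × (Fin m → ℝ)}
    {S : Submodule ℝ (TangentSpace (modelY E m) y)}
    (hS : IsIntegralElementOf (systemIdeal e 𝓑 Q) (independenceForm e 𝓑 m) y S) (x : 𝔞) :
    ∃ v ∈ S, 𝓑.projA (groupPart e y v) = x := by
  obtain ⟨-, v, hv, hΩ⟩ := hS
  rw [independenceForm, wedgeOneForms_apply] at hΩ
  let f : 𝔞 →ₗ[ℝ] (Fin k → ℝ) := LinearMap.pi fun i => 𝓑.basis.coord (Sum.inl i) ∘ₗ 𝔞.subtype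
  have hli : LinearIndependent ℝ fun j => 𝓑.projA (groupPart e y (v j)) := by
    refine linearIndependent_of_det_ne_zero f ?_
    rw [← Matrix.det_transpose]
    convert hΩ using 2
    ext i j
    simp only [Matrix.transpose_apply, Matrix.of_apply, f, LinearMap.pi_apply,
      LinearMap.comp_apply, Submodule.subtype_apply]
    exact 𝓑.coord_inl_projA i _
  have hspan := hli.span_eq_top_of_card_eq_finrank' (by rw [Fintype.card_fin, 𝓑.finrank_A])
  have hx : x ∈ Submodule.span ℝ (Set.range fun j => 𝓑.projA (groupPart e y (v j))) :=
    hspan ▸ Submodule.mem_top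
  have hle : Submodule.span ℝ (Set.range fun j => 𝓑.projA (groupPart e y (v j))) ≤
      S.map (𝓑.projA ∘ₗ groupPart e y) := by
    rw [Submodule.span_le]
    rintro _ ⟨j, rfl⟩
    exact ⟨v j, hv j, rfl⟩
  exact hle hx

/-- `F p` may lie over a non-generic sequence. An arbitrarily small move inside `F k` puts it over a
generic one, where the plane is Kähler-ordinary with known polar dimension; the regularity of `F p`
carries that dimension back. -/
theorem finrank_polarSpace_of_isOrdinaryFlag (hA : IsTableauOver A) (h𝓑 : 𝓑.IsGeneric A)
    {y : G × (Fin m → ℝ)} {F : ℕ → Submodule ℝ (TangentSpace (modelY E m) y)}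
    (hF : IsOrdinaryFlag (systemIdeal e 𝓑 Q) k y F)
    (hFk : IsIntegralElementOf (systemIdeal e 𝓑 Q) (independenceForm e 𝓑 m) y (F k))
    {p : ℕ} (hp : p < k) :
    Module.finrank ℝ (polarSpace (systemIdeal e 𝓑 Q) p y (F p)) = k + minDim A p := by
  have := isManifold_config (E := E) (G := G) (m := m)
  have hk := 𝓑.finrank_A
  obtain ⟨b, hb⟩ := 𝓑.exists_isGenericTuple h𝓑 hk
  obtain ⟨-, v, hv, hreg⟩ := hF.regular p hp
  have hle : ∀ q, p ≤ q → q ≤ k → F p ≤ F q := by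
    intro q hpq
    induction q, hpq using Nat.le_induction with
    | base => exact fun _ => le_rfl
    | succ q hpq ih => exact fun hq => (ih (by omega)).trans (hF.le_succ q (by omega))
  have hvF : ∀ i, v i ∈ F k := fun i => hle k hp.le le_rfl (hv.2 ▸ Submodule.subset_span ⟨i, rfl⟩)
  choose u huF hub using fun i : Fin p => exists_lift_of_isIntegralElementOf e 𝓑 Q hFk (b i)
  -- The padding by zero beyond `p` is harmless, since moving towards `b` makes the whole sequence
  -- generic.
  let a : ℕ → 𝔞 := fun i => if hi : i < p then 𝓑.projA (groupPart e y (v ⟨i, hi⟩)) else 0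
  have hav : ∀ i : Fin p, a i = 𝓑.projA (groupPart e y (v i)) := fun i => dif_pos i.2
  -- These vectors stay in the integral element `F k`, so they satisfy all the equations, while
  -- their projections move from those of `v` towards `b`.
  let vt : ℝ → Fin p → TangentSpace (modelY E m) y := fun t i => v i + t • (u i - v i)
  have hvt : ∀ t i, vt t i ∈ F k := fun t i =>
    (F k).add_mem (hvF i) ((F k).smul_mem t ((F k).sub_mem (huF i) (hvF i)))
  have hvta : ∀ t (i : Fin p), 𝓑.projA (groupPart e y (vt t i)) = a i + t • (b i - a i) := by
    intro t i
    simp only [vt, map_add, map_smul, map_sub, hub, hav]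
  have hlim : Filter.Tendsto (fun t => frameCoord y (vt t)) (𝓝[≠] 0) (𝓝 (frameCoord y v)) := by
    simp only [frameCoord_eq]
    let v' : Fin p → E × (Fin m → ℝ) := v
    let u' : Fin p → E × (Fin m → ℝ) := u
    have hc : Continuous fun t : ℝ => ((extChartAt (modelY E m) y y,
        fun i => v' i + t • (u' i - v' i)) :
        (E × (Fin m → ℝ)) × (Fin p → E × (Fin m → ℝ))) := by fun_prop
    exact (hc.tendsto' 0 (extChartAt (modelY E m) y y, v') (by simp)).mono_left nhdsWithin_le_nhds
  -- A non-zero `t` so small that the frame lies in the neighbourhood given by regularity, and for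
  -- which the sequence is generic.
  obtain ⟨t, ht, hgen⟩ := ((hlim.eventually hreg).and (hb.eventually_line (a := a))).exists
  obtain ⟨P, hP, hPv⟩ := exists_param_of_isIntegralElement e 𝓑 Q hA
    (a := fun i => a i + t • (b i - a i)) hFk.1 (vt t) (hvt t) (hvta t)
  have hord := isKahlerOrdinary_zeroVector e 𝓑 Q hA hgen (hp.le.trans hk.ge) y hP
  have hpol := finrank_polarSpace e 𝓑 Q hA hgen (hp.le.trans hk.ge) y hP
  rw [funext hPv] at hord hpol
  rw [frameCoord_eq] at ht
  rw [← ht (of_frame_at_center y (vt t)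
    (fun y w => IsKahlerOrdinary (systemIdeal e 𝓑 Q) p y (Submodule.span ℝ (Set.range w))) hord)]
  refine of_frame_at_center y (vt t) (fun y w => Module.finrank ℝ
    (polarSpace (systemIdeal e 𝓑 Q) p y (Submodule.span ℝ (Set.range w))) = k + minDim A p) ?_
  rw [hpol, hk]

theorem hasCartanCharacters (hA : IsTableauOver A) (h𝓑 : 𝓑.IsGeneric A) :
    HasCartanCharacters (systemIdeal e 𝓑 Q) (independenceForm e 𝓑 m) (character A) := by
  refine ⟨isInInvolution e 𝓑 Q hA h𝓑, fun y F hF hFk j hj => ?_⟩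
  rw [Finset.mem_Icc] at hj
  obtain ⟨p, rfl⟩ : ∃ p, j = p + 1 := ⟨j - 1, by omega⟩
  have hk := 𝓑.finrank_A
  obtain ⟨a, ha⟩ := 𝓑.exists_isGenericTuple h𝓑 hk
  have hp : p < k := by omega
  have hmono := ha.minDim_succ_le (j := p) (by omega)
  have hlast := ha.minDim_finrank
  have hpolar := finrank_polarSpace_of_isOrdinaryFlag e 𝓑 Q hA h𝓑 hF hFk hp
  change polarCodim _ k y F (p + 1) - polarCodim _ k y F p = _
  rw [polarCodim, polarCodim, if_pos hp, hpolar]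
  have hchar : character A (p + 1) = minDim A p - minDim A (p + 1) := rfl
  rw [hchar]
  by_cases hp' : p + 1 < k
  · rw [if_pos hp', finrank_polarSpace_of_isOrdinaryFlag e 𝓑 Q hA h𝓑 hF hFk hp']
    omega
  -- Here `c_k` is the codimension of `F k` itself, which fits the same formula because `dim A_k =
  -- 0`.
  · have hpk : p + 1 = k := by omega
    rw [if_neg hp', (hF.integral k le_rfl).1]
    rw [hk, ← hpk] at hlast
    omega

end Main
end LieTableau

theorem theorem3p1
    {E : Type*} [NormedAddCommGroup E] [NormedSpace ℝ E] [FiniteDimensional ℝ E] [CompleteSpace E]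
    {G : Type*} [TopologicalSpace G] [ChartedSpace E G] [Group G] [LieGroup 𝓘(ℝ, E) ∞ G]
    [ConnectedSpace G]
    {𝔤 : Type*} [LieRing 𝔤] [LieAlgebra ℝ 𝔤] (e : GroupLieAlgebra 𝓘(ℝ, E) G ≃ₗ⁅ℝ⁆ 𝔤)
    {𝔞 𝔟 : Submodule ℝ 𝔤} (A : Submodule ℝ (𝔞 →ₗ[ℝ] 𝔟)) (hA : LieTableau.IsTableauOver A)
    {k h s m : ℕ} (𝓑 : LieTableau.AdaptedBasis 𝔞 𝔟 k h s) (h𝓑 : 𝓑.IsGeneric A)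
    (Q : Module.Basis (Fin m) ℝ A) :
    EDS.IsLinearPfaffian (LieTableau.generators e 𝓑 Q) (LieTableau.alphaForm e 𝓑 m) ∧
      EDS.IsInInvolution (LieTableau.systemIdeal e 𝓑 Q) (LieTableau.independenceForm e 𝓑 m) ∧
      EDS.HasCartanCharacters (LieTableau.systemIdeal e 𝓑 Q) (LieTableau.independenceForm e 𝓑 m)
        (LieTableau.character A) := by
  have : FiniteDimensional ℝ 𝔤 := Module.Finite.of_basis 𝓑.basis
  exact ⟨LieTableau.isLinearPfaffian e 𝓑 Q, LieTableau.isInInvolution e 𝓑 Q hA h𝓑,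
    LieTableau.hasCartanCharacters e 𝓑 Q hA h𝓑⟩
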